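/- Let $\mathcal X$ be a connected, second countable smooth manifold of dimension $d$ with a smooth Riemannian metric whose distance makes $\mathcal X$ a complete metric space. Let $f$ be a $C^2$ vector field on $\mathcal X$ that is complete, and let $\psi_t(x)$, $t\in\mathbb R$, be the solution of $\dot x=f(x)$ with $\psi_0(x)=x$. Suppose that every forward trajectory $\{\psi_t(x): t\ge 0\}$ is bounded. A *cone field* $\mathcal K$ assigns to each $x\in\mathcal X$ a closed convex cone $\mathcal K(x)\subseteq T_x\mathcal X$ that is pointed ($\mathcal K(x)\cap-\mathcal K(x)=\{0\}$) and solid (it spans $T_x\mathcal X$), such that any two cones $\mathcal K(x_1)$, $\mathcal K(x_2)$ correspond to each other under a linear isomorphism $T_{x_1}\mathcal X\to T_{x_2}\mathcal X$, and such that locally $\mathcal K(x)=\{v\in T_x\mathcal X : k_i(x,v)\ge 0\ \forall i\in I\}$ for some index set $I\subseteq\mathbb Z$ and smooth functions $k_i$ on the tangent bundle. Suppose that the system is strictly differentially positive with respect to a cone field $\mathcal K$: $\partial\psi_t(x)\mathcal K(x)\subseteq\mathcal K(\psi_t(x))$ for all $x$ and $t\ge0$, and there are $T>0$ and a cone field $\mathcal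 R$ with $\mathcal R(x)\subseteq\operatorname{int}\mathcal K(x)\cup\{0\}$, such that for all $x_1,x_2$ some linear isomorphism $T_{x_1}\mathcal X\to T_{x_2}\mathcal X$ maps $\mathcal K(x_1)$ onto $\mathcal K(x_2)$ and $\mathcal R(x_1)$ onto $\mathcal R(x_2)$, and $\partial\psi_t(x)\mathcal K(x)\subseteq\mathcal R(\psi_t(x))$ for all $x$ and $t\ge T$. Suppose also that for each $x$ the set of unit vectors of $\mathcal K(x)$ is complete for the ($[0,\infty]$-valued) Hilbert metric of $\mathcal K(x)$. Let $\mathbf w$ be the Perron–Frobenius vector field: $\mathbf w(x)\in\operatorname{int}\mathcal K(x)$ is the unit vector such that $\lim_{s\to\infty}\partial\psi_s(\psi_{-s}(x))\,\mathcal K(\psi_{-s}(x))=\{\lambda\mathbf w(x):\lambda\ge0\}$ in the sense of Painlevé–Kuratowski. A fixed point is hyperbolic if no eigenvalue of the linearization of $f$ there has zero real part, and the dimension of its unstable manifold is the number of eigenvalues with positive real part, counted with algebraic multiplicity. An orbit $\psi_t(x)$ that converges to $p$ as $t\to-\infty$ (or $t\to+\infty$) is tangent to $\mathbf w(p)$ at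 $p$ if its unit tangent vector $f(\psi_t(x))/|f(\psi_t(x))|$ converges in the tangent bundle, as $t\to-\infty$ (respectively $t\to+\infty$), to $\mathbf w(p)$ or to $-\mathbf w(p)$. Then: 1. If $y_e$, $z_e$ are hyperbolic fixed points and $\psi_t(x)\to y_e$ as $t\to-\infty$, $\psi_t(x)\to z_e$ as $t\to+\infty$, and the orbit is tangent to $\mathbf w(y_e)$ at $y_e$, then it is tangent to $\mathbf w(z_e)$ at $z_e$. 2. If $p$ is a hyperbolic fixed point whose unstable manifold is one-dimensional, there is no homoclinic orbit to $p$: no $x\ne p$ satisfies $\psi_t(x)\to p$ both as $t\to-\infty$ and as $t\to+\infty$. -/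

import Mathlib

open Set Filter
open scoped Manifold ContDiff Topology Bundle NNReal ENNReal

noncomputable section

namespace DiffPos

/-- A smooth cone field on a `d`-dimensional manifold: each cone is closed, convex, pointed and
solid, any two of the cones are related by a linear isomorphism of the tangent spaces, and locally
the cones are cut out by inequalities `k i (x, v) ≥ 0` with functions `k i` that are smooth on the
tangent bundle. -/
structure ConeField (d : ℕ) (M : Type*) [TopologicalSpace M]
    [ChartedSpace (EuclideanSpace ℝ (Fin d)) M] [IsManifold (𝓡 d) ∞ M] where
  cone : ∀ x : M, Set (TangentSpace (𝓡 d) x)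
  isClosed_cone : ∀ x, IsClosed (cone x)
  zero_mem : ∀ x, (0 : TangentSpace (𝓡 d) x) ∈ cone x
  add_mem : ∀ x, ∀ v ∈ cone x, ∀ w ∈ cone x, v + w ∈ cone x
  smul_mem : ∀ x, ∀ c : ℝ, 0 ≤ c → ∀ v ∈ cone x, c • v ∈ cone x
  pointed : ∀ x, ∀ v ∈ cone x, -v ∈ cone x → v = 0
  solid : ∀ x, Submodule.span ℝ (cone x) = ⊤
  equivalent : ∀ x₁ x₂ : M, ∃ Γ : TangentSpace (𝓡 d) x₁ ≃ₗ[ℝ] TangentSpace (𝓡 d) x₂,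
    Γ '' cone x₁ = cone x₂
  smooth : ∀ x₀ : M, ∃ U : Set M, IsOpen U ∧ x₀ ∈ U ∧
    ∃ (S : Set ℤ) (k : ℤ → TangentBundle (𝓡 d) M → ℝ),
      (∀ i ∈ S, ContMDiffOn (𝓡 d).tangent 𝓘(ℝ, ℝ) ∞ (k i)
        {q : TangentBundle (𝓡 d) M | q.proj ∈ U}) ∧
      ∀ x ∈ U, ∀ v : TangentSpace (𝓡 d) x,
        v ∈ cone x ↔ ∀ i ∈ S, 0 ≤ k i (⟨x, v⟩ : TangentBundle (𝓡 d) M)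

section Hilbert

variable {V : Type*} [AddCommGroup V] [Module ℝ V]

/-- `M_K(v, w) = inf {c ≥ 0 | c w - v ∈ K}`, equal to `∞` when there is no such `c`. -/
def hilbertSup (K : Set V) (v w : V) : ℝ≥0∞ :=
  ⨅ (c : ℝ≥0) (_ : (c : ℝ) • w - v ∈ K), (c : ℝ≥0∞)

/-- `m_K(v, w) = sup {c ≥ 0 | v - c w ∈ K}`. -/
def hilbertInf (K : Set V) (v w : V) : ℝ≥0∞ :=
  ⨆ (c : ℝ≥0) (_ : v - (c : ℝ) • w ∈ K), (c : ℝ≥0∞)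

/-- Hilbert's projective metric `d_K(v, w) = log (M_K(v, w) / m_K(v, w))` of the cone `K`, used for
nonzero `v`, `w` in `K`; the value may be `∞`. -/
def hilbertDist (K : Set V) (v w : V) : EReal :=
  ENNReal.log (hilbertSup K v w / hilbertInf K v w)

/-- Every sequence in `B` that is Cauchy for the Hilbert metric of `K` converges in this metric to
a point of `B`. -/
def HilbertComplete (K B : Set V) : Prop :=
  ∀ v : ℕ → V, (∀ n, v n ∈ B) →
    (∀ ε : ℝ, 0 < ε → ∃ N, ∀ m ≥ N, ∀ n ≥ N, hilbertDist K (v m) (v n) < (ε : EReal)) →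
    ∃ w ∈ B, ∀ ε : ℝ, 0 < ε → ∃ N, ∀ n ≥ N, hilbertDist K (v n) w < (ε : EReal)

end Hilbert

/-- Painlevé–Kuratowski convergence of the sets `S s` to `L` along the filter `l`: the outer limit
is contained in `L`, and `L` is contained in the inner limit. -/
def PKTendsto {α V : Type*} [TopologicalSpace V] (S : α → Set V) (l : Filter α)
    (L : Set V) : Prop :=
  (∀ v, (∀ U ∈ 𝓝 v, ∃ᶠ s in l, (S s ∩ U).Nonempty) → v ∈ L) ∧
  (∀ v ∈ L, ∀ U ∈ 𝓝 v, ∀ᶠ s in l, (S s ∩ U).Nonempty)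

section Manifold

variable {d : ℕ} {M : Type*} [TopologicalSpace M]
  [ChartedSpace (EuclideanSpace ℝ (Fin d)) M]

/-- `ψ t x` is the value at time `t` of the (global) solution of `ẋ = f(x)` with `ψ 0 x = x`. -/
def IsCompleteFlow (f : ∀ x : M, TangentSpace (𝓡 d) x) (ψ : ℝ → M → M) : Prop :=
  ∀ x, ψ 0 x = x ∧ IsMIntegralCurve (I := 𝓡 d) (fun t => ψ t x) f

/-- The linearization `∂f(p)` in the coordinates of the chart at `p`: the derivative at `p` of the
coordinate expression of `f`. It is used at zeros `p` of `f` only, where it does not depend on the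
coordinates. -/
def linearization (f : ∀ x : M, TangentSpace (𝓡 d) x) (p : M) :
    EuclideanSpace ℝ (Fin d) →L[ℝ] EuclideanSpace ℝ (Fin d) :=
  fderiv ℝ (fun u : EuclideanSpace ℝ (Fin d) =>
      (mfderiv (𝓡 d) 𝓘(ℝ, EuclideanSpace ℝ (Fin d)) (extChartAt (𝓡 d) p)
        ((extChartAt (𝓡 d) p).symm u) (f ((extChartAt (𝓡 d) p).symm u)) :
          EuclideanSpace ℝ (Fin d)))
    (extChartAt (𝓡 d) p p)

/-- The complex eigenvalues of `∂f(p)`, listed with algebraic multiplicity. -/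
def eigenvalues (f : ∀ x : M, TangentSpace (𝓡 d) x) (p : M) :
    Multiset ℂ :=
  ((LinearMap.charpoly (linearization f p : EuclideanSpace ℝ (Fin d) →ₗ[ℝ]
    EuclideanSpace ℝ (Fin d))).map (algebraMap ℝ ℂ)).roots

/-- `p` is a hyperbolic fixed point of `ẋ = f(x)`. -/
def IsHyperbolicFixedPoint (f : ∀ x : M, TangentSpace (𝓡 d) x)
    (p : M) : Prop :=
  f p = 0 ∧ ∀ μ ∈ eigenvalues f p, μ.re ≠ 0

open Classical in
/-- The dimension of the unstable manifold of the hyperbolic fixed point `p`: the number of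
eigenvalues of `∂f(p)` with positive real part, counted with multiplicity. -/
def unstableDim (f : ∀ x : M, TangentSpace (𝓡 d) x) (p : M) : ℕ :=
  Multiset.card ((eigenvalues f p).filter fun μ => 0 < μ.re)

/-- Differential positivity. The solutions of the prolonged system `ẋ = f(x)`, `δẋ = ∂f(x) δx` are
the curves `t ↦ (ψ t x, ∂ψ_t(x) δx)`. -/
def DifferentiallyPositive [IsManifold (𝓡 d) ∞ M] (ψ : ℝ → M → M) (K : ConeField d M) : Prop :=
  ∀ x : M, ∀ v ∈ K.cone x, ∀ t : ℝ, 0 ≤ t →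
    mfderiv (𝓡 d) (𝓡 d) (ψ t) x v ∈ K.cone (ψ t x)

/-- (Uniform) strict differential positivity: after a fixed time `T` the cones `K` are mapped into
the cones of a cone field `R` with `R(x) ⊆ int K(x) ∪ {0}`, where all pairs `(K(x), R(x))` are
linearly isomorphic to each other. -/
def StrictlyDifferentiallyPositive [IsManifold (𝓡 d) ∞ M] (ψ : ℝ → M → M)
    (K : ConeField d M) : Prop :=
  DifferentiallyPositive ψ K ∧
  ∃ T : ℝ, 0 < T ∧ ∃ R : ConeField d M,
    (∀ x, R.cone x ⊆ interior (K.cone x) ∪ {0}) ∧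
    (∀ x₁ x₂ : M, ∃ Γ : TangentSpace (𝓡 d) x₁ ≃ₗ[ℝ] TangentSpace (𝓡 d) x₂,
      Γ '' K.cone x₁ = K.cone x₂ ∧ Γ '' R.cone x₁ = R.cone x₂) ∧
    ∀ x : M, ∀ v ∈ K.cone x, ∀ t : ℝ, T ≤ t →
      mfderiv (𝓡 d) (𝓡 d) (ψ t) x v ∈ R.cone (ψ t x)

/-- The subset `∂ψ_s(z) K(z)` of the tangent space at `x`, where `z = ψ_{-s}(x)`. -/
def pushedCone [IsManifold (𝓡 d) ∞ M] (ψ : ℝ → M → M) (K : ConeField d M) (x : M) (s : ℝ) :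
    Set (TangentSpace (𝓡 d) x) :=
  {v | ∃ u ∈ K.cone (ψ (-s) x),
    tangentMap (𝓡 d) (𝓡 d) (ψ s) (⟨ψ (-s) x, u⟩ : TangentBundle (𝓡 d) M) = ⟨x, v⟩}

section Riemannian

variable [IsManifold (𝓡 d) ∞ M] [Bundle.RiemannianBundle (fun x : M => TangentSpace (𝓡 d) x)]

/-- `v` is the Perron–Frobenius vector at `x`: a unit vector in the interior of `K(x)` such that the
cones `∂ψ_s(ψ_{-s}(x)) K(ψ_{-s}(x))` converge, as `s → ∞`, to the ray spanned by `v`. -/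
def IsPerronFrobeniusVector (ψ : ℝ → M → M) (K : ConeField d M) (x : M)
    (v : TangentSpace (𝓡 d) x) : Prop :=
  v ∈ interior (K.cone x) ∧ ‖v‖ = 1 ∧
  PKTendsto (pushedCone ψ K x) atTop {u | ∃ c : ℝ, 0 ≤ c ∧ u = c • v}

open Classical in
/-- The Perron–Frobenius vector field `w`: the value at `x` is the (unique) Perron–Frobenius vector at
`x`. -/
def perronFrobenius (ψ : ℝ → M → M) (K : ConeField d M) (x : M) : TangentSpace (𝓡 d) x :=
  if h : ∃ v, IsPerronFrobeniusVector ψ K x v then h.choose else 0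

/-- As `t` runs along the filter `l` (`atBot` or `atTop`), the orbit of `x` becomes tangent at `p`
to the line spanned by the unit vector `v` at `p`: the unit tangent vector of the orbit converges,
in the tangent bundle, to `v` or to `-v` at `p`. -/
def OrbitTangentAt (f : ∀ x : M, TangentSpace (𝓡 d) x) (ψ : ℝ → M → M) (x : M) (l : Filter ℝ)
    (p : M) (v : TangentSpace (𝓡 d) p) : Prop :=
  ∃ ε : ℝ, (ε = 1 ∨ ε = -1) ∧
    Tendsto (fun t => (⟨ψ t x, ‖f (ψ t x)‖⁻¹ • f (ψ t x)⟩ : TangentBundle (𝓡 d) M)) l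
      (𝓝 (⟨p, ε • v⟩ : TangentBundle (𝓡 d) M))

end Riemannian

end Manifold

end DiffPos

end

/-!
The argument rests on the linear Perron–Frobenius theorem at a fixed point `p` of the flow. There
the derivative `P` of `ψ_T` maps the nonzero vectors of the cone `K(p)` into its interior, so that
`P` has a dominant eigenvalue `μ > 0`, with an eigenvector `w` in the interior of the cone and a
positive functional `φ`, `φ ∘ P = μ φ`, and `μ⁻ⁿ Pⁿ → φ ⊗ w`
(`DiffPos.IsPointedCone.exists_isPerronTriple`). The Perron–Frobenius vector at `p` is `w`,
normalized (`DiffPos.perronFrobenius_eq`). The only regularity of the cone field that is used is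
that it is closed in the tangent bundle (`DiffPos.ConeField.isClosed_total`): in a chart around `p`,
all cones near `p` lie in one sector `‖v‖ ≤ C φ v`.

*Backward in time.* Suppose that the velocity of an orbit converging to `p` as `t → -∞` decays
backwards faster than `ρ⁻ⁿ`, where `ρ` separates `μ` from the rest of the spectrum of `P` (with
powers of `P` in place of `P`, to make the gap wide). By compactness there is a nonzero vector all
of whose backward images lie in the cones; it decays at the dominant rate. The combination of this
vector and the velocity on which `φ` vanishes decays faster than `ρ⁻ⁿ` as well, while a nonzero
vector off the dominant direction cannot; so it is zero and the velocity lies in `K ∪ -K`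
(`DiffPos.mem_or_neg_mem_of_tendsto_backward`, `DiffPos.exists_smul_field_mem_cone`). If the orbit
is tangent to `w` at `p`, its velocity decays at the dominant rate
(`DiffPos.tendsto_field_backward`). If `p` is hyperbolic with one-dimensional unstable manifold,
then `μ > 1` and `Pⁿ` tends to zero on the kernel of `φ`
(`DiffPos.IsPerronTriple.one_lt_and_tendsto_zero`), so that `ρ = 1` will do: the velocity tends to
`f(p) = 0`.

*Forward in time.* By positivity the velocity stays in `K` or in `-K`. Every limit direction at a
limit point `p` lies in `⋂ₙ Pⁿ K(p)`, which is the ray of `w`; hence the orbit is tangent to `w` at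
`p` (`DiffPos.orbitTangentAt_of_mem_cone`), which is the first claim. On a homoclinic orbit,
moreover, `μ > 1` prevents the value of `φ` on the velocity from decreasing, although the velocity
tends to zero at `p` (`DiffPos.field_eq_zero_of_mem_cone`); this is the second claim.

That the flow of a `C²` field is continuously differentiable, with derivative `exp (t A)` at a fixed
point of linearization `A`, is derived from the variational equation (`DiffPos.exists_local_flow`,
`DiffPos.contMDiff_flow`, `DiffPos.flowDeriv_eq_exp`).
-/

/-! ### Closed pointed cones and the Perron–Frobenius theorem -/

namespace DiffPos

open scoped Pointwise

/-- A closed, convex, pointed cone of a normed space. -/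
structure IsPointedCone {E : Type*} [NormedAddCommGroup E] [NormedSpace ℝ E] (K : Set E) :
    Prop where
  isClosed : IsClosed K
  zero_mem : (0 : E) ∈ K
  add_mem : ∀ v ∈ K, ∀ w ∈ K, v + w ∈ K
  smul_mem : ∀ c : ℝ, 0 ≤ c → ∀ v ∈ K, c • v ∈ K
  pointed : ∀ v ∈ K, -v ∈ K → v = 0

/-- The conclusion of the Perron–Frobenius theorem for an operator `P` that maps the nonzero vectors
of a cone `K` to the interior of `K`: a positive eigenvalue `μ` with an eigenvector `w` in the
interior of `K` and an eigenfunctional `φ` that is positive on `K`, normalized by `φ w = 1`, such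
that `μ⁻ⁿ Pⁿ` converges to the projection `φ ⊗ w`. -/
structure IsPerronTriple {E : Type*} [NormedAddCommGroup E] [NormedSpace ℝ E] (P : E →L[ℝ] E)
    (K : Set E) (μ : ℝ) (w : E) (φ : E →L[ℝ] ℝ) : Prop where
  pos : 0 < μ
  mem_interior : w ∈ interior K
  map_eq : P w = μ • w
  apply_map : ∀ x, φ (P x) = μ * φ x
  apply_self : φ w = 1
  apply_pos : ∀ v ∈ K, v ≠ 0 → 0 < φ v
  tendsto : ∀ x, Tendsto (fun n : ℕ => (μ⁻¹ ^ n) • (P ^ n) x) atTop (𝓝 (φ x • w))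

variable {E : Type*} [NormedAddCommGroup E] [NormedSpace ℝ E] {K : Set E}

namespace IsPointedCone

/-- An interior point of a cone is an order unit. -/
lemma exists_orderUnit (hK : IsPointedCone K) {w : E} (hw : w ∈ interior K) :
    ∃ C : ℝ, 0 < C ∧ ∀ v : E, (C * ‖v‖) • w + v ∈ K := by
  obtain ⟨ε, hε, hball⟩ := Metric.mem_nhds_iff.1 (mem_interior_iff_mem_nhds.1 hw)
  refine ⟨2 / ε, by positivity, fun v => ?_⟩
  by_cases hv : v = 0
  · simpa [hv] using hK.zero_mem
  have hn : 0 < ‖v‖ := norm_pos_iff.2 hv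
  have hmem : w + (ε / (2 * ‖v‖)) • v ∈ K := by
    apply hball
    rw [Metric.mem_ball, dist_eq_norm, add_sub_cancel_left, norm_smul, Real.norm_of_nonneg
      (by positivity)]
    field_simp
    norm_num
  have := hK.smul_mem (2 / ε * ‖v‖) (by positivity) _ hmem
  rw [smul_add, smul_smul] at this
  convert this using 2
  have : 2 / ε * ‖v‖ * (ε / (2 * ‖v‖)) = 1 := by field_simp
  rw [this, one_smul]

lemma exists_pos_add_smul_mem (hK : IsPointedCone K) {w : E} (hw : w ∈ interior K) (v : E) :
    ∃ ε : ℝ, 0 < ε ∧ w + ε • v ∈ K := by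
  obtain ⟨C, hC, h⟩ := hK.exists_orderUnit hw
  refine ⟨(C * (‖v‖ + 1))⁻¹, by positivity, ?_⟩
  have h1 := h ((C * (‖v‖ + 1))⁻¹ • v)
  have h2 : w + (C * (‖v‖ + 1))⁻¹ • v = ((C * ‖(C * (‖v‖ + 1))⁻¹ • v‖) • w +
      (C * (‖v‖ + 1))⁻¹ • v) + (1 - C * ‖(C * (‖v‖ + 1))⁻¹ • v‖) • w := by
    module
  rw [h2]
  refine hK.add_mem _ h1 _ (hK.smul_mem _ ?_ _ (interior_subset hw))
  rw [norm_smul, Real.norm_of_nonneg (by positivity)]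
  have : C * ((C * (‖v‖ + 1))⁻¹ * ‖v‖) = ‖v‖ / (‖v‖ + 1) := by field_simp
  rw [this, sub_nonneg, div_le_one (by positivity)]
  linarith

lemma ne_zero_of_mem_interior (hK : IsPointedCone K) {w : E} (hw : w ∈ interior K) {v : E}
    (hv : v ≠ 0) : w ≠ 0 := by
  rintro rfl
  obtain ⟨C, -, h⟩ := hK.exists_orderUnit hw
  refine hv (hK.pointed v (by simpa using h v) (by simpa using h (-v)))

lemma nonneg_of_smul_mem (hK : IsPointedCone K) {w : E} (hw : w ∈ K) (hw0 : w ≠ 0) {c : ℝ}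
    (h : c • w ∈ K) : 0 ≤ c := by
  by_contra! hc
  refine hw0 (hK.pointed w hw ?_)
  have := hK.smul_mem (-c)⁻¹ (by rw [inv_nonneg]; linarith) _ h
  rw [smul_smul] at this
  convert this using 1
  have : (-c)⁻¹ * c = -1 := by field_simp [hc.ne]
  rw [this, neg_one_smul]

/-- A pointed closed cone in finite dimension is normal. -/
lemma exists_mul_norm_le_norm_add [FiniteDimensional ℝ E] (hK : IsPointedCone K) :
    ∃ c : ℝ, 0 < c ∧ ∀ a ∈ K, ∀ b ∈ K, c * ‖a‖ ≤ ‖a + b‖ := by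
  have hS : IsCompact (Metric.sphere (0 : E) 1 ∩ K) :=
    (isCompact_sphere _ _).inter_right hK.isClosed
  have hcl : IsClosed ((Metric.sphere (0 : E) 1 ∩ K) + K) := hK.isClosed.add_left_of_isCompact hS
  have h0 : (0 : E) ∉ (Metric.sphere (0 : E) 1 ∩ K) + K := by
    rintro ⟨a, ⟨ha1, ha⟩, b, hb, hab⟩
    have hba : b = -a := eq_neg_of_add_eq_zero_right hab
    have := hK.pointed a ha (hba ▸ hb)
    simp [this] at ha1
  obtain ⟨c, hc, hball⟩ := Metric.mem_nhds_iff.1 (hcl.isOpen_compl.mem_nhds h0)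
  refine ⟨c, hc, fun a ha b hb => ?_⟩
  by_cases ha0 : a = 0
  · simp [ha0]
  have hn : 0 < ‖a‖ := norm_pos_iff.2 ha0
  by_contra! hlt
  refine hball (a := ‖a‖⁻¹ • (a + b)) ?_ ?_
  · rw [mem_ball_zero_iff, norm_smul, norm_inv, norm_norm, inv_mul_lt_iff₀ hn]
    linarith [mul_comm c ‖a‖]
  · rw [smul_add]
    refine Set.add_mem_add ⟨?_, hK.smul_mem _ (by positivity) _ ha⟩
      (hK.smul_mem _ (by positivity) _ hb)
    rw [mem_sphere_zero_iff_norm, norm_smul, norm_inv, norm_norm, inv_mul_cancel₀ hn.ne']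

/-- The eigenvector is a maximizer of the Collatz–Wielandt quotient, the largest `r` with
`P x - r x ∈ K`. -/
lemma exists_eigenvector [FiniteDimensional ℝ E] (hK : IsPointedCone K) {P : E →L[ℝ] E}
    (hP : ∀ v ∈ K, v ≠ 0 → P v ∈ interior K) {v₀ : E} (hv₀ : v₀ ∈ K) (hv₀' : v₀ ≠ 0) :
    ∃ (μ : ℝ) (w : E), 0 < μ ∧ w ∈ interior K ∧ w ≠ 0 ∧ P w = μ • w := by
  obtain ⟨c, hc, hnorm⟩ := hK.exists_mul_norm_le_norm_add
  let S : Set (ℝ × E) := {q | 0 ≤ q.1 ∧ q.2 ∈ K ∧ ‖q.2‖ = 1 ∧ P q.2 - q.1 • q.2 ∈ K}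
  have hScl : IsClosed S := by
    refine (isClosed_le continuous_const continuous_fst).inter
      ((hK.isClosed.preimage continuous_snd).inter
      ((isClosed_eq continuous_snd.norm continuous_const).inter (hK.isClosed.preimage ?_)))
    fun_prop
  have hSb : S ⊆ Metric.closedBall (0 : ℝ) (‖P‖ / c) ×ˢ Metric.closedBall (0 : E) 1 := by
    rintro ⟨r, x⟩ ⟨hr, hx, hx1, hm⟩
    refine ⟨?_, by simpa using hx1.le⟩
    simp only [] at hr hx hx1 hm
    rw [mem_closedBall_zero_iff, Real.norm_of_nonneg hr, le_div_iff₀ hc]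
    have h1 := hnorm (r • x) (hK.smul_mem r hr x hx) _ hm
    rw [add_sub_cancel, norm_smul, hx1, Real.norm_of_nonneg hr] at h1
    have h2 := P.le_opNorm x
    rw [hx1] at h2
    linarith
  have hScomp : IsCompact S :=
    ((isCompact_closedBall _ _).prod (isCompact_closedBall _ _)).of_isClosed_subset hScl hSb
  have hunit : ∀ v ∈ K, v ≠ 0 → ∀ r : ℝ, 0 ≤ r → P v - r • v ∈ K → (r, ‖v‖⁻¹ • v) ∈ S := by
    intro v hv hv0 r hr hm
    have hn : 0 < ‖v‖ := norm_pos_iff.2 hv0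
    refine ⟨hr, hK.smul_mem _ (by positivity) _ hv, ?_, ?_⟩
    · simp [norm_smul, hn.ne']
    · have := hK.smul_mem ‖v‖⁻¹ (by positivity) _ hm
      simp only [map_smul]
      convert this using 1
      module
  have hSne : S.Nonempty := by
    refine ⟨_, hunit v₀ hv₀ hv₀' 0 le_rfl ?_⟩
    simpa using interior_subset (hP v₀ hv₀ hv₀')
  obtain ⟨⟨μ, x⟩, ⟨hμ, hx, hx1, hm⟩, hmax⟩ :=
    hScomp.exists_isMaxOn hSne continuous_fst.continuousOn
  simp only [] at hμ hx hx1 hm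
  have hx0 : x ≠ 0 := by rintro rfl; simp at hx1
  have hPx := hP x hx hx0
  have hPx0 := hK.ne_zero_of_mem_interior hPx hx0
  have heig : P x - μ • x = 0 := by
    by_contra hne
    obtain ⟨ε, hε, hmem⟩ := hK.exists_pos_add_smul_mem (hP _ hm hne) (-(P x))
    have := hmax (hunit (P x) (interior_subset hPx) hPx0 (μ + ε) (by positivity) (by
      convert hmem using 1
      simp only [map_sub, map_smul]
      module))
    simp only [mem_ofPred_eq] at this
    linarith
  have heig' : P x = μ • x := sub_eq_zero.1 heig
  have hμ0 : μ ≠ 0 := by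
    rintro rfl
    simp [heig'] at hPx0
  refine ⟨μ, P x, lt_of_le_of_ne hμ hμ0.symm, hPx, hPx0, ?_⟩
  nth_rewrite 1 [heig']
  rw [map_smul]

end IsPointedCone

/-- The gauge `inf {c | c w - x ∈ K}` of a vector `x` relative to an order unit `w`. -/
noncomputable def coneGauge (K : Set E) (w x : E) : ℝ := sInf {c : ℝ | c • w - x ∈ K}

namespace IsPointedCone

variable {w : E}

lemma coneGauge_aux (hK : IsPointedCone K) (hw : w ∈ interior K) (hw0 : w ≠ 0) :
    ∃ C : ℝ, 0 < C ∧ ∀ x, C * ‖x‖ ∈ {c : ℝ | c • w - x ∈ K} ∧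
      ∀ c ∈ {c : ℝ | c • w - x ∈ K}, -(C * ‖x‖) ≤ c := by
  obtain ⟨C, hC, h⟩ := hK.exists_orderUnit hw
  refine ⟨C, hC, fun x => ⟨?_, fun c hc => ?_⟩⟩
  · have := h (-x)
    rwa [norm_neg, ← sub_eq_add_neg] at this
  · have h1 := hK.add_mem _ hc _ (h x)
    have h2 : c • w - x + ((C * ‖x‖) • w + x) = (c + C * ‖x‖) • w := by module
    have := hK.nonneg_of_smul_mem (interior_subset hw) hw0 (h2 ▸ h1)
    linarith

lemma coneGauge_le (hK : IsPointedCone K) (hw : w ∈ interior K) (hw0 : w ≠ 0) {x : E} {c : ℝ}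
    (h : c • w - x ∈ K) : coneGauge K w x ≤ c := by
  obtain ⟨C, -, hC⟩ := hK.coneGauge_aux hw hw0
  exact csInf_le ⟨_, (hC x).2⟩ h

lemma coneGauge_mem (hK : IsPointedCone K) (hw : w ∈ interior K) (hw0 : w ≠ 0) (x : E) :
    coneGauge K w x • w - x ∈ K := by
  obtain ⟨C, -, hC⟩ := hK.coneGauge_aux hw hw0
  have hcl : IsClosed {c : ℝ | c • w - x ∈ K} := hK.isClosed.preimage (by fun_prop)
  exact hcl.csInf_mem ⟨_, (hC x).1⟩ ⟨_, (hC x).2⟩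

lemma continuous_coneGauge (hK : IsPointedCone K) (hw : w ∈ interior K) (hw0 : w ≠ 0) :
    Continuous (coneGauge K w) := by
  obtain ⟨C, hC, h⟩ := hK.exists_orderUnit hw
  refine (LipschitzWith.of_le_add_mul C.toNNReal fun x y => ?_).continuous
  rw [Real.coe_toNNReal _ hC.le, dist_eq_norm]
  refine hK.coneGauge_le hw hw0 ?_
  have h1 := hK.add_mem _ (hK.coneGauge_mem hw hw0 y) _ (h (y - x))
  rw [norm_sub_rev] at h1
  convert h1 using 1
  module

variable {P : E →L[ℝ] E}

/-- The gauge is a strict Lyapunov function of `P` off the line of the fixed vector `w`. -/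
lemma coneGauge_map_lt (hK : IsPointedCone K) (hP : ∀ v ∈ K, v ≠ 0 → P v ∈ interior K)
    (hw : w ∈ interior K) (hw0 : w ≠ 0) (hPw : P w = w) {x : E}
    (hx : x ≠ coneGauge K w x • w) : coneGauge K w (P x) < coneGauge K w x := by
  obtain ⟨ε, hε, h⟩ := hK.exists_pos_add_smul_mem
    (hP _ (hK.coneGauge_mem hw hw0 x) (sub_ne_zero.2 hx.symm)) (-w)
  have : coneGauge K w (P x) ≤ coneGauge K w x - ε := hK.coneGauge_le hw hw0 (by
    convert h using 1
    simp only [map_sub, map_smul, hPw]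
    module)
  linarith

lemma map_mem (hK : IsPointedCone K) (hP : ∀ v ∈ K, v ≠ 0 → P v ∈ interior K) {v : E}
    (hv : v ∈ K) : P v ∈ K := by
  by_cases h : v = 0
  · simpa [h] using hK.zero_mem
  · exact interior_subset (hP v hv h)

lemma pow_map_mem (hK : IsPointedCone K) (hP : ∀ v ∈ K, v ≠ 0 → P v ∈ interior K) {v : E}
    (hv : v ∈ K) (n : ℕ) : (P ^ n) v ∈ K := by
  induction n with
  | zero => simpa using hv
  | succ n ih => rw [pow_succ']; exact hK.map_mem hP ih

lemma tendsto_pow_of_fixed [FiniteDimensional ℝ E] (hK : IsPointedCone K)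
    (hP : ∀ v ∈ K, v ≠ 0 → P v ∈ interior K)
    (hw : w ∈ interior K) (hw0 : w ≠ 0) (hPw : P w = w) (x : E) :
    ∃ c : ℝ, Tendsto (fun n : ℕ => (P ^ n) x) atTop (𝓝 (c • w)) := by
  obtain ⟨C, hC, h⟩ := hK.exists_orderUnit hw
  obtain ⟨k, hk, hnorm⟩ := hK.exists_mul_norm_le_norm_add
  have hPnw : ∀ n : ℕ, (P ^ n) w = w := by
    intro n
    induction n with
    | zero => simp
    | succ n ih => rw [pow_succ']; simp [ih, hPw]
  have hbdd : ∀ n : ℕ, (P ^ n) x ∈ Metric.closedBall (0 : E)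
      (‖(2 * (C * ‖x‖)) • w‖ / k + ‖(C * ‖x‖) • w‖) := by
    intro n
    have h1 := hK.pow_map_mem hP (h x) n
    have h2 := hK.pow_map_mem hP (h (-x)) n
    simp only [map_add, map_smul, map_neg, hPnw, norm_neg] at h1 h2
    have h3 := hnorm _ h1 _ h2
    have h4 : (C * ‖x‖) • w + (P ^ n) x + ((C * ‖x‖) • w + -(P ^ n) x) = (2 * (C * ‖x‖)) • w := by
      module
    rw [h4, mul_comm, ← le_div_iff₀ hk] at h3
    rw [mem_closedBall_zero_iff]
    have h5 := norm_sub_le ((C * ‖x‖) • w + (P ^ n) x) ((C * ‖x‖) • w)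
    rw [add_sub_cancel_left] at h5
    linarith
  have hanti : Antitone fun n : ℕ => coneGauge K w ((P ^ n) x) := by
    refine antitone_nat_of_succ_le fun n => hK.coneGauge_le hw hw0 ?_
    have := hK.map_mem hP (hK.coneGauge_mem hw hw0 ((P ^ n) x))
    rw [pow_succ']
    simpa [hPw] using this
  have hbelow : BddBelow (range fun n : ℕ => coneGauge K w ((P ^ n) x)) := by
    obtain ⟨B, hB⟩ := (isCompact_closedBall (0 : E) (‖(2 * (C * ‖x‖)) • w‖ / k +
      ‖(C * ‖x‖) • w‖)).bddBelow_image (hK.continuous_coneGauge hw hw0).continuousOn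
    refine ⟨B, ?_⟩
    rintro _ ⟨n, rfl⟩
    exact hB ⟨_, hbdd n, rfl⟩
  have hlim := tendsto_atTop_ciInf hanti hbelow
  set m := ⨅ n : ℕ, coneGauge K w ((P ^ n) x)
  refine ⟨m, (isCompact_closedBall _ _).tendsto_nhds_of_unique_mapClusterPt
    (Eventually.of_forall hbdd) fun y _ hy => ?_⟩
  obtain ⟨g, hg, hgy⟩ := mapClusterPt_iff_ultrafilter.1 hy
  have hc := hK.continuous_coneGauge hw hw0
  have e1 : coneGauge K w y = m :=
    tendsto_nhds_unique ((hc.tendsto y).comp hgy) (hlim.mono_left hg)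
  have e2 : coneGauge K w (P y) = m := by
    have h1 : Tendsto (fun n : ℕ => coneGauge K w ((P ^ (n + 1)) x)) g
        (𝓝 (coneGauge K w (P y))) := by
      have := (hc.tendsto (P y)).comp ((P.continuous.tendsto y).comp hgy)
      refine this.congr fun n => ?_
      simp [pow_succ']
    exact tendsto_nhds_unique h1 ((hlim.comp (tendsto_add_atTop_nat 1)).mono_left hg)
  by_contra hne
  have := hK.coneGauge_map_lt hP hw hw0 hPw (x := y) (by rwa [e1])
  linarith

end IsPointedCone

/-- **Perron–Frobenius theorem** for a closed pointed cone of a finite-dimensional space. -/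
theorem IsPointedCone.exists_isPerronTriple [FiniteDimensional ℝ E] (hK : IsPointedCone K)
    {P : E →L[ℝ] E} (hP : ∀ v ∈ K, v ≠ 0 → P v ∈ interior K) {v₀ : E} (hv₀ : v₀ ∈ K)
    (hv₀' : v₀ ≠ 0) : ∃ μ w φ, IsPerronTriple P K μ w φ := by
  obtain ⟨μ, w, hμ, hw, hw0, hPw⟩ := hK.exists_eigenvector hP hv₀ hv₀'
  have hQ : ∀ v ∈ K, v ≠ 0 → (μ⁻¹ • P) v ∈ interior K := by
    intro v hv hv0
    have h1 : μ⁻¹ • P v ∈ μ⁻¹ • interior K := smul_mem_smul_set (hP v hv hv0)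
    rw [← interior_smul₀ (inv_ne_zero hμ.ne')] at h1
    refine interior_mono ?_ h1
    rintro _ ⟨u, hu, rfl⟩
    exact hK.smul_mem _ (by positivity) _ hu
  have hQw : (μ⁻¹ • P) w = w := by simp [hPw, smul_smul, hμ.ne']
  have hpow : ∀ (n : ℕ) x, ((μ⁻¹ • P) ^ n) x = (μ⁻¹ ^ n) • (P ^ n) x := by
    intro n x
    rw [smul_pow]
    rfl
  have hpow_w : ∀ n : ℕ, (μ⁻¹ ^ n) • (P ^ n) w = w := by
    intro n
    rw [← hpow]
    induction n with
    | zero => simp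
    | succ n ih => rw [pow_succ']; exact (congrArg _ ih).trans hQw
  choose c hc using hK.tendsto_pow_of_fixed hQ hw hw0 hQw
  simp only [hpow] at hc
  have huniq : ∀ {a b : ℝ}, a • w = b • w → a = b := fun h => smul_left_injective ℝ hw0 h
  let φ₀ : E →ₗ[ℝ] ℝ :=
    { toFun := c
      map_add' := fun x y => huniq (tendsto_nhds_unique (hc (x + y)) (by
        have := (hc x).add (hc y)
        simpa [← add_smul] using this))
      map_smul' := fun r x => huniq (tendsto_nhds_unique (hc (r • x)) (by
        have := (hc x).const_smul r
        simpa [smul_smul, mul_comm] using this)) }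
  have hcw : c w = 1 := huniq (tendsto_nhds_unique (hc w) (by
    rw [one_smul]
    exact tendsto_const_nhds.congr fun n => (hpow_w n).symm))
  have hcP : ∀ x, c (P x) = μ * c x := fun x => huniq (tendsto_nhds_unique (hc (P x)) (by
    have h1 := ((hc x).comp (tendsto_add_atTop_nat 1)).const_smul μ
    rw [smul_smul] at h1
    refine h1.congr fun n => ?_
    simp only [Function.comp, smul_smul]
    rw [pow_succ, pow_succ P, mul_comm (μ⁻¹ ^ n), ← mul_assoc, mul_inv_cancel₀ hμ.ne', one_mul]
    rfl))
  have hnonneg : ∀ x ∈ K, 0 ≤ c x := fun x hx =>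
    hK.nonneg_of_smul_mem (interior_subset hw) hw0 (hK.isClosed.mem_of_tendsto (hc x)
      (Eventually.of_forall fun n => hK.smul_mem _ (by positivity) _ (hK.pow_map_mem hP hx n)))
  refine ⟨μ, w, φ₀.toContinuousLinearMap, hμ, hw, hPw, hcP, hcw, fun v hv hv0 => ?_, hc⟩
  obtain ⟨ε, hε, h⟩ := hK.exists_pos_add_smul_mem (hP v hv hv0) (-w)
  have h1 : 0 ≤ φ₀ (P v + ε • -w) := hnonneg _ h
  have h2 : φ₀ (P v) = μ * φ₀ v := hcP v
  have h3 : φ₀ w = 1 := hcw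
  rw [map_add, map_smul, map_neg, h2, h3] at h1
  have : 0 < μ * φ₀ v := by
    simp only [smul_eq_mul] at h1
    linarith
  exact pos_of_mul_pos_right this hμ.le

/-- In finite dimension pointwise convergence of operators is convergence in norm. -/
lemma tendsto_clm_of_forall_apply {F ι : Type*} [NormedAddCommGroup F] [NormedSpace ℝ F]
    [FiniteDimensional ℝ E] {l : Filter ι} {f : ι → E →L[ℝ] F} {g : E →L[ℝ] F}
    (h : ∀ x, Tendsto (fun i => f i x) l (𝓝 (g x))) : Tendsto f l (𝓝 g) := by
  let e : (E →L[ℝ] F) ≃L[ℝ] Fin (Module.finrank ℝ E) → F :=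
    ((ContinuousLinearEquiv.ofFinrankEq (Module.finrank_fin_fun ℝ).symm).arrowCongr
      (1 : F ≃L[ℝ] F)).trans (ContinuousLinearEquiv.piRing _)
  rw [e.toHomeomorph.isInducing.tendsto_nhds_iff]
  exact tendsto_pi_nhds.2 fun i => h _

namespace IsPerronTriple

variable {P : E →L[ℝ] E} {μ : ℝ} {w : E} {φ : E →L[ℝ] ℝ}

lemma ne_zero (h : IsPerronTriple P K μ w φ) : w ≠ 0 := by
  rintro rfl
  simpa using h.apply_self

lemma apply_pow (h : IsPerronTriple P K μ w φ) (n : ℕ) (x : E) :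
    φ ((P ^ n) x) = μ ^ n * φ x := by
  induction n with
  | zero => simp
  | succ n ih => rw [pow_succ', mul_apply_eq_comp, h.apply_map, ih]; ring

/-- On the cone the norm is controlled by the Perron functional. -/
lemma exists_norm_le [FiniteDimensional ℝ E] (hK : IsPointedCone K)
    (h : IsPerronTriple P K μ w φ) : ∃ C : ℝ, 0 < C ∧ ∀ v ∈ K, ‖v‖ ≤ C * φ v := by
  have hS : IsCompact (Metric.sphere (0 : E) 1 ∩ K) :=
    (isCompact_sphere _ _).inter_right hK.isClosed
  obtain hne | hne := (Metric.sphere (0 : E) 1 ∩ K).eq_empty_or_nonempty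
  · refine ⟨1, one_pos, fun v hv => ?_⟩
    by_cases hv0 : v = 0
    · simp [hv0]
    · have hn : 0 < ‖v‖ := norm_pos_iff.2 hv0
      have : ‖v‖⁻¹ • v ∈ Metric.sphere (0 : E) 1 ∩ K :=
        ⟨by simp [norm_smul, hn.ne'], hK.smul_mem _ (by positivity) _ hv⟩
      simp [hne] at this
  · obtain ⟨x, ⟨hx1, hx⟩, hmin⟩ := hS.exists_isMinOn hne φ.continuous.continuousOn
    have hx0 : x ≠ 0 := by rintro rfl; simp at hx1
    have hφx := h.apply_pos x hx hx0
    refine ⟨(φ x)⁻¹, by positivity, fun v hv => ?_⟩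
    by_cases hv0 : v = 0
    · simp [hv0]
    · have hn : 0 < ‖v‖ := norm_pos_iff.2 hv0
      have : ‖v‖⁻¹ • v ∈ Metric.sphere (0 : E) 1 ∩ K :=
        ⟨by simp [norm_smul, hn.ne'], hK.smul_mem _ (by positivity) _ hv⟩
      have h1 : φ x ≤ φ (‖v‖⁻¹ • v) := hmin this
      rw [map_smul, smul_eq_mul, ← div_eq_inv_mul, le_div_iff₀ hn] at h1
      rw [← div_eq_inv_mul, le_div_iff₀ hφx]
      linarith

/-- The images `Pⁿ K` shrink to the ray of the Perron vector. -/
lemma eq_smul_of_forall_pow [FiniteDimensional ℝ E] (hK : IsPointedCone K)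
    (h : IsPerronTriple P K μ w φ) {v : E} (hv : ∀ n : ℕ, ∃ k ∈ K, (P ^ n) k = v) :
    v = φ v • w := by
  obtain ⟨C, hC, hnorm⟩ := h.exists_norm_le hK
  choose k hk hkv using hv
  -- the rescaled preimages stay in a bounded set, on which the convergence is uniform
  have hμ := h.pos
  have hunif : Tendsto (fun n : ℕ => (μ⁻¹ ^ n) • (P ^ n)) atTop (𝓝 (φ.smulRight w)) :=
    tendsto_clm_of_forall_apply h.tendsto
  have hφk : ∀ n, φ (μ ^ n • k n) = φ v := fun n => by
    rw [map_smul, smul_eq_mul, ← h.apply_pow, hkv]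
  have hb : ∀ n, ‖v - φ v • w‖ ≤ ‖(μ⁻¹ ^ n) • (P ^ n) - φ.smulRight w‖ * (C * φ v) := by
    intro n
    have h1 := ((μ⁻¹ ^ n) • (P ^ n) - φ.smulRight w).le_opNorm (μ ^ n • k n)
    have h2 : ((μ⁻¹ ^ n) • (P ^ n) - φ.smulRight w) (μ ^ n • k n) = v - φ v • w := by
      rw [sub_apply, ContinuousLinearMap.smulRight_apply, hφk,
        smul_apply, map_smul, hkv, smul_smul, inv_pow,
        inv_mul_cancel₀ (by positivity), one_smul]
    have h3 := hnorm _ (hK.smul_mem (μ ^ n) (by positivity) _ (hk n))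
    rw [hφk] at h3
    rw [h2] at h1
    exact h1.trans (by gcongr)
  have hz : Tendsto (fun n : ℕ => ‖(μ⁻¹ ^ n) • (P ^ n) - φ.smulRight w‖ * (C * φ v)) atTop
      (𝓝 0) := by
    have := ((tendsto_iff_norm_sub_tendsto_zero.1 hunif).mul_const (C * φ v))
    simpa using this
  have := ge_of_tendsto' hz hb
  exact sub_eq_zero.1 (norm_le_zero_iff.1 this)

end IsPerronTriple

end DiffPos

/-! ### Backward orbits of perturbations of an operator with a dominant direction -/

namespace DiffPos

variable {E : Type*} [NormedAddCommGroup E] [NormedSpace ℝ E]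

/-- A backward orbit that stays near the dominant direction decays backwards in time faster than
`ρ⁻ⁿ`. -/
lemma tendsto_backward_orbit_of_norm_le {G : E →L[ℝ] E} {φ : E →L[ℝ] ℝ} {ν ρ C : ℝ} (hρ : 0 < ρ)
    (hC : 0 < C) (hν : 2 * ρ ≤ ν) (hG : ∀ v, φ (G v) = ν * φ v) :
    ∃ δ : ℝ, 0 < δ ∧ ∀ (D : ℕ → E →L[ℝ] E) (e : ℕ → E), (∀ n, ‖D n - G‖ ≤ δ) →
      (∀ n, e n = D n (e (n + 1))) → (∀ n, ‖e n‖ ≤ C * |φ (e n)|) →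
      Tendsto (fun n => ρ ^ n * ‖e n‖) atTop (𝓝 0) := by
  refine ⟨ρ / (2 * C * (‖φ‖ + 1)), by positivity, fun D e hD he hn => ?_⟩
  have hstep : ∀ n, 3 / 2 * ρ * |φ (e (n + 1))| ≤ |φ (e n)| := by
    intro n
    set x := e (n + 1)
    have h1 : φ (e n) = ν * φ x + φ ((D n - G) x) := by
      rw [he n, sub_apply, map_sub, hG]; ring
    have h2 : |φ ((D n - G) x)| ≤ ρ / 2 * |φ x| := by
      calc |φ ((D n - G) x)| ≤ ‖φ‖ * ‖(D n - G) x‖ := φ.le_opNorm _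
        _ ≤ ‖φ‖ * (‖D n - G‖ * ‖x‖) := by gcongr; exact (D n - G).le_opNorm _
        _ ≤ (‖φ‖ + 1) * (ρ / (2 * C * (‖φ‖ + 1)) * (C * |φ x|)) := by
          gcongr
          · linarith
          · exact hD n
          · exact hn _
        _ = ρ / 2 * |φ x| := by field_simp
    have h3 : ν * |φ x| ≤ |φ (e n)| + |φ ((D n - G) x)| := by
      have h4 : ν * φ x = φ (e n) - φ ((D n - G) x) := by rw [h1]; ring
      calc ν * |φ x| = |ν * φ x| := by rw [abs_mul, abs_of_nonneg (by linarith : 0 ≤ ν)]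
        _ ≤ _ := by rw [h4]; exact abs_sub _ _
    have h5 : 2 * ρ * |φ x| ≤ ν * |φ x| := by gcongr
    linarith
  have hpow : ∀ n, ρ ^ n * |φ (e n)| ≤ (2 / 3) ^ n * |φ (e 0)| := by
    intro n
    induction n with
    | zero => simp
    | succ n ih =>
      have h1 : ρ ^ n * (3 / 2 * ρ * |φ (e (n + 1))|) ≤ ρ ^ n * |φ (e n)| := by
        gcongr
        exact hstep n
      rw [pow_succ, pow_succ]
      linarith
  have hlim : Tendsto (fun n : ℕ => C * ((2 / 3 : ℝ) ^ n * |φ (e 0)|)) atTop (𝓝 0) := by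
    have := ((tendsto_pow_atTop_nhds_zero_of_lt_one (by norm_num : (0 : ℝ) ≤ 2 / 3)
      (by norm_num)).mul_const (|φ (e 0)|)).const_mul C
    simpa using this
  refine squeeze_zero (fun n => by positivity) (fun n => ?_) hlim
  calc ρ ^ n * ‖e n‖ ≤ ρ ^ n * (C * |φ (e n)|) := by gcongr; exact hn n
    _ = C * (ρ ^ n * |φ (e n)|) := by ring
    _ ≤ _ := mul_le_mul_of_nonneg_left (hpow n) hC.le

/-- Complements of cones around the dominant direction are backward invariant, and outside such a
cone vectors grow backwards in time faster than `ρ⁻ⁿ`. Hence a backward orbit that decays faster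
vanishes as soon as it starts in the kernel of the dominant functional. -/
lemma backward_orbit_eq_zero {G : E →L[ℝ] E} {φ : E →L[ℝ] ℝ} {w : E} {ν ρ : ℝ} (hρ : 0 < ρ)
    (hν : 2 * ρ ≤ ν) (hG : ∀ v, φ (G v) = ν * φ v)
    (hG' : ∀ v, ‖G v - (ν * φ v) • w‖ ≤ ρ / 8 * ‖v‖) :
    ∃ δ : ℝ, 0 < δ ∧ ∀ (D : ℕ → E →L[ℝ] E) (e : ℕ → E), (∀ n, ‖D n - G‖ ≤ δ) →
      (∀ n, e n = D n (e (n + 1))) → Tendsto (fun n => ρ ^ n * ‖e n‖) atTop (𝓝 0) →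
      φ (e 0) = 0 → e 0 = 0 := by
  have hν0 : 0 < ν := by linarith
  set W := ‖w‖ + 1 with hW
  have hW1 : ‖w‖ ≤ W := by linarith
  have hW0 : 0 < W := by positivity
  set L := 4 * ν * W / ρ with hL
  have hL0 : 0 < L := by positivity
  have hLρ : L * ρ = 4 * ν * W := by rw [hL]; field_simp
  have hLW : 8 * W ≤ L := by
    rw [hL, le_div_iff₀ hρ]
    nlinarith
  refine ⟨min (ρ / 8) (ρ / (2 * L * (‖φ‖ + 1))), by positivity,
    fun D e hD he hlim h0 => ?_⟩
  by_contra hne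
  have hD1 : ∀ n x, ‖(D n - G) x‖ ≤ ρ / 8 * ‖x‖ := fun n x =>
    ((D n - G).le_opNorm x).trans (by gcongr; exact (hD n).trans (min_le_left _ _))
  have hbound : ∀ n, ‖e n‖ ≤ ν * W * |φ (e (n + 1))| + ρ / 4 * ‖e (n + 1)‖ := by
    intro n
    set x := e (n + 1)
    have h1 : e n = (ν * φ x) • w + ((G x - (ν * φ x) • w) + (D n - G) x) := by
      rw [he n, sub_apply]; abel
    rw [h1]
    refine (norm_add_le _ _).trans ?_
    have h2 : ‖(ν * φ x) • w‖ ≤ ν * W * |φ x| := by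
      rw [norm_smul, Real.norm_eq_abs, abs_mul, abs_of_pos hν0]
      nlinarith [mul_le_mul_of_nonneg_left hW1 (mul_nonneg hν0.le (abs_nonneg (φ x)))]
    have h3 := norm_add_le (G x - (ν * φ x) • w) ((D n - G) x)
    have h4 := hG' x
    have h5 := hD1 n x
    linarith
  -- outside the cone `‖v‖ ≤ L |φ v|`, the whole backward orbit stays outside
  have hout : ∀ n, L * |φ (e n)| < ‖e n‖ := by
    intro n
    induction n with
    | zero => simpa [h0] using hne
    | succ n ih =>
      by_contra! hin
      set x := e (n + 1)
      have h1 : φ (e n) = ν * φ x + φ ((D n - G) x) := by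
        rw [he n, sub_apply, map_sub, hG]; ring
      have h2 : |φ ((D n - G) x)| ≤ ρ / 2 * |φ x| := by
        calc |φ ((D n - G) x)| ≤ ‖φ‖ * ‖(D n - G) x‖ := φ.le_opNorm _
          _ ≤ ‖φ‖ * (‖D n - G‖ * ‖x‖) := by gcongr; exact (D n - G).le_opNorm _
          _ ≤ (‖φ‖ + 1) * (ρ / (2 * L * (‖φ‖ + 1)) * (L * |φ x|)) := by
            gcongr
            · linarith
            · exact (hD n).trans (min_le_right _ _)
          _ = ρ / 2 * |φ x| := by field_simp
      have h3 : ν * |φ x| ≤ |φ (e n)| + |φ ((D n - G) x)| := by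
        have h4 : ν * φ x = φ (e n) - φ ((D n - G) x) := by rw [h1]; ring
        calc ν * |φ x| = |ν * φ x| := by rw [abs_mul, abs_of_pos hν0]
          _ ≤ _ := by rw [h4]; exact abs_sub _ _
      have h5 := hbound n
      have hp := abs_nonneg (φ x)
      -- `L (ν - ρ/2) ≥ ν W + (ρ/4) L`, so the cone would be mapped into itself
      have h6 : L * (ν * |φ x|) ≤ L * |φ (e n)| + L * (ρ / 2 * |φ x|) := by
        rw [← mul_add]; gcongr; linarith
      have h7 : ρ / 4 * ‖x‖ ≤ ρ / 4 * (L * |φ x|) := by gcongr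
      have h8 : L * ρ * |φ x| = 4 * ν * W * |φ x| := by rw [hLρ]
      have h9 : 8 * W * (ν * |φ x|) ≤ L * (ν * |φ x|) := by gcongr
      linarith [mul_nonneg (mul_nonneg hν0.le hW0.le) hp]
  have hstep : ∀ n, ρ ^ n * ‖e n‖ ≤ 1 / 2 * (ρ ^ (n + 1) * ‖e (n + 1)‖) := by
    intro n
    have h1 := hbound n
    have h2 := (hout (n + 1)).le
    have h3 : ν * W * |φ (e (n + 1))| ≤ ρ / 4 * ‖e (n + 1)‖ := by
      have : ν * W = ρ / 4 * L := by linarith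
      rw [this, mul_assoc]
      gcongr
    have h4 : ‖e n‖ ≤ ρ / 2 * ‖e (n + 1)‖ := by linarith
    calc ρ ^ n * ‖e n‖ ≤ ρ ^ n * (ρ / 2 * ‖e (n + 1)‖) := by gcongr
      _ = _ := by ring
  have hpow : ∀ n, ‖e 0‖ ≤ ρ ^ n * ‖e n‖ := by
    intro n
    induction n with
    | zero => simp
    | succ n ih =>
      have : 0 ≤ ρ ^ (n + 1) * ‖e (n + 1)‖ := by positivity
      linarith [hstep n]
  have := ge_of_tendsto' hlim hpow
  exact hne (norm_le_zero_iff.1 this)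

end DiffPos

/-! ### Decay of matrix exponentials on the stable subspace -/

namespace DiffPos

section Operators

variable {𝕜 V : Type*} [NontriviallyNormedField 𝕜] [NormedAddCommGroup V] [NormedSpace 𝕜 V]

lemma inv_factorial_smul_smul_pow_apply (c t : 𝕜) (A : V →L[𝕜] V) (n : ℕ) (x : V) :
    ContinuousLinearMap.apply 𝕜 V x (c • (t • A) ^ n) = (c * t ^ n) • (A ^ n) x := by
  rw [smul_pow, smul_smul]; rfl

lemma exp_natCast_mul_smul [NormedSpace ℝ V] [CompleteSpace V] (A : V →L[ℝ] V) (n : ℕ) (t : ℝ) :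
    NormedSpace.exp (((n : ℝ) * t) • A) = NormedSpace.exp (t • A) ^ n := by
  let : NormedAlgebra ℚ (V →L[ℝ] V) := NormedAlgebra.restrictScalars ℚ ℝ _
  rw [← NormedSpace.exp_nsmul, mul_smul, Nat.cast_smul_eq_nsmul]

end Operators

section GeneralizedEigenspace

variable {V : Type*} [NormedAddCommGroup V] [NormedSpace ℂ V] [CompleteSpace V]

lemma exp_apply_eq_sum_of_pow_apply_eq_zero (N : V →L[ℂ] V) {k : ℕ} {z : V}
    (hz : ∀ n, k ≤ n → (N ^ n) z = 0) (t : ℂ) :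
    NormedSpace.exp (t • N) z =
      ∑ j ∈ Finset.range k, ((j.factorial : ℂ)⁻¹ * t ^ j) • (N ^ j) z := by
  have h1 := NormedSpace.exp_series_hasSum_exp' (𝕂 := ℂ) (t • N)
  have h2 := h1.mapL (ContinuousLinearMap.apply ℂ V z)
  refine h2.unique ?_
  simp only [inv_factorial_smul_smul_pow_apply]
  refine hasSum_sum_of_ne_finset_zero fun n hn => ?_
  rw [hz n (by simpa using hn), smul_zero]

lemma exp_smul_apply_eq (A : V →L[ℂ] V) (ν t : ℂ) (z : V) :
    NormedSpace.exp (t • A) z = Complex.exp (t * ν) •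
      NormedSpace.exp (t • (A - ν • (1 : V →L[ℂ] V))) z := by
  have h1 : t • A = (t * ν) • (1 : V →L[ℂ] V) + t • (A - ν • (1 : V →L[ℂ] V)) := by
    rw [smul_sub, smul_smul]; abel
  have hc : Commute ((t * ν) • (1 : V →L[ℂ] V)) (t • (A - ν • (1 : V →L[ℂ] V))) :=
    (Commute.one_left _).smul_left _
  have h2 : NormedSpace.exp ((t * ν) • (1 : V →L[ℂ] V)) =
      Complex.exp (t * ν) • (1 : V →L[ℂ] V) := by
    have := NormedSpace.algebraMap_exp_comm (𝕂 := ℂ) (𝔸 := V →L[ℂ] V) (t * ν)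
    rw [Algebra.algebraMap_eq_smul_one, Algebra.algebraMap_eq_smul_one,
      ← Complex.exp_eq_exp_ℂ] at this
    exact this.symm
  let : NormedAlgebra ℚ (V →L[ℂ] V) := NormedAlgebra.restrictScalars ℚ ℂ _
  rw [h1, NormedSpace.exp_add_of_commute hc, h2]
  simp

/-- On a generalized eigenspace `exp (t A)` is `exp (t ν)` times a polynomial in `t`. -/
lemma tendsto_exp_apply_of_pow_sub_apply_eq_zero (A : V →L[ℂ] V) {ν : ℂ} (hν : ν.re < 0) {k : ℕ}
    {z : V} (hz : ((A - ν • (1 : V →L[ℂ] V)) ^ k) z = 0) :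
    Tendsto (fun t : ℝ => NormedSpace.exp ((t : ℂ) • A) z) atTop (𝓝 0) := by
  have hz' : ∀ n, k ≤ n → ((A - ν • (1 : V →L[ℂ] V)) ^ n) z = 0 := by
    intro n hn
    obtain ⟨m, rfl⟩ := Nat.exists_eq_add_of_le hn
    rw [add_comm, pow_add, mul_apply_eq_comp, hz, map_zero]
  have h1 : ∀ t : ℝ, NormedSpace.exp ((t : ℂ) • A) z = ∑ j ∈ Finset.range k,
      (Complex.exp (t * ν) * ((j.factorial : ℂ)⁻¹ * (t : ℂ) ^ j)) •
        ((A - ν • (1 : V →L[ℂ] V)) ^ j) z := by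
    intro t
    rw [exp_smul_apply_eq A ν, exp_apply_eq_sum_of_pow_apply_eq_zero _ hz', Finset.smul_sum]
    simp only [smul_smul]
  simp only [h1]
  have h2 : ∀ j : ℕ, Tendsto (fun t : ℝ =>
      Complex.exp (t * ν) * ((j.factorial : ℂ)⁻¹ * (t : ℂ) ^ j)) atTop (𝓝 0) := by
    intro j
    rw [tendsto_zero_iff_norm_tendsto_zero]
    have h3 := ((Real.tendsto_pow_mul_exp_neg_atTop_nhds_zero j).comp
      (tendsto_id.const_mul_atTop (neg_pos.2 hν))).const_mul
        ((j.factorial : ℝ)⁻¹ * ((-ν.re)⁻¹) ^ j)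
    rw [mul_zero] at h3
    refine h3.congr' ?_
    filter_upwards [eventually_ge_atTop 0] with t ht
    have hne : -ν.re ≠ 0 := by linarith
    simp only [Function.comp, id, norm_mul, Complex.norm_exp, norm_inv, norm_pow,
      Complex.norm_natCast,
      Complex.norm_real, Real.norm_eq_abs, abs_of_nonneg ht, mul_pow, inv_pow]
    have : (t * ν : ℂ).re = -(-ν.re * t) := by simp [mul_comm]
    rw [this]
    field_simp
  have := tendsto_finsetSum (Finset.range k) fun j _ =>
    (h2 j).smul_const (((A - ν • (1 : V →L[ℂ] V)) ^ j) z)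
  simpa using this

end GeneralizedEigenspace

section Complexification

variable {d : ℕ}

/-- The inclusion of `ℝᵈ` into `ℂᵈ`. -/
noncomputable def complexify (d : ℕ) : EuclideanSpace ℝ (Fin d) →L[ℝ] (Fin d → ℂ) :=
  LinearMap.toContinuousLinearMap
    { toFun := fun x i => (x i : ℂ)
      map_add' := fun x y => by ext i; simp
      map_smul' := fun c x => by ext i; simp }

/-- The real part `ℂᵈ → ℝᵈ`. -/
noncomputable def realPart (d : ℕ) : (Fin d → ℂ) →L[ℝ] EuclideanSpace ℝ (Fin d) :=
  LinearMap.toContinuousLinearMap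
    { toFun := fun z => WithLp.toLp 2 fun i => (z i).re
      map_add' := fun x y => by ext i; simp
      map_smul' := fun c x => by ext i; simp }

@[simp] lemma complexify_apply (x : EuclideanSpace ℝ (Fin d)) (i : Fin d) :
    complexify d x i = (x i : ℂ) := rfl

@[simp] lemma realPart_apply (z : Fin d → ℂ) (i : Fin d) : realPart d z i = (z i).re := rfl

lemma realPart_complexify (x : EuclideanSpace ℝ (Fin d)) : realPart d (complexify d x) = x := by
  ext i; simp

lemma eq_complexify_add (z : Fin d → ℂ) :
    z = complexify d (realPart d z) +
      Complex.I • complexify d (realPart d (-Complex.I • z)) := by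
  ext i
  simp [mul_comm Complex.I, Complex.re_add_im]

/-- The complex-linear extension of a real operator. -/
noncomputable def complexOperator (A : EuclideanSpace ℝ (Fin d) →L[ℝ] EuclideanSpace ℝ (Fin d)) :
    (Fin d → ℂ) →L[ℂ] (Fin d → ℂ) :=
  LinearMap.toContinuousLinearMap (Matrix.toLin'
    ((LinearMap.toMatrix (EuclideanSpace.basisFun (Fin d) ℝ).toBasis
      (EuclideanSpace.basisFun (Fin d) ℝ).toBasis
      (A : EuclideanSpace ℝ (Fin d) →ₗ[ℝ] EuclideanSpace ℝ (Fin d))).map (algebraMap ℝ ℂ)))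

variable (A : EuclideanSpace ℝ (Fin d) →L[ℝ] EuclideanSpace ℝ (Fin d))

lemma charpoly_complexOperator :
    LinearMap.charpoly (complexOperator A : (Fin d → ℂ) →ₗ[ℂ] (Fin d → ℂ)) =
      (LinearMap.charpoly (A : EuclideanSpace ℝ (Fin d) →ₗ[ℝ]
        EuclideanSpace ℝ (Fin d))).map (algebraMap ℝ ℂ) := by
  have : (complexOperator A : (Fin d → ℂ) →ₗ[ℂ] (Fin d → ℂ)) = Matrix.toLin'
    ((LinearMap.toMatrix (EuclideanSpace.basisFun (Fin d) ℝ).toBasis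
      (EuclideanSpace.basisFun (Fin d) ℝ).toBasis
      (A : EuclideanSpace ℝ (Fin d) →ₗ[ℝ] EuclideanSpace ℝ (Fin d))).map (algebraMap ℝ ℂ)) := rfl
  rw [this, Matrix.charpoly_toLin', Matrix.charpoly_map, LinearMap.charpoly_toMatrix]

lemma complexOperator_complexify (x : EuclideanSpace ℝ (Fin d)) :
    complexOperator A (complexify d x) = complexify d (A x) := by
  ext i
  have h : A x i = ∑ j, LinearMap.toMatrix (EuclideanSpace.basisFun (Fin d) ℝ).toBasis
      (EuclideanSpace.basisFun (Fin d) ℝ).toBasis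
      (A : EuclideanSpace ℝ (Fin d) →ₗ[ℝ] EuclideanSpace ℝ (Fin d)) i j * x j := by
    have := congrFun (LinearMap.toMatrix_mulVec_repr
      (EuclideanSpace.basisFun (Fin d) ℝ).toBasis (EuclideanSpace.basisFun (Fin d) ℝ).toBasis
      (A : EuclideanSpace ℝ (Fin d) →ₗ[ℝ] EuclideanSpace ℝ (Fin d)) x) i
    simp only [Matrix.mulVec, dotProduct, OrthonormalBasis.coe_toBasis_repr_apply,
      EuclideanSpace.basisFun_repr, ContinuousLinearMap.coe_coe] at this
    exact this.symm
  rw [complexify_apply, h]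
  simp [complexOperator, Matrix.toLin'_apply, Matrix.mulVec, dotProduct]

lemma exp_complexOperator_complexify (t : ℝ) (x : EuclideanSpace ℝ (Fin d)) :
    NormedSpace.exp ((t : ℂ) • complexOperator A) (complexify d x) =
      complexify d (NormedSpace.exp (t • A) x) := by
  have hpow : ∀ n : ℕ, (complexOperator A ^ n) (complexify d x) = complexify d ((A ^ n) x) := by
    intro n
    induction n with
    | zero => simp
    | succ n ih =>
      rw [pow_succ', pow_succ', mul_apply_eq_comp, mul_apply_eq_comp, ih,
        complexOperator_complexify]
  have h1 := (NormedSpace.exp_series_hasSum_exp' (𝕂 := ℂ) ((t : ℂ) • complexOperator A)).mapL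
    (ContinuousLinearMap.apply ℂ (Fin d → ℂ) (complexify d x))
  have h2 := ((NormedSpace.exp_series_hasSum_exp' (𝕂 := ℝ) (t • A)).mapL
    (ContinuousLinearMap.apply ℝ (EuclideanSpace ℝ (Fin d)) x)).mapL (complexify d)
  refine h1.unique ?_
  have h3 : ∀ n : ℕ, (ContinuousLinearMap.apply ℂ (Fin d → ℂ) (complexify d x))
      ((n.factorial : ℂ)⁻¹ • ((t : ℂ) • complexOperator A) ^ n) =
      complexify d ((ContinuousLinearMap.apply ℝ (EuclideanSpace ℝ (Fin d)) x)
        ((n.factorial : ℝ)⁻¹ • (t • A) ^ n)) := by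
    intro n
    rw [inv_factorial_smul_smul_pow_apply, inv_factorial_smul_smul_pow_apply, hpow, map_smul]
    ext i
    simp only [Pi.smul_apply, smul_eq_mul, Complex.real_smul]
    push_cast
    ring
  simp only [h3]
  exact h2

variable {A}

/-- If exactly one eigenvalue `λ₁` of `A` has positive real part and all others have negative real
part, then along real initial vectors `exp (t A)` follows a multiple of `exp (t λ₁) z₁`, where `z₁`
is an eigenvector of `λ₁`. -/
lemma exists_dominant_mode
    (h0 : ∀ ν ∈ ((LinearMap.charpoly (A : EuclideanSpace ℝ (Fin d) →ₗ[ℝ]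
      EuclideanSpace ℝ (Fin d))).map (algebraMap ℝ ℂ)).roots, ν.re ≠ 0)
    [DecidablePred fun ν : ℂ => 0 < ν.re]
    (h1 : Multiset.card ((((LinearMap.charpoly (A : EuclideanSpace ℝ (Fin d) →ₗ[ℝ]
      EuclideanSpace ℝ (Fin d))).map (algebraMap ℝ ℂ)).roots).filter fun ν => 0 < ν.re) = 1) :
    ∃ (ν : ℂ) (z : Fin d → ℂ), 0 < ν.re ∧ z ≠ 0 ∧
      (∀ t : ℝ, NormedSpace.exp ((t : ℂ) • complexOperator A) z = Complex.exp (t * ν) • z) ∧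
      ∀ y : Fin d → ℂ, ∃ c : ℂ,
      Tendsto (fun t : ℝ => NormedSpace.exp ((t : ℂ) • complexOperator A) y -
        (c * Complex.exp (t * ν)) • z) atTop (𝓝 0) := by
  set Ac := complexOperator A with hAc
  rw [← charpoly_complexOperator] at h0 h1
  obtain ⟨ν, hν⟩ := Multiset.card_eq_one.1 h1
  have hmem : ν ∈ (LinearMap.charpoly (Ac : (Fin d → ℂ) →ₗ[ℂ] (Fin d → ℂ))).roots ∧ 0 < ν.re := by
    refine (Multiset.mem_filter (p := fun ν : ℂ => 0 < ν.re)).1 ?_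
    rw [hν]; simp
  have hmult : (LinearMap.charpoly (Ac : (Fin d → ℂ) →ₗ[ℂ] (Fin d → ℂ))).rootMultiplicity ν
      = 1 := by
    rw [← Polynomial.count_roots,
      ← Multiset.count_filter_of_pos (p := fun ν : ℂ => 0 < ν.re) hmem.2,
      hν]
    simp
  have hrank : Module.finrank ℂ
      (Module.End.maxGenEigenspace (Ac : (Fin d → ℂ) →ₗ[ℂ] (Fin d → ℂ)) ν) = 1 := by
    rw [LinearMap.finrank_maxGenEigenspace_eq, hmult]
  have hev : Module.End.HasEigenvalue (Ac : (Fin d → ℂ) →ₗ[ℂ] (Fin d → ℂ)) ν := by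
    rw [Module.End.hasEigenvalue_iff_isRoot_charpoly]
    exact (Polynomial.mem_roots'.1 hmem.1).2
  obtain ⟨z, hz, hz0⟩ := hev.exists_hasEigenvector
  have hzA : Ac z = ν • z := Module.End.mem_eigenspace_iff.1 hz
  have hzm : z ∈ Module.End.maxGenEigenspace (Ac : (Fin d → ℂ) →ₗ[ℂ] (Fin d → ℂ)) ν :=
    (Module.End.mem_maxGenEigenspace _ _ _).2 ⟨1, by
      rw [pow_one, LinearMap.sub_apply]
      exact sub_eq_zero.2 hzA⟩
  have hexp : ∀ t : ℝ, NormedSpace.exp ((t : ℂ) • Ac) z = Complex.exp (t * ν) • z := by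
    intro t
    rw [exp_smul_apply_eq Ac ν, exp_apply_eq_sum_of_pow_apply_eq_zero (k := 1)]
    · simp
    · intro n hn
      obtain ⟨m, rfl⟩ := Nat.exists_eq_add_of_le' hn
      have : (Ac - ν • (1 : (Fin d → ℂ) →L[ℂ] (Fin d → ℂ))) z = 0 := by
        rw [sub_apply, hzA]
        exact sub_self _
      rw [pow_succ, mul_apply_eq_comp, this, map_zero]
  refine ⟨ν, z, hmem.2, hz0, hexp, fun y => ?_⟩
  have hy : y ∈ ⨆ κ, Module.End.maxGenEigenspace (Ac : (Fin d → ℂ) →ₗ[ℂ] (Fin d → ℂ)) κ := by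
    rw [Module.End.iSup_maxGenEigenspace_eq_top]; trivial
  induction hy using Submodule.iSup_induction' with
  | zero => exact ⟨0, by simp⟩
  | add x y _ _ hx hy =>
    obtain ⟨a, ha⟩ := hx
    obtain ⟨b, hb⟩ := hy
    refine ⟨a + b, ?_⟩
    have := ha.add hb
    rw [add_zero] at this
    refine this.congr fun t => ?_
    rw [map_add]
    module
  | mem κ x hx =>
    by_cases hx0 : x = 0
    · exact ⟨0, by simp [hx0]⟩
    by_cases hκ : κ = ν
    · subst hκ
      obtain ⟨c, hc⟩ := (finrank_eq_one_iff_of_nonzero' (⟨z, hzm⟩ :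
        Module.End.maxGenEigenspace (Ac : (Fin d → ℂ) →ₗ[ℂ] (Fin d → ℂ)) κ)
        (by simpa using hz0)).1 hrank ⟨x, hx⟩
      have hc' : c • z = x := congrArg Subtype.val hc
      refine ⟨c, ?_⟩
      have : ∀ t : ℝ, NormedSpace.exp ((t : ℂ) • Ac) x - (c * Complex.exp (t * κ)) • z = 0 := by
        intro t
        rw [← hc', map_smul, hexp, smul_smul, sub_self]
      simp [this]
    · refine ⟨0, ?_⟩
      simp only [zero_mul, zero_smul, sub_zero]
      have hroot : κ ∈ (LinearMap.charpoly (Ac : (Fin d → ℂ) →ₗ[ℂ] (Fin d → ℂ))).roots := by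
        rw [Polynomial.mem_roots']
        have hne := (LinearMap.charpoly_monic (Ac : (Fin d → ℂ) →ₗ[ℂ] (Fin d → ℂ))).ne_zero
        refine ⟨hne, (Polynomial.rootMultiplicity_pos hne).1 ?_⟩
        rw [← LinearMap.finrank_maxGenEigenspace_eq]
        exact Module.finrank_pos_iff_exists_ne_zero.2 ⟨⟨x, hx⟩, by simpa using hx0⟩
      have hneg : κ.re < 0 := by
        refine lt_of_le_of_ne ?_ (h0 κ hroot)
        by_contra! hpos
        have : κ ∈ ((LinearMap.charpoly (Ac : (Fin d → ℂ) →ₗ[ℂ] (Fin d → ℂ))).roots).filter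
            fun ν => 0 < ν.re := Multiset.mem_filter.2 ⟨hroot, hpos⟩
        rw [hν, Multiset.mem_singleton] at this
        exact hκ this
      obtain ⟨k, hk⟩ := (Module.End.mem_maxGenEigenspace _ _ _).1 hx
      refine tendsto_exp_apply_of_pow_sub_apply_eq_zero Ac hneg (k := k) ?_
      have hpow : ∀ (n : ℕ) (u : Fin d → ℂ),
          ((Ac - κ • (1 : (Fin d → ℂ) →L[ℂ] (Fin d → ℂ))) ^ n) u =
          (((Ac : (Fin d → ℂ) →ₗ[ℂ] (Fin d → ℂ)) - κ • 1) ^ n) u := by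
        intro n
        induction n with
        | zero => intro u; rfl
        | succ n ih =>
          intro u
          rw [pow_succ, pow_succ, mul_apply_eq_comp, ih]
          rfl
      rw [hpow]
      exact hk

/-- If `P = exp (T A)` has a Perron triple and `A` has exactly one eigenvalue with nonnegative real
part, then this eigenvalue is positive and belongs to the Perron vector; the kernel of the Perron
functional is the stable subspace. -/
theorem IsPerronTriple.one_lt_and_tendsto_zero {K : Set (EuclideanSpace ℝ (Fin d))} {μ : ℝ}
    {w : EuclideanSpace ℝ (Fin d)} {φ : EuclideanSpace ℝ (Fin d) →L[ℝ] ℝ} {T : ℝ} (hT : 0 < T)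
    (h : IsPerronTriple (NormedSpace.exp (T • A)) K μ w φ)
    (h0 : ∀ ν ∈ ((LinearMap.charpoly (A : EuclideanSpace ℝ (Fin d) →ₗ[ℝ]
      EuclideanSpace ℝ (Fin d))).map (algebraMap ℝ ℂ)).roots, ν.re ≠ 0)
    [DecidablePred fun ν : ℂ => 0 < ν.re]
    (h1 : Multiset.card ((((LinearMap.charpoly (A : EuclideanSpace ℝ (Fin d) →ₗ[ℝ]
      EuclideanSpace ℝ (Fin d))).map (algebraMap ℝ ℂ)).roots).filter fun ν => 0 < ν.re) = 1) :
    1 < μ ∧ ∀ x, φ x = 0 →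
      Tendsto (fun n : ℕ => (NormedSpace.exp (T • A) ^ n) x) atTop (𝓝 0) := by
  set P := NormedSpace.exp (T • A) with hP
  obtain ⟨ν, z, hν, hz, hzexp, hmode⟩ := exists_dominant_mode h0 h1
  set r := Complex.exp (T * ν) with hr
  have hr1 : 1 < ‖r‖ := by
    rw [hr, Complex.norm_exp, Real.one_lt_exp_iff]
    simpa using mul_pos hT hν
  have hr0 : r ≠ 0 := Complex.exp_ne_zero _
  have hrpow : Tendsto (fun n : ℕ => ‖r‖ ^ n) atTop atTop := tendsto_pow_atTop_atTop_of_one_lt hr1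
  have hnT : Tendsto (fun n : ℕ => (n : ℝ) * T) atTop atTop :=
    tendsto_natCast_atTop_atTop.atTop_mul_const hT
  have hexpn : ∀ n : ℕ, NormedSpace.exp (((n : ℝ) * T) • A) = P ^ n := by
    intro n
    rw [exp_natCast_mul_smul]
  have hmode' : ∀ x, ∃ c : ℂ, Tendsto (fun n : ℕ => complexify d ((P ^ n) x) -
      (c * r ^ n) • z) atTop (𝓝 0) := by
    intro x
    obtain ⟨c, hc⟩ := hmode (complexify d x)
    refine ⟨c, (hc.comp hnT).congr fun n => ?_⟩
    simp only [Function.comp]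
    rw [exp_complexOperator_complexify, hexpn, hr, ← Complex.exp_nat_mul]
    congr 4
    push_cast
    ring
  have hμ := h.pos
  have hscale : ∀ x, Tendsto (fun n : ℕ => ((μ : ℂ)⁻¹ ^ n) • complexify d ((P ^ n) x)) atTop
      (𝓝 (complexify d (φ x • w))) := by
    intro x
    refine (((complexify d).continuous.tendsto _).comp (h.tendsto x)).congr fun n => ?_
    ext i
    simp
  -- some real vector has a component along the growing mode
  obtain ⟨x₁, c₁, hc₁0, hc₁⟩ : ∃ x, ∃ c : ℂ, c ≠ 0 ∧ Tendsto (fun n : ℕ =>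
      complexify d ((P ^ n) x) - (c * r ^ n) • z) atTop (𝓝 0) := by
    by_contra! hno
    have hzero : ∀ x, Tendsto (fun n : ℕ => complexify d ((P ^ n) x)) atTop (𝓝 0) := by
      intro x
      obtain ⟨c, hc⟩ := hmode' x
      have : c = 0 := by
        by_contra hc0
        exact hno x c hc0 hc
      simpa [this] using hc
    have hz1 : ∀ n : ℕ, r ^ n • z = complexify d ((P ^ n) (realPart d z)) +
        Complex.I • complexify d ((P ^ n) (realPart d (-Complex.I • z))) := by
      intro n
      have e1 := hzexp (n * T)
      nth_rewrite 1 [eq_complexify_add z] at e1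
      rw [map_add, map_smul, exp_complexOperator_complexify, exp_complexOperator_complexify,
        hexpn] at e1
      rw [e1, hr, ← Complex.exp_nat_mul]
      congr 2
      push_cast
      ring
    have hlim : Tendsto (fun n : ℕ => ‖r ^ n • z‖) atTop (𝓝 0) := by
      have := ((hzero (realPart d z)).add
        ((hzero (realPart d (-Complex.I • z))).const_smul Complex.I)).norm
      simp only [smul_zero, add_zero, norm_zero] at this
      exact this.congr fun n => by rw [hz1]
    refine hz (norm_le_zero_iff.1 (ge_of_tendsto' hlim fun n => ?_))
    rw [norm_smul, norm_pow]
    exact le_mul_of_one_le_left (norm_nonneg _) (one_le_pow₀ hr1.le)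
  have hμ1 : 1 < μ := by
    by_contra! hle
    -- otherwise the orbit of `x₁` would be bounded
    have hb := ((hscale x₁).norm).add hc₁.norm
    obtain ⟨B, hB⟩ := hb.bddAbove_range
    obtain ⟨n, hn⟩ := (((hrpow.const_mul_atTop
      (mul_pos (norm_pos_iff.2 hc₁0) (norm_pos_iff.2 hz)))).eventually_gt_atTop B).exists
    have h2 : ‖((c₁ * r ^ n) • z)‖ ≤ ‖complexify d ((P ^ n) x₁)‖ +
        ‖complexify d ((P ^ n) x₁) - (c₁ * r ^ n) • z‖ := by
      have := norm_sub_le (complexify d ((P ^ n) x₁))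
        (complexify d ((P ^ n) x₁) - (c₁ * r ^ n) • z)
      rwa [sub_sub_cancel] at this
    have h3 : ‖complexify d ((P ^ n) x₁)‖ ≤ ‖((μ : ℂ)⁻¹ ^ n) • complexify d ((P ^ n) x₁)‖ := by
      rw [norm_smul, norm_pow, norm_inv, Complex.norm_real, Real.norm_of_nonneg hμ.le]
      exact le_mul_of_one_le_left (norm_nonneg _) (one_le_pow₀ ((one_le_inv₀ hμ).2 hle))
    have h4 := hB ⟨n, rfl⟩
    simp only [norm_smul, norm_mul, norm_pow] at h2 h3 h4 hn
    have : ‖c₁‖ * ‖z‖ * ‖r‖ ^ n = ‖c₁‖ * ‖r‖ ^ n * ‖z‖ := by ring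
    linarith
  have hμinv : Tendsto (fun n : ℕ => (μ : ℂ)⁻¹ ^ n) atTop (𝓝 0) := by
    refine tendsto_pow_atTop_nhds_zero_of_norm_lt_one ?_
    rw [norm_inv, Complex.norm_real, Real.norm_of_nonneg hμ.le]
    exact inv_lt_one_of_one_lt₀ hμ1
  -- after rescaling by `μ⁻ⁿ`, the growing mode carries the Perron component
  have hratio : ∀ x c, Tendsto (fun n : ℕ => complexify d ((P ^ n) x) - (c * r ^ n) • z) atTop
      (𝓝 0) → Tendsto (fun n : ℕ => (c * ((μ : ℂ)⁻¹ * r) ^ n) • z) atTop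
        (𝓝 (complexify d (φ x • w))) := by
    intro x c hc
    have := (hscale x).sub (hμinv.smul hc)
    simp only [smul_zero, sub_zero] at this
    refine this.congr fun n => ?_
    rw [smul_sub, sub_sub_cancel, smul_smul]
    congr 1
    ring
  have hJw : complexify d w ≠ 0 := by
    intro h2
    apply h.ne_zero
    rw [← realPart_complexify w, h2, map_zero]
  obtain ⟨cw, hcw⟩ := hmode' w
  have hcw' := hratio w cw hcw
  rw [h.apply_self, one_smul] at hcw'
  refine ⟨hμ1, fun x hx => ?_⟩
  obtain ⟨c, hc⟩ := hmode' x
  have hc' := hratio x c hc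
  rw [hx, zero_smul, map_zero] at hc'
  have hc0 : c = 0 := by
    by_contra hne
    refine hJw (tendsto_nhds_unique hcw' ?_)
    have := hc'.const_smul (cw / c)
    rw [smul_zero] at this
    refine this.congr fun n => ?_
    rw [smul_smul]
    congr 1
    field_simp
  have h2 : Tendsto (fun n : ℕ => complexify d ((P ^ n) x)) atTop (𝓝 0) := by
    simpa [hc0] using hc
  have h3 := ((realPart d).continuous.tendsto _).comp h2
  rw [map_zero] at h3
  exact h3.congr fun n => realPart_complexify _

end Complexification

end DiffPos

/-! ### Differentiability of local flows in the initial condition -/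

namespace DiffPos

section LocalFlow

variable {E : Type*} [NormedAddCommGroup E] [NormedSpace ℝ E]

/-- The vector field of the variational system `ẋ = g(x)`, `Ẇ = ∂g(x) W`. -/
noncomputable def variationalField (g : E → E) (q : E × (E →L[ℝ] E)) : E × (E →L[ℝ] E) :=
  (g q.1, (fderiv ℝ g q.1).comp q.2)

lemma contDiffAt_variationalField {g : E → E} {u : E} (hg : ContDiffAt ℝ 2 g u)
    (W : E →L[ℝ] E) : ContDiffAt ℝ 1 (variationalField g) (u, W) := by
  refine ContDiffAt.prodMk ?_ ?_
  · exact ContDiffAt.comp (u, W) (hg.of_le (by norm_num)) contDiffAt_fst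
  · refine ContDiffAt.clm_comp ?_ contDiffAt_snd
    exact ContDiffAt.comp (u, W) (hg.fderiv_right (m := 1) (by norm_num)) contDiffAt_fst

lemma gronwallBound_zero_eq_mul (K ε x : ℝ) :
    gronwallBound 0 K ε x = ε * gronwallBound 0 K 1 x := by
  by_cases hK : K = 0
  · simp [hK, gronwallBound_K0]
  · simp [gronwallBound_of_K_ne_0 hK]
    ring

/-- Second-order Taylor estimate on a ball where the derivative is Lipschitz. -/
lemma norm_sub_sub_fderiv_le {g : E → E} {u : E} {ρ : ℝ} {K : ℝ≥0}
    (hdiff : ∀ x ∈ Metric.ball u ρ, DifferentiableAt ℝ g x)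
    (hlip : LipschitzOnWith K (fderiv ℝ g) (Metric.ball u ρ)) {a b : E}
    (ha : a ∈ Metric.ball u ρ) (hb : b ∈ Metric.ball u ρ) :
    ‖g b - g a - fderiv ℝ g a (b - a)‖ ≤ K * ‖b - a‖ ^ 2 := by
  have hseg : segment ℝ a b ⊆ Metric.ball u ρ := (convex_ball u ρ).segment_subset ha hb
  have := (convex_segment a b).norm_image_sub_le_of_norm_hasFDerivWithin_le' (f := g)
    (f' := fderiv ℝ g) (φ := fderiv ℝ g a) (C := K * ‖b - a‖)
    (fun x hx => (hdiff x (hseg hx)).hasFDerivAt.hasFDerivWithinAt)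
    (fun x hx => ?_) (left_mem_segment ℝ a b) (right_mem_segment ℝ a b)
  · calc _ ≤ K * ‖b - a‖ * ‖b - a‖ := this
      _ = _ := by ring
  · refine (hlip.norm_sub_le (hseg hx) ha).trans ?_
    gcongr
    rw [segment_eq_image'] at hx
    obtain ⟨θ, hθ, rfl⟩ := hx
    simp only [add_sub_cancel_left, norm_smul, Real.norm_eq_abs, abs_of_nonneg hθ.1]
    exact mul_le_of_le_one_left (norm_nonneg _) hθ.2

/-- Grönwall estimate between the difference of two solutions and a solution of the variational
equation, in either direction of time. -/
lemma norm_sub_sub_variational_le {g : E → E} {u : E} {ρ ε : ℝ} {K M : ℝ≥0} {B : ℝ}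
    (hdiff : ∀ x ∈ Metric.ball u ρ, DifferentiableAt ℝ g x)
    (hlip : LipschitzOnWith K (fderiv ℝ g) (Metric.ball u ρ))
    (hM : ∀ x ∈ Metric.ball u ρ, ‖fderiv ℝ g x‖ ≤ M) {α β : ℝ → E} {W : ℝ → E →L[ℝ] E}
    (hα : ∀ t ∈ Ioo (-ε) ε, α t ∈ Metric.ball u ρ ∧ HasDerivAt α (g (α t)) t)
    (hβ : ∀ t ∈ Ioo (-ε) ε, β t ∈ Metric.ball u ρ ∧ HasDerivAt β (g (β t)) t)
    (hW : ∀ t ∈ Ioo (-ε) ε, HasDerivAt W ((fderiv ℝ g (α t)).comp (W t)) t)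
    (hW0 : W 0 = 1) (hB : ∀ t ∈ Ioo (-ε) ε, ‖β t - α t‖ ≤ B) {t : ℝ} (ht : t ∈ Ioo (-ε) ε) :
    ‖β t - α t - W t (β 0 - α 0)‖ ≤ K * B ^ 2 * gronwallBound 0 M 1 |t| := by
  obtain ⟨σ, hσ, htσ⟩ : ∃ σ : ℝ, |σ| = 1 ∧ t = σ * |t| := by
    rcases le_total 0 t with h | h
    · exact ⟨1, by simp, by simp [abs_of_nonneg h]⟩
    · exact ⟨-1, by simp, by simp [abs_of_nonpos h]⟩
  have hmem : ∀ s ∈ Icc (0 : ℝ) |t|, σ * s ∈ Ioo (-ε) ε := by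
    intro s hs
    rw [mem_Ioo, ← abs_lt, abs_mul, hσ, one_mul, abs_of_nonneg hs.1]
    exact hs.2.trans_lt (abs_lt.2 ht)
  have hscale : ∀ s : ℝ, HasDerivAt (fun s => σ * s) σ s := fun s => by
    simpa using (hasDerivAt_id s).const_mul σ
  have hf : ∀ s ∈ Icc (0 : ℝ) |t|,
      HasDerivAt (fun s => β (σ * s) - α (σ * s) - W (σ * s) (β 0 - α 0))
        (σ • (g (β (σ * s)) - g (α (σ * s)) -
          fderiv ℝ g (α (σ * s)) (W (σ * s) (β 0 - α 0)))) s := by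
    intro s hs
    have h := hmem s hs
    have h1 := ((hW _ h).scomp s (hscale s)).clm_apply (hasDerivAt_const s (β 0 - α 0))
    have h2 := (((hβ _ h).2.scomp s (hscale s)).sub ((hα _ h).2.scomp s (hscale s))).sub h1
    convert! h2 using 1
    simp [smul_sub]
  have key := norm_le_gronwallBound_of_norm_deriv_right_le (K := M) (ε := K * B ^ 2) (δ := 0)
    (fun s hs => (hf s hs).continuousAt.continuousWithinAt)
    (fun s hs => (hf s (Ico_subset_Icc_self hs)).hasDerivWithinAt) (by simp [hW0])
    (fun s hs => ?_) |t| ⟨abs_nonneg t, le_rfl⟩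
  · rw [gronwallBound_zero_eq_mul, ← htσ, sub_zero] at key
    exact key
  · have h := hmem s (Ico_subset_Icc_self hs)
    set a := α (σ * s)
    set b := β (σ * s)
    set c := W (σ * s) (β 0 - α 0)
    have h1 : g b - g a - fderiv ℝ g a c =
        fderiv ℝ g a (b - a - c) + (g b - g a - fderiv ℝ g a (b - a)) := by
      rw [map_sub _ (b - a)]; abel
    rw [norm_smul, Real.norm_eq_abs, hσ, one_mul, h1]
    refine (norm_add_le _ _).trans (add_le_add ?_ ?_)
    · exact ((fderiv ℝ g a).le_opNorm _).trans (by gcongr; exact hM a (hα _ h).1)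
    · refine (norm_sub_sub_fderiv_le hdiff hlip (hα _ h).1 (hβ _ h).1).trans ?_
      gcongr
      exact hB _ h

/-- A `C²` vector field has a local flow that is `C¹` in the initial condition, and whose derivative
solves the variational equation. -/
theorem exists_local_flow [CompleteSpace E] {g : E → E} {u : E} (hg : ContDiffAt ℝ 2 g u)
    {N : Set E} (hN : N ∈ 𝓝 u) :
    ∃ ε : ℝ, 0 < ε ∧ ∃ U : Set E, IsOpen U ∧ u ∈ U ∧
      ∃ (Φ : E → ℝ → E) (W : E → ℝ → E →L[ℝ] E), ∀ x ∈ U, Φ x 0 = x ∧ W x 0 = 1 ∧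
        ∀ t ∈ Ioo (-ε) ε, Φ x t ∈ N ∧ HasDerivAt (Φ x) (g (Φ x t)) t ∧
          HasDerivAt (W x) ((fderiv ℝ g (Φ x t)).comp (W x t)) t ∧
          HasFDerivAt (Φ · t) (W x t) x ∧ ContinuousAt (W · t) x := by
  -- a ball with a Lipschitz derivative
  have hg1 : ContDiffAt ℝ 1 (fderiv ℝ g) u := hg.fderiv_right (by norm_num)
  obtain ⟨K, s, hs, hlip⟩ := hg1.exists_lipschitzOnWith
  have hdiff : ∀ᶠ x in 𝓝 u, DifferentiableAt ℝ g x :=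
    (hg.eventually (by simp)).mono fun x hx => hx.differentiableAt (by simp)
  have hM : ∀ᶠ x in 𝓝 u, ‖fderiv ℝ g x‖ < ‖fderiv ℝ g u‖ + 1 :=
    hg1.continuousAt.norm.eventually_lt continuousAt_const (by linarith)
  obtain ⟨ρ, hρ, hball⟩ := Metric.mem_nhds_iff.1
    (inter_mem (inter_mem hs hN) (hdiff.and hM))
  set M : ℝ≥0 := ⟨‖fderiv ℝ g u‖ + 1, by positivity⟩
  have hMball : ∀ x ∈ Metric.ball u ρ, ‖fderiv ℝ g x‖ ≤ M := fun x hx => (hball hx).2.2.le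
  have hdball : ∀ x ∈ Metric.ball u ρ, DifferentiableAt ℝ g x := fun x hx => (hball hx).2.1
  have hlball : LipschitzOnWith K (fderiv ℝ g) (Metric.ball u ρ) :=
    hlip.mono fun x hx => (hball hx).1.1
  -- the local flow of the variational system
  obtain ⟨ε₀, hε₀, a, r, L, K', hr, hpl⟩ :=
    IsPicardLindelof.of_contDiffAt_one (contDiffAt_variationalField hg 1)
  obtain ⟨α, hα, L', hL'⟩ :=
    (hpl 0).exists_forall_mem_closedBall_eq_hasDerivWithinAt_lipschitzOnWith
  have hcont : ContinuousOn (Function.uncurry α)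
      (Metric.closedBall (u, (1 : E →L[ℝ] E)) r ×ˢ Icc (0 - ε₀) (0 + ε₀)) :=
    continuousOn_prod_of_continuousOn_lipschitzOnWith _ L'
      (fun x hx => HasDerivWithinAt.continuousOn (hα x hx).2) hL'
  have hc0 : ContinuousAt (Function.uncurry α) ((u, (1 : E →L[ℝ] E)), 0) :=
    hcont.continuousAt (prod_mem_nhds (Metric.closedBall_mem_nhds _ hr)
      (Icc_mem_nhds (by linarith) (by linarith)))
  have hval : Function.uncurry α ((u, (1 : E →L[ℝ] E)), 0) = (u, 1) :=
    (hα _ (Metric.mem_closedBall_self hr.le)).1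
  have hpre : ∀ᶠ q : (E × (E →L[ℝ] E)) × ℝ in 𝓝 ((u, (1 : E →L[ℝ] E)), 0),
      (α q.1 q.2).1 ∈ Metric.ball u ρ := by
    have h1 := (continuous_fst.tendsto _).comp hc0
    exact h1.eventually (by rw [hval]; exact Metric.ball_mem_nhds _ hρ)
  rw [nhds_prod_eq] at hpre
  obtain ⟨pa, hpa, pb, hpb, hprod⟩ := eventually_prod_iff.1 hpre
  obtain ⟨ε₁, hε₁, hball₁⟩ := Metric.eventually_nhds_iff.1 hpb
  have hU : ∀ᶠ x in 𝓝 u, pa (x, (1 : E →L[ℝ] E)) ∧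
      (x, (1 : E →L[ℝ] E)) ∈ Metric.closedBall (u, (1 : E →L[ℝ] E)) r := by
    have hc : ContinuousAt (fun x : E => (x, (1 : E →L[ℝ] E))) u := by fun_prop
    exact (hc.eventually hpa).and (hc.eventually (Metric.closedBall_mem_nhds _ hr))
  obtain ⟨U, hUsub, hUo, huU⟩ := mem_nhds_iff.1 hU
  have hmain : ∀ x ∈ U, ∀ t ∈ Ioo (-(min ε₀ ε₁)) (min ε₀ ε₁),
      (α (x, 1) t).1 ∈ Metric.ball u ρ ∧
      HasDerivAt (fun t => (α (x, 1) t).1) (g (α (x, 1) t).1) t ∧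
      HasDerivAt (fun t => (α (x, 1) t).2)
        ((fderiv ℝ g (α (x, 1) t).1).comp (α (x, 1) t).2) t := by
    intro x hx t ht
    have ht0 : |t| < min ε₀ ε₁ := abs_lt.2 ht
    have ht1 := abs_lt.1 (ht0.trans_le (min_le_left _ _))
    have hd : HasDerivAt (α (x, 1)) (variationalField g (α (x, 1) t)) t :=
      ((hα _ (hUsub hx).2).2 t ⟨by linarith, by linarith⟩).hasDerivAt
        (Icc_mem_nhds (by linarith) (by linarith))
    refine ⟨hprod (hUsub hx).1 (hball₁ ?_), hd.fst, hd.snd⟩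
    rw [dist_zero_right, Real.norm_eq_abs]
    exact ht0.trans_le (min_le_right _ _)
  refine ⟨min ε₀ ε₁, lt_min hε₀ hε₁, U, hUo, huU, fun x t => (α (x, 1) t).1,
    fun x t => (α (x, 1) t).2, fun x hx => ?_⟩
  have hinit : ∀ y ∈ U, α (y, 1) 0 = (y, 1) := fun y hy => (hα _ (hUsub hy).2).1
  refine ⟨by simp [hinit x hx], by simp [hinit x hx], fun t ht => ?_⟩
  have htI : ∀ t ∈ Ioo (-(min ε₀ ε₁)) (min ε₀ ε₁), t ∈ Icc (0 - ε₀) (0 + ε₀) := by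
    intro t ht
    have ht1 := abs_lt.1 ((abs_lt.2 ht).trans_le (min_le_left _ _))
    exact ⟨by linarith, by linarith⟩
  have hlipx : ∀ y ∈ U, ∀ t ∈ Ioo (-(min ε₀ ε₁)) (min ε₀ ε₁),
      ‖α (y, 1) t - α (x, 1) t‖ ≤ L' * ‖y - x‖ := by
    intro y hy t ht
    have := (hL' t (htI t ht)).norm_sub_le (hUsub hy).2 (hUsub hx).2
    simpa [Prod.norm_def] using this
  obtain ⟨h1, h2, h3⟩ := hmain x hx t ht
  refine ⟨(hball h1).1.2, h2, h3, ?_, ?_⟩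
  · have hO : (fun y => (α (y, 1) t).1 - (α (x, 1) t).1 - (α (x, 1) t).2 (y - x)) =O[𝓝 x]
        fun y => ‖y - x‖ ^ 2 := by
      refine Asymptotics.IsBigO.of_bound (K * L' ^ 2 * gronwallBound 0 M 1 |t|) ?_
      filter_upwards [hUo.mem_nhds hx] with y hy
      have := norm_sub_sub_variational_le (α := fun t => (α (x, 1) t).1)
        (β := fun t => (α (y, 1) t).1) (W := fun t => (α (x, 1) t).2) (B := L' * ‖y - x‖)
        hdball hlball hMball (fun s hs => ⟨(hmain x hx s hs).1, (hmain x hx s hs).2.1⟩)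
        (fun s hs => ⟨(hmain y hy s hs).1, (hmain y hy s hs).2.1⟩)
        (fun s hs => (hmain x hx s hs).2.2) (by simp [hinit x hx])
        (fun s hs => (norm_fst_le (α (y, 1) s - α (x, 1) s)).trans (hlipx y hy s hs)) ht
      simp only [hinit x hx, hinit y hy] at this
      refine this.trans (le_of_eq ?_)
      rw [norm_pow, norm_norm]
      ring
    have h4 := hO.hasFDerivAt (𝕜 := ℝ) (by norm_num)
    have h5 : HasFDerivAt (fun y => (α (x, 1) t).1 + (α (x, 1) t).2 (y - x)) (α (x, 1) t).2 x :=
      HasFDerivAt.const_add _ (by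
        simpa using! ((α (x, 1) t).2.hasFDerivAt (x := x)).sub_const ((α (x, 1) t).2 x))
    have h6 := h4.add h5
    rw [zero_add] at h6
    refine h6.congr_of_eventuallyEq (Eventually.of_forall fun y => ?_)
    simp
  · have h4 : ContinuousOn (fun y => α (y, 1) t) U := by
      have h5 : ContinuousOn (fun y : E => (y, (1 : E →L[ℝ] E))) U := by fun_prop
      exact (hL' t (htI t ht)).continuousOn.comp h5 fun y hy => (hUsub hy).2
    exact (h4.continuousAt (hUo.mem_nhds hx)).snd

end LocalFlow

end DiffPos

/-! ### The flow of a `C²` vector field on a manifold -/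

namespace DiffPos

variable {d : ℕ} {M : Type*} [TopologicalSpace M]
  [ChartedSpace (EuclideanSpace ℝ (Fin d)) M] [IsManifold (𝓡 d) ∞ M]

/-- The coordinate expression of the vector field `f` in the chart at `p`. -/
noncomputable def coordField (f : ∀ x : M, TangentSpace (𝓡 d) x) (p : M)
    (u : EuclideanSpace ℝ (Fin d)) : EuclideanSpace ℝ (Fin d) :=
  mfderiv (𝓡 d) 𝓘(ℝ, EuclideanSpace ℝ (Fin d)) (extChartAt (𝓡 d) p)
    ((extChartAt (𝓡 d) p).symm u) (f ((extChartAt (𝓡 d) p).symm u))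

/-- The coordinate expression of a tangent vector in the trivialization of the tangent bundle
at `p`. -/
noncomputable def tangentCoord (p : M) (q : TangentBundle (𝓡 d) M) : EuclideanSpace ℝ (Fin d) :=
  (trivializationAt (EuclideanSpace ℝ (Fin d)) (TangentSpace (𝓡 d)) p q).2

lemma tangentCoord_mk {p x : M} (hx : x ∈ (chartAt (EuclideanSpace ℝ (Fin d)) p).source)
    (v : TangentSpace (𝓡 d) x) : tangentCoord p ⟨x, v⟩ =
      mfderiv (𝓡 d) 𝓘(ℝ, EuclideanSpace ℝ (Fin d)) (extChartAt (𝓡 d) p) x v := by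
  have : IsManifold (𝓡 d) 1 M := IsManifold.of_le (n := ∞) (by simp)
  have h1 := DFunLike.congr_fun
    (TangentBundle.continuousLinearMapAt_trivializationAt (I := 𝓡 d) hx) v
  refine Eq.trans ?_ h1
  have h2 := Bundle.Trivialization.coe_linearMapAt_of_mem (R := ℝ)
    (trivializationAt (EuclideanSpace ℝ (Fin d)) (TangentSpace (𝓡 d) (M := M)) p) (b := x)
    (by simpa using hx)
  exact (congrFun h2 v).symm

variable {f : ∀ x : M, TangentSpace (𝓡 d) x}

lemma contDiffAt_coordField
    (hf : ContMDiff (𝓡 d) (𝓡 d).tangent 2 (fun x => (⟨x, f x⟩ : TangentBundle (𝓡 d) M))) (p : M) :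
    ContDiffAt ℝ 2 (coordField f p) (extChartAt (𝓡 d) p p) := by
  have : IsManifold (𝓡 d) 1 M := IsManifold.of_le (n := ∞) (by simp)
  have h1 := (Bundle.contMDiffAt_section p).1 (hf p)
  have h2 : ContMDiffAt 𝓘(ℝ, EuclideanSpace ℝ (Fin d)) (𝓡 d) 2 (extChartAt (𝓡 d) p).symm
      (extChartAt (𝓡 d) p p) :=
    (contMDiffOn_extChartAt_symm (n := 2) p).contMDiffAt (extChartAt_target_mem_nhds p)
  have h3 := ContMDiffAt.comp (extChartAt (𝓡 d) p p) (by
    rw [extChartAt_to_inv]; exact h1) h2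
  rw [← contMDiffAt_iff_contDiffAt]
  refine h3.congr_of_eventuallyEq ?_
  filter_upwards [extChartAt_target_mem_nhds (I := 𝓡 d) p] with u hu
  have hs : (extChartAt (𝓡 d) p).symm u ∈ (chartAt (EuclideanSpace ℝ (Fin d)) p).source := by
    rw [← extChartAt_source (𝓡 d)]
    exact (extChartAt (𝓡 d) p).map_target hu
  exact (tangentCoord_mk hs _).symm

variable {ψ : ℝ → M → M}

/-- Solutions in a chart are integral curves on the manifold. -/
lemma hasMFDerivAt_extChartAt_symm_comp {p : M} {c : ℝ → EuclideanSpace ℝ (Fin d)} {t : ℝ}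
    (hc : HasDerivAt c (coordField f p (c t)) t) (ht : c t ∈ (extChartAt (𝓡 d) p).target) :
    HasMFDerivAt 𝓘(ℝ, ℝ) (𝓡 d) (fun s => (extChartAt (𝓡 d) p).symm (c s)) t
      ((1 : ℝ →L[ℝ] ℝ).smulRight (f ((extChartAt (𝓡 d) p).symm (c t)))) := by
  have : IsManifold (𝓡 d) 1 M := IsManifold.of_le (n := ∞) (by simp)
  have h1 : MDifferentiableAt 𝓘(ℝ, EuclideanSpace ℝ (Fin d)) (𝓡 d) (extChartAt (𝓡 d) p).symm
      (c t) := by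
    have := mdifferentiableWithinAt_extChartAt_symm (I := 𝓡 d) ht
    rwa [ModelWithCorners.range_eq_univ, mdifferentiableWithinAt_univ] at this
  have h2 := h1.hasMFDerivAt.comp t hc.hasFDerivAt.hasMFDerivAt
  refine h2.congr_mfderiv ?_
  have h3 := mfderivWithin_extChartAt_symm_comp_mfderiv_extChartAt (I := 𝓡 d) ht
  rw [ModelWithCorners.range_eq_univ, mfderivWithin_univ] at h3
  have h4 := DFunLike.congr_fun h3 (f ((extChartAt (𝓡 d) p).symm (c t)))
  refine ContinuousLinearMap.ext fun (r : ℝ) => ?_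
  change mfderiv 𝓘(ℝ, EuclideanSpace ℝ (Fin d)) (𝓡 d) (extChartAt (𝓡 d) p).symm (c t)
    (r • coordField f p (c t)) = r • f ((extChartAt (𝓡 d) p).symm (c t))
  exact (ContinuousLinearMap.map_smul _ r _).trans (congrArg (r • ·) h4)

variable [T2Space M]

lemma flow_add (hf : ContMDiff (𝓡 d) (𝓡 d).tangent 2
    (fun x => (⟨x, f x⟩ : TangentBundle (𝓡 d) M))) (hψ : IsCompleteFlow f ψ)
    (s t : ℝ) (x : M) : ψ (s + t) x = ψ s (ψ t x) := by
  have : IsManifold (𝓡 d) 1 M := IsManifold.of_le (n := ∞) (by simp)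
  have h1 : IsMIntegralCurve ((fun s => ψ s x) ∘ (· + t)) f := (hψ x).2.comp_add t
  have := isMIntegralCurve_Ioo_eq_of_contMDiff_boundaryless (t₀ := 0)
    (hf.of_le (by norm_num)) h1 (hψ (ψ t x)).2 (by simp [(hψ (ψ t x)).1])
  exact congrFun this s

/-- The flow of a `C²` vector field is, for short times, given by the local flow in a chart. -/
lemma exists_flow_eq_local (hf : ContMDiff (𝓡 d) (𝓡 d).tangent 2
    (fun x => (⟨x, f x⟩ : TangentBundle (𝓡 d) M))) (hψ : IsCompleteFlow f ψ)
    (p : M) :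
    ∃ ε : ℝ, 0 < ε ∧ ∃ V : Set M, IsOpen V ∧ p ∈ V ∧ V ⊆ (extChartAt (𝓡 d) p).source ∧
      ∃ (Φ : EuclideanSpace ℝ (Fin d) → ℝ → EuclideanSpace ℝ (Fin d))
        (W : EuclideanSpace ℝ (Fin d) → ℝ →
          EuclideanSpace ℝ (Fin d) →L[ℝ] EuclideanSpace ℝ (Fin d)),
        (∀ x ∈ V, ∀ t ∈ Ioo (-ε) ε, Φ (extChartAt (𝓡 d) p x) t ∈ (extChartAt (𝓡 d) p).target ∧
          ψ t x = (extChartAt (𝓡 d) p).symm (Φ (extChartAt (𝓡 d) p x) t)) ∧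
        ∀ u ∈ (extChartAt (𝓡 d) p).symm ⁻¹' V ∩ (extChartAt (𝓡 d) p).target,
          Φ u 0 = u ∧ W u 0 = 1 ∧ ∀ t ∈ Ioo (-ε) ε,
          HasDerivAt (W u) ((fderiv ℝ (coordField f p) (Φ u t)).comp (W u t)) t ∧
          HasFDerivAt (Φ · t) (W u t) u ∧ ContinuousAt (W · t) u := by
  have : IsManifold (𝓡 d) 1 M := IsManifold.of_le (n := ∞) (by simp)
  obtain ⟨ε, hε, U, hU, hpU, Φ, W, hΦ⟩ := exists_local_flow (contDiffAt_coordField hf p)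
    (extChartAt_target_mem_nhds (I := 𝓡 d) p)
  refine ⟨ε, hε, (extChartAt (𝓡 d) p).source ∩ extChartAt (𝓡 d) p ⁻¹' U,
    (continuousOn_extChartAt p).isOpen_inter_preimage (isOpen_extChartAt_source p) hU,
    ⟨mem_extChartAt_source p, hpU⟩, inter_subset_left, Φ, W, fun x hx => ?_, fun u hu => ?_⟩
  · obtain ⟨h0, -, ht⟩ := hΦ _ hx.2
    have hcurve : IsMIntegralCurveOn
        (fun t => (extChartAt (𝓡 d) p).symm (Φ (extChartAt (𝓡 d) p x) t)) f (Ioo (-ε) ε) :=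
      fun t h => (hasMFDerivAt_extChartAt_symm_comp (ht t h).2.1 (ht t h).1).hasMFDerivWithinAt
    have heq := isMIntegralCurveOn_Ioo_eqOn_of_contMDiff_boundaryless (t₀ := 0)
      (a := -ε) (b := ε) ⟨by linarith, hε⟩ (hf.of_le (by norm_num))
      ((hψ x).2.isMIntegralCurveOn (Ioo (-ε) ε)) hcurve
      (by rw [(hψ x).1, h0, (extChartAt (𝓡 d) p).left_inv hx.1])
    exact fun t h => ⟨(ht t h).1, heq h⟩
  · obtain ⟨⟨hu1, hu2⟩, hu3⟩ := hu
    rw [mem_preimage, (extChartAt (𝓡 d) p).right_inv hu3] at hu2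
    obtain ⟨h0, h1, ht⟩ := hΦ u hu2
    exact ⟨h0, h1, fun t h => (ht t h).2.2⟩

lemma exists_contMDiffAt_flow (hf : ContMDiff (𝓡 d) (𝓡 d).tangent 2
    (fun x => (⟨x, f x⟩ : TangentBundle (𝓡 d) M))) (hψ : IsCompleteFlow f ψ)
    (p : M) : ∃ ε : ℝ, 0 < ε ∧ ∃ V : Set M, IsOpen V ∧ p ∈ V ∧
    ∀ x ∈ V, ∀ t ∈ Ioo (-ε) ε, ContMDiffAt (𝓡 d) (𝓡 d) 1 (ψ t) x := by
  have : IsManifold (𝓡 d) 1 M := IsManifold.of_le (n := ∞) (by simp)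
  obtain ⟨ε, hε, V, hV, hpV, hVs, Φ, W, h1, h2⟩ := exists_flow_eq_local hf hψ p
  refine ⟨ε, hε, V, hV, hpV, fun x hx t ht => ?_⟩
  set u := extChartAt (𝓡 d) p x
  have hopen : IsOpen ((extChartAt (𝓡 d) p).symm ⁻¹' V ∩ (extChartAt (𝓡 d) p).target) := by
    rw [inter_comm]
    exact (continuousOn_extChartAt_symm p).isOpen_inter_preimage (isOpen_extChartAt_target p) hV
  have hu : u ∈ (extChartAt (𝓡 d) p).symm ⁻¹' V ∩ (extChartAt (𝓡 d) p).target := by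
    refine ⟨?_, (extChartAt (𝓡 d) p).map_source (hVs hx)⟩
    rw [mem_preimage, (extChartAt (𝓡 d) p).left_inv (hVs hx)]
    exact hx
  have hΦ : ContDiffAt ℝ 1 (Φ · t) u := contDiffAt_one_iff.2
    ⟨(W · t), _, hopen.mem_nhds hu,
      fun y hy => ((h2 y hy).2.2 t ht).2.2.continuousWithinAt,
      fun y hy => ((h2 y hy).2.2 t ht).2.1⟩
  have hc : ContMDiffAt (𝓡 d) 𝓘(ℝ, EuclideanSpace ℝ (Fin d)) 1 (extChartAt (𝓡 d) p) x :=
    contMDiffAt_extChartAt' (by rw [← extChartAt_source (𝓡 d)]; exact hVs hx)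
  have hs : ContMDiffAt 𝓘(ℝ, EuclideanSpace ℝ (Fin d)) (𝓡 d) 1 (extChartAt (𝓡 d) p).symm
      (Φ u t) := (contMDiffOn_extChartAt_symm (n := 1) p).contMDiffAt
        ((isOpen_extChartAt_target p).mem_nhds (h1 x hx t ht).1)
  refine (hs.comp x (hΦ.contMDiffAt.comp x hc)).congr_of_eventuallyEq ?_
  filter_upwards [hV.mem_nhds hx] with y hy
  exact (h1 y hy t ht).2

/-- The time-`t` maps of the flow are `C¹`: for fixed `x` the set of times at which this holds is
open and closed. -/
theorem contMDiff_flow (hf : ContMDiff (𝓡 d) (𝓡 d).tangent 2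
    (fun x => (⟨x, f x⟩ : TangentBundle (𝓡 d) M))) (hψ : IsCompleteFlow f ψ)
    (t : ℝ) : ContMDiff (𝓡 d) (𝓡 d) 1 (ψ t) := by
  intro x
  have hloc : ∀ t₀ : ℝ, ∃ δ : ℝ, 0 < δ ∧ ∀ s ∈ Metric.ball t₀ δ, ∀ s' ∈ Metric.ball t₀ δ,
      ContMDiffAt (𝓡 d) (𝓡 d) 1 (ψ s) x → ContMDiffAt (𝓡 d) (𝓡 d) 1 (ψ s') x := by
    intro t₀
    obtain ⟨ε, hε, V, hV, hpV, h⟩ := exists_contMDiffAt_flow hf hψ (ψ t₀ x)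
    obtain ⟨δ, hδ, hδV⟩ := Metric.eventually_nhds_iff_ball.1
      ((hψ x).2.continuous.continuousAt.eventually (hV.mem_nhds hpV))
    refine ⟨min δ (ε / 2), by positivity, fun s hs s' hs' hd => ?_⟩
    have hs1 : ψ s x ∈ V := hδV s (Metric.ball_subset_ball (min_le_left _ _) hs)
    have hs2 : s' - s ∈ Ioo (-ε) ε := by
      have e1 := (Metric.mem_ball.1 hs).trans_le (min_le_right _ _)
      have e2 := (Metric.mem_ball.1 hs').trans_le (min_le_right _ _)
      rw [Real.dist_eq, abs_lt] at e1 e2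
      constructor <;> linarith
    have heq : ψ s' = ψ (s' - s) ∘ ψ s := by
      funext y
      rw [Function.comp, ← flow_add hf hψ, sub_add_cancel]
    rw [heq]
    exact (h _ hs1 _ hs2).comp x hd
  have hclopen : IsClopen {t : ℝ | ContMDiffAt (𝓡 d) (𝓡 d) 1 (ψ t) x} := by
    constructor
    · rw [← isOpen_compl_iff, Metric.isOpen_iff]
      intro t₀ ht₀
      obtain ⟨δ, hδ, h⟩ := hloc t₀
      exact ⟨δ, hδ, fun s hs hd => ht₀ (h s hs t₀ (Metric.mem_ball_self hδ) hd)⟩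
    · rw [Metric.isOpen_iff]
      intro t₀ ht₀
      obtain ⟨δ, hδ, h⟩ := hloc t₀
      exact ⟨δ, hδ, fun s hs => h t₀ (Metric.mem_ball_self hδ) s hs ht₀⟩
  have h0 : ContMDiffAt (𝓡 d) (𝓡 d) 1 (ψ 0) x := by
    have : ψ 0 = id := funext fun y => (hψ y).1
    rw [this]
    exact contMDiffAt_id
  have := hclopen.eq_univ ⟨0, h0⟩
  exact (Set.eq_univ_iff_forall.1 this) t

end DiffPos

/-! ### The derivative of the flow -/

namespace DiffPos

variable {d : ℕ} {M : Type*} [TopologicalSpace M]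
  [ChartedSpace (EuclideanSpace ℝ (Fin d)) M]

lemma tangentMap_flow_zero {f : ∀ x : M, TangentSpace (𝓡 d) x} {ψ : ℝ → M → M}
    (hψ : IsCompleteFlow f ψ) (q : TangentBundle (𝓡 d) M) :
    tangentMap (𝓡 d) (𝓡 d) (ψ 0) q = q := by
  have h : ψ 0 = id := funext fun x => (hψ x).1
  rw [h, tangentMap_id, id]

variable [IsManifold (𝓡 d) ∞ M]

/-- The linear isomorphism from the tangent space at `x` to the model space that is given by the
chart at `p`, for `x` in the domain of this chart. -/
noncomputable def toCoord (p x : M) : TangentSpace (𝓡 d) x →L[ℝ] EuclideanSpace ℝ (Fin d) :=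
  (trivializationAt (EuclideanSpace ℝ (Fin d)) (TangentSpace (𝓡 d) (M := M))
    p).continuousLinearMapAt ℝ x

/-- The inverse of `toCoord p x`. -/
noncomputable def ofCoord (p x : M) : EuclideanSpace ℝ (Fin d) →L[ℝ] TangentSpace (𝓡 d) x :=
  (trivializationAt (EuclideanSpace ℝ (Fin d)) (TangentSpace (𝓡 d) (M := M)) p).symmL ℝ x

section coordinates

variable {p x : M}

lemma tangentCoord_eq_toCoord (hx : x ∈ (chartAt (EuclideanSpace ℝ (Fin d)) p).source)
    (v : TangentSpace (𝓡 d) x) : tangentCoord p ⟨x, v⟩ = toCoord p x v := by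
  have h2 := Bundle.Trivialization.coe_linearMapAt_of_mem (R := ℝ)
    (trivializationAt (EuclideanSpace ℝ (Fin d)) (TangentSpace (𝓡 d) (M := M)) p) (b := x)
    (by simpa using hx)
  exact (congrFun h2 v).symm

lemma toCoord_ofCoord (hx : x ∈ (chartAt (EuclideanSpace ℝ (Fin d)) p).source)
    (a : EuclideanSpace ℝ (Fin d)) : toCoord p x (ofCoord p x a) = a :=
  Bundle.Trivialization.continuousLinearMapAt_symmL _ (by simpa using hx) a

lemma ofCoord_toCoord (hx : x ∈ (chartAt (EuclideanSpace ℝ (Fin d)) p).source)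
    (v : TangentSpace (𝓡 d) x) : ofCoord p x (toCoord p x v) = v :=
  Bundle.Trivialization.symmL_continuousLinearMapAt _ (by simpa using hx) v

lemma toCoord_self (v : TangentSpace (𝓡 d) p) : toCoord p p v = v := by
  have : IsManifold (𝓡 d) 1 M := IsManifold.of_le (n := ∞) (by simp)
  have h1 := DFunLike.congr_fun (TangentBundle.continuousLinearMapAt_trivializationAt (I := 𝓡 d)
    (mem_chart_source (EuclideanSpace ℝ (Fin d)) p)) v
  refine h1.trans ?_
  exact DFunLike.congr_fun (mfderiv_extChartAt_self (I := 𝓡 d) (x := p)) v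

lemma ofCoord_self (a : EuclideanSpace ℝ (Fin d)) : ofCoord p p a = a :=
  (toCoord_self (ofCoord p p a)).symm.trans (toCoord_ofCoord (mem_chart_source _ p) a)

lemma tangentCoord_self (v : TangentSpace (𝓡 d) p) : tangentCoord p ⟨p, v⟩ = v :=
  (tangentCoord_eq_toCoord (mem_chart_source _ p) v).trans (toCoord_self v)

lemma tangentCoord_ofCoord (hx : x ∈ (chartAt (EuclideanSpace ℝ (Fin d)) p).source)
    (a : EuclideanSpace ℝ (Fin d)) :
    tangentCoord p (⟨x, ofCoord p x a⟩ : TangentBundle (𝓡 d) M) = a :=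
  (tangentCoord_eq_toCoord hx _).trans (toCoord_ofCoord hx a)

/-- Convergence in the tangent bundle is convergence of the base points and of the coordinates. -/
lemma tendsto_tangentBundle_iff {α : Type*} {l : Filter α} {q : α → TangentBundle (𝓡 d) M}
    {v : TangentSpace (𝓡 d) p} : Tendsto q l (𝓝 ⟨p, v⟩) ↔
      Tendsto (fun i => (q i).proj) l (𝓝 p) ∧
        Tendsto (fun i => tangentCoord p (q i)) l (𝓝 (v : EuclideanSpace ℝ (Fin d))) := by
  have h := (trivializationAt (EuclideanSpace ℝ (Fin d)) (TangentSpace (𝓡 d) (M := M))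
    p).tendsto_nhds_iff (l := l) (f := q) (z := ⟨p, v⟩) (by simp)
  have h2 : tangentCoord p ⟨p, v⟩ = v := tangentCoord_self v
  unfold tangentCoord at h2
  rw [h2] at h
  exact h

end coordinates

variable (d) in
/-- The derivative of the time-`t` map at `x` in the coordinates given by the chart at `p`. -/
noncomputable def flowDeriv (ψ : ℝ → M → M) (p : M) (t : ℝ) (x : M) :
    EuclideanSpace ℝ (Fin d) →L[ℝ] EuclideanSpace ℝ (Fin d) :=
  (toCoord p (ψ t x)).comp ((mfderiv (𝓡 d) (𝓡 d) (ψ t) x).comp (ofCoord p x))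

variable {f : ∀ x : M, TangentSpace (𝓡 d) x} {ψ : ℝ → M → M}

lemma tangentCoord_tangentMap {p : M} {t : ℝ} {q : TangentBundle (𝓡 d) M}
    (hq : q.proj ∈ (chartAt (EuclideanSpace ℝ (Fin d)) p).source)
    (hq' : ψ t q.proj ∈ (chartAt (EuclideanSpace ℝ (Fin d)) p).source) :
    tangentCoord p (tangentMap (𝓡 d) (𝓡 d) (ψ t) q) =
      flowDeriv d ψ p t q.proj (tangentCoord p q) := by
  obtain ⟨x, v⟩ := q
  have h1 : ofCoord p x (tangentCoord p ⟨x, v⟩) = v :=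
    (congrArg (ofCoord p x) (tangentCoord_eq_toCoord hq v)).trans (ofCoord_toCoord hq v)
  refine (tangentCoord_eq_toCoord hq' _).trans ?_
  exact congrArg (fun v => toCoord p (ψ t x) (mfderiv (𝓡 d) (𝓡 d) (ψ t) x v)) h1.symm

lemma flowDeriv_zero (hψ : IsCompleteFlow f ψ) {p x : M}
    (hx : x ∈ (chartAt (EuclideanSpace ℝ (Fin d)) p).source) : flowDeriv d ψ p 0 x = 1 := by
  ext1 a
  have h1 := tangentCoord_tangentMap (ψ := ψ) (p := p) (t := 0)
    (q := ⟨x, ofCoord p x a⟩) hx (by rwa [(hψ _).1])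
  rw [tangentMap_flow_zero hψ, tangentCoord_ofCoord hx] at h1
  exact h1.symm

variable [T2Space M]

lemma flow_fixed
    (hf : ContMDiff (𝓡 d) (𝓡 d).tangent 2 (fun x => (⟨x, f x⟩ : TangentBundle (𝓡 d) M)))
    (hψ : IsCompleteFlow f ψ) {x : M} (hx : f x = 0) (t : ℝ) : ψ t x = x := by
  have : IsManifold (𝓡 d) 1 M := IsManifold.of_le (n := ∞) (by simp)
  have := isMIntegralCurve_Ioo_eq_of_contMDiff_boundaryless (t₀ := 0)
    (hf.of_le (by norm_num)) (hψ x).2 (isMIntegralCurve_const hx) (hψ x).1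
  exact congrFun this t

lemma tangentMap_flow_add
    (hf : ContMDiff (𝓡 d) (𝓡 d).tangent 2 (fun x => (⟨x, f x⟩ : TangentBundle (𝓡 d) M)))
    (hψ : IsCompleteFlow f ψ) (s t : ℝ) (q : TangentBundle (𝓡 d) M) :
    tangentMap (𝓡 d) (𝓡 d) (ψ (s + t)) q =
      tangentMap (𝓡 d) (𝓡 d) (ψ s) (tangentMap (𝓡 d) (𝓡 d) (ψ t) q) := by
  have h : ψ (s + t) = ψ s ∘ ψ t := funext fun x => flow_add hf hψ s t x
  rw [h, tangentMap_comp ((contMDiff_flow hf hψ s).mdifferentiable (by simp))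
    ((contMDiff_flow hf hψ t).mdifferentiable (by simp)), Function.comp]

/-- The derivative of the flow maps the vector field to itself. -/
lemma tangentMap_flow_field
    (hf : ContMDiff (𝓡 d) (𝓡 d).tangent 2 (fun x => (⟨x, f x⟩ : TangentBundle (𝓡 d) M)))
    (hψ : IsCompleteFlow f ψ) (t : ℝ) (x : M) :
    tangentMap (𝓡 d) (𝓡 d) (ψ t) (⟨x, f x⟩ : TangentBundle (𝓡 d) M) = ⟨ψ t x, f (ψ t x)⟩ := by
  have h0 := (hψ x).2 0
  have h1 := (((contMDiff_flow hf hψ t).mdifferentiable (by simp) (ψ 0 x)).hasMFDerivAt).comp 0 h0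
  have h2 := (hψ (ψ t x)).2 0
  have h3 : ψ t ∘ (fun s => ψ s x) = fun s => ψ s (ψ t x) := by
    funext s
    rw [Function.comp, ← flow_add hf hψ, ← flow_add hf hψ, add_comm]
  rw [h3] at h1
  have h4 := DFunLike.congr_fun (hasMFDerivAt_unique h1 h2) (1 : ℝ)
  have h5 : mfderiv (𝓡 d) (𝓡 d) (ψ t) (ψ 0 x) (f (ψ 0 x)) = f (ψ 0 (ψ t x)) := by
    have e1 : ((1 : ℝ →L[ℝ] ℝ).smulRight (f (ψ 0 x))) (1 : ℝ) = f (ψ 0 x) := by simp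
    have e2 : ((1 : ℝ →L[ℝ] ℝ).smulRight (f (ψ 0 (ψ t x)))) (1 : ℝ) = f (ψ 0 (ψ t x)) := by simp
    exact ((congrArg (mfderiv (𝓡 d) (𝓡 d) (ψ t) (ψ 0 x)) e1).symm.trans h4).trans e2
  have h6 : (⟨ψ t (ψ 0 x), mfderiv (𝓡 d) (𝓡 d) (ψ t) (ψ 0 x) (f (ψ 0 x))⟩ :
      TangentBundle (𝓡 d) M) = ⟨ψ 0 (ψ t x), f (ψ 0 (ψ t x))⟩ := by
    have e : ψ t (ψ 0 x) = ψ 0 (ψ t x) := by rw [(hψ x).1, (hψ _).1]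
    refine Bundle.TotalSpace.ext e ?_
    exact heq_of_eq h5
  rw [(hψ x).1, (hψ (ψ t x)).1] at h6
  exact h6

lemma tendsto_flowDeriv
    (hf : ContMDiff (𝓡 d) (𝓡 d).tangent 2 (fun x => (⟨x, f x⟩ : TangentBundle (𝓡 d) M)))
    (hψ : IsCompleteFlow f ψ) {p : M} (hp : f p = 0) (t : ℝ) :
    Tendsto (flowDeriv d ψ p t) (𝓝 p) (𝓝 (flowDeriv d ψ p t p)) := by
  have : IsManifold (𝓡 d) 1 M := IsManifold.of_le (n := ∞) (by simp)
  have h := (ContMDiffAt.mfderiv_const (m := 0) (contMDiff_flow hf hψ t p) (by simp)).continuousAt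
  unfold inTangentCoordinates at h
  rw [flow_fixed hf hψ hp t] at h
  exact h

lemma flowDeriv_add
    (hf : ContMDiff (𝓡 d) (𝓡 d).tangent 2 (fun x => (⟨x, f x⟩ : TangentBundle (𝓡 d) M)))
    (hψ : IsCompleteFlow f ψ) {p x : M} {s t : ℝ}
    (hx : x ∈ (chartAt (EuclideanSpace ℝ (Fin d)) p).source)
    (hx' : ψ t x ∈ (chartAt (EuclideanSpace ℝ (Fin d)) p).source)
    (hx'' : ψ (s + t) x ∈ (chartAt (EuclideanSpace ℝ (Fin d)) p).source) :
    flowDeriv d ψ p (s + t) x = flowDeriv d ψ p s (ψ t x) * flowDeriv d ψ p t x := by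
  ext1 a
  have h0 := tangentCoord_ofCoord hx a
  set q : TangentBundle (𝓡 d) M := ⟨x, ofCoord p x a⟩ with hq
  have h1 := tangentCoord_tangentMap (ψ := ψ) (p := p) (t := s + t) (q := q) hx hx''
  have h2 := tangentCoord_tangentMap (ψ := ψ) (p := p) (t := t) (q := q) hx hx'
  have h3 := tangentCoord_tangentMap (ψ := ψ) (p := p) (t := s)
    (q := tangentMap (𝓡 d) (𝓡 d) (ψ t) q) hx' (by
      change ψ s (ψ t x) ∈ _
      rwa [← flow_add hf hψ])
  rw [tangentMap_flow_add hf hψ, h3, h2, h0] at h1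
  exact h1.symm

lemma flowDeriv_surjective
    (hf : ContMDiff (𝓡 d) (𝓡 d).tangent 2 (fun x => (⟨x, f x⟩ : TangentBundle (𝓡 d) M)))
    (hψ : IsCompleteFlow f ψ) {p x : M} {t : ℝ}
    (hx : x ∈ (chartAt (EuclideanSpace ℝ (Fin d)) p).source)
    (hx' : ψ t x ∈ (chartAt (EuclideanSpace ℝ (Fin d)) p).source) :
    Function.Surjective (flowDeriv d ψ p t x) := by
  intro a
  have hb : ψ (-t) (ψ t x) = x := by rw [← flow_add hf hψ, neg_add_cancel, (hψ x).1]
  have h := flowDeriv_add hf hψ (s := t) (t := -t) hx' (by rwa [hb])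
    (by rwa [add_neg_cancel, (hψ _).1])
  rw [add_neg_cancel, flowDeriv_zero hψ hx', hb] at h
  exact ⟨flowDeriv d ψ p (-t) (ψ t x) a, (DFunLike.congr_fun h a).symm⟩

lemma flowDeriv_natCast_mul
    (hf : ContMDiff (𝓡 d) (𝓡 d).tangent 2 (fun x => (⟨x, f x⟩ : TangentBundle (𝓡 d) M)))
    (hψ : IsCompleteFlow f ψ) {p : M} (hp : f p = 0) (n : ℕ) (t : ℝ) :
    flowDeriv d ψ p (n * t) p = flowDeriv d ψ p t p ^ n := by
  have hm (t : ℝ) : ψ t p ∈ (chartAt (EuclideanSpace ℝ (Fin d)) p).source := by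
    rw [flow_fixed hf hψ hp]
    exact mem_chart_source _ p
  induction n with
  | zero => rw [Nat.cast_zero, zero_mul, pow_zero, flowDeriv_zero hψ (mem_chart_source _ p)]
  | succ n ih =>
    rw [Nat.cast_succ, add_mul, one_mul,
      flowDeriv_add hf hψ (mem_chart_source _ p) (hm _) (hm _), flow_fixed hf hψ hp t, ih, pow_succ]

/-- At a fixed point, the derivative of the flow is the exponential of the linearization. -/
theorem flowDeriv_eq_exp
    (hf : ContMDiff (𝓡 d) (𝓡 d).tangent 2 (fun x => (⟨x, f x⟩ : TangentBundle (𝓡 d) M)))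
    (hψ : IsCompleteFlow f ψ) {p : M} (hp : f p = 0) (t : ℝ) :
    flowDeriv d ψ p t p = NormedSpace.exp (t • linearization f p) := by
  have : IsManifold (𝓡 d) 1 M := IsManifold.of_le (n := ∞) (by simp)
  obtain ⟨ε, hε, V, hV, hpV, hVs, Φ, W, h1, h2⟩ := exists_flow_eq_local hf hψ p
  set u₀ := extChartAt (𝓡 d) p p with hu₀
  set A := linearization f p with hA
  have hopen : IsOpen ((extChartAt (𝓡 d) p).symm ⁻¹' V ∩ (extChartAt (𝓡 d) p).target) := by
    rw [inter_comm]
    exact (continuousOn_extChartAt_symm p).isOpen_inter_preimage (isOpen_extChartAt_target p) hV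
  have hu : u₀ ∈ (extChartAt (𝓡 d) p).symm ⁻¹' V ∩ (extChartAt (𝓡 d) p).target := by
    refine ⟨?_, (extChartAt (𝓡 d) p).map_source (hVs hpV)⟩
    rw [mem_preimage, (extChartAt (𝓡 d) p).left_inv (hVs hpV)]
    exact hpV
  have hΦ : ∀ t ∈ Ioo (-ε) ε, Φ u₀ t = u₀ := fun t ht => by
    obtain ⟨e1, e2⟩ := h1 p hpV t ht
    rw [flow_fixed hf hψ hp] at e2
    have := congrArg (extChartAt (𝓡 d) p) e2
    rw [(extChartAt (𝓡 d) p).right_inv e1] at this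
    exact this.symm
  have hexp : ∀ t : ℝ, HasDerivAt (fun t : ℝ => NormedSpace.exp (t • A))
      (A.comp (NormedSpace.exp (t • A))) t := fun t => hasDerivAt_exp_smul_const' A t
  have hW : ∀ t ∈ Ioo (-ε) ε, W u₀ t = NormedSpace.exp (t • A) := by
    have := ODE_solution_unique_of_mem_Ioo (v := fun _ Z => A.comp Z) (s := fun _ => univ)
      (K := ‖A‖₊) (f := W u₀) (g := fun t => NormedSpace.exp (t • A)) (a := -ε) (b := ε) (t₀ := 0)
      (fun t _ => by
        refine LipschitzWith.lipschitzOnWith (LipschitzWith.of_dist_le_mul fun Z Z' => ?_)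
        rw [dist_eq_norm, dist_eq_norm, ← ContinuousLinearMap.comp_sub]
        exact A.opNorm_comp_le _)
      ⟨by linarith, hε⟩ (fun t ht => ⟨?_, mem_univ _⟩) (fun t ht => ⟨hexp t, mem_univ _⟩)
      ((h2 u₀ hu).2.1.trans
        (NormedSpace.exp_zero.symm.trans (congrArg NormedSpace.exp (zero_smul ℝ A).symm)))
    · exact fun t ht => this ht
    · have := ((h2 u₀ hu).2.2 t ht).1
      rwa [hΦ t ht] at this
  have hsmall : ∀ t ∈ Ioo (-ε) ε, flowDeriv d ψ p t p = NormedSpace.exp (t • A) := by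
    intro t ht
    have hpt := flow_fixed hf hψ hp t
    have hc : MDifferentiableAt (𝓡 d) 𝓘(ℝ, EuclideanSpace ℝ (Fin d)) (extChartAt (𝓡 d) p)
        (ψ t p) := by
      rw [hpt]
      exact mdifferentiableAt_extChartAt (mem_chart_source _ p)
    have hs : MDifferentiableAt 𝓘(ℝ, EuclideanSpace ℝ (Fin d)) (𝓡 d) (extChartAt (𝓡 d) p).symm
        u₀ := by
      have := mdifferentiableWithinAt_extChartAt_symm (I := 𝓡 d) hu.2
      rwa [ModelWithCorners.range_eq_univ, mdifferentiableWithinAt_univ] at this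
    have hsp : (extChartAt (𝓡 d) p).symm u₀ = p := extChartAt_to_inv p
    have hm : MDifferentiableAt (𝓡 d) (𝓡 d) (ψ t) p :=
      (contMDiff_flow hf hψ t).mdifferentiable (by simp) p
    rw [← hW t ht]
    have hfd := ((h2 u₀ hu).2.2 t ht).2.1
    have heq : (extChartAt (𝓡 d) p ∘ ψ t) ∘ (extChartAt (𝓡 d) p).symm =ᶠ[𝓝 u₀] (Φ · t) := by
      filter_upwards [hopen.mem_nhds hu] with u hu'
      obtain ⟨e1, e2⟩ := h1 _ hu'.1 t ht
      rw [(extChartAt (𝓡 d) p).right_inv hu'.2] at e1 e2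
      rw [Function.comp, Function.comp, e2, (extChartAt (𝓡 d) p).right_inv e1]
    have h5 : mfderiv 𝓘(ℝ, EuclideanSpace ℝ (Fin d)) 𝓘(ℝ, EuclideanSpace ℝ (Fin d))
        ((extChartAt (𝓡 d) p ∘ ψ t) ∘ (extChartAt (𝓡 d) p).symm) u₀ = W u₀ t := by
      rw [heq.mfderiv_eq, mfderiv_eq_fderiv]
      exact hfd.fderiv
    have h6 := mfderiv_comp (I := 𝓘(ℝ, EuclideanSpace ℝ (Fin d))) (I' := 𝓡 d)
      (I'' := 𝓘(ℝ, EuclideanSpace ℝ (Fin d))) u₀ (g := extChartAt (𝓡 d) p ∘ ψ t)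
      (f := (extChartAt (𝓡 d) p).symm) (by rw [hsp]; exact hc.comp p hm) hs
    rw [h6] at h5
    refine Eq.trans ?_ h5
    rw [hsp]
    refine Eq.trans ?_ (congrArg
      (fun L : TangentSpace (𝓡 d) p →L[ℝ] EuclideanSpace ℝ (Fin d) => L.comp
        (mfderiv 𝓘(ℝ, EuclideanSpace ℝ (Fin d)) (𝓡 d) (extChartAt (𝓡 d) p).symm u₀))
      (mfderiv_comp p hc hm).symm)
    have e3 := TangentBundle.continuousLinearMapAt_trivializationAt (I := 𝓡 d) (x₀ := p)
      (x := ψ t p) (by rw [hpt]; exact mem_chart_source _ p)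
    have e4 := TangentBundle.symmL_trivializationAt (I := 𝓡 d) (x₀ := p)
      (x := p) (mem_chart_source _ p)
    rw [ModelWithCorners.range_eq_univ, mfderivWithin_univ] at e4
    unfold flowDeriv toCoord ofCoord
    rw [e3, e4]
    rfl
  obtain ⟨n, hn⟩ := exists_nat_gt (|t| / ε)
  have hn0 : (0 : ℝ) < n := lt_of_le_of_lt (by positivity) hn
  have ht : t / n ∈ Ioo (-ε) ε := by
    rw [mem_Ioo, ← abs_lt, abs_div, Nat.abs_cast, div_lt_iff₀ hn0, mul_comm]
    exact (div_lt_iff₀ hε).1 hn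
  have hn' : t = n * (t / n) := by field_simp
  rw [hn', flowDeriv_natCast_mul hf hψ hp, hsmall _ ht, exp_natCast_mul_smul]

end DiffPos

/-! ### Backward orbits in a field of cones -/

namespace DiffPos

/-- Let `A n` be the backward products of operators `D n` close to an operator `G` with dominant
eigenvector `w`, and let `L n` be cones with `D n (L (n + 1)) ⊆ L n` in a fixed sector around `w`.
A vector whose backward orbit decays faster than the dominant one is, up to sign, in `L 0`: by
compactness some nonzero `v` has all its backward images in the cones, the backward orbit of `v`
decays as well, and the combination of the two vectors in the kernel of `φ` vanishes. -/
lemma mem_or_neg_mem_of_tendsto_backward {E : Type*} [NormedAddCommGroup E] [NormedSpace ℝ E]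
    [FiniteDimensional ℝ E] {G : E →L[ℝ] E} {φ : E →L[ℝ] ℝ} {w : E} {ν ρ C : ℝ} (hρ : 0 < ρ)
    (hC : 0 < C) (hν : 2 * ρ ≤ ν) (hG : ∀ v, φ (G v) = ν * φ v)
    (hG' : ∀ v, ‖G v - (ν * φ v) • w‖ ≤ ρ / 8 * ‖v‖) :
    ∃ δ : ℝ, 0 < δ ∧ ∀ (A D : ℕ → E →L[ℝ] E) (L : ℕ → Set E), A 0 = 1 →
      (∀ n, A n = D n * A (n + 1)) → (∀ n, Function.Surjective (A n)) → (∀ n, ‖D n - G‖ ≤ δ) →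
      (∀ n, IsClosed (L n)) → (∀ n, ∀ c : ℝ, 0 ≤ c → ∀ v ∈ L n, c • v ∈ L n) →
      (∀ n, ∃ v ∈ L n, v ≠ 0) → (∀ n, ∀ v ∈ L (n + 1), D n v ∈ L n) →
      (∀ n, ∀ v ∈ L n, ‖v‖ ≤ C * φ v) →
      ∀ a, Tendsto (fun n => ρ ^ n * ‖A n a‖) atTop (𝓝 0) → a ∈ L 0 ∨ -a ∈ L 0 := by
  obtain ⟨δ₁, hδ₁, h1⟩ := tendsto_backward_orbit_of_norm_le (G := G) hρ hC hν hG
  obtain ⟨δ₂, hδ₂, h2⟩ := backward_orbit_eq_zero (G := G) (w := w) hρ hν hG hG'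
  refine ⟨min δ₁ δ₂, lt_min hδ₁ hδ₂, ?_⟩
  intro A D L hA0 hA hsurj hD hcl hsmul hne hpos hφ a ha
  have horb : ∀ b n, A n b = D n (A (n + 1) b) := fun b n => by rw [hA n]; rfl
  let V : ℕ → Set E := fun n => Metric.sphere (0 : E) 1 ∩ A n ⁻¹' L n
  have hVcl : ∀ n, IsClosed (V n) := fun n =>
    Metric.isClosed_sphere.inter ((hcl n).preimage (A n).continuous)
  obtain ⟨v, hv⟩ : (⋂ n, V n).Nonempty := by
    refine IsCompact.nonempty_iInter_of_sequence_nonempty_isCompact_isClosed V ?_ ?_ ?_ hVcl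
    · intro n b hb
      refine ⟨hb.1, ?_⟩
      rw [mem_preimage, horb]
      exact hpos n _ hb.2
    · intro n
      obtain ⟨k, hk, hk0⟩ := hne n
      obtain ⟨b, rfl⟩ := hsurj n k
      have hb : b ≠ 0 := fun h => hk0 (by rw [h, map_zero])
      refine ⟨‖b‖⁻¹ • b, ?_, ?_⟩
      · rw [mem_sphere_zero_iff_norm, norm_smul, norm_inv, norm_norm,
          inv_mul_cancel₀ (norm_ne_zero_iff.2 hb)]
      · rw [mem_preimage, map_smul]
        exact hsmul n _ (by positivity) _ hk
    · exact (isCompact_sphere _ _).inter_right ((hcl 0).preimage (A 0).continuous)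
  rw [mem_iInter] at hv
  have hv0 : A 0 v = v := by rw [hA0]; rfl
  have hvL : v ∈ L 0 := by
    have := (hv 0).2
    rwa [mem_preimage, hv0] at this
  have hvn : ‖v‖ = 1 := by simpa using (hv 0).1
  have hφv : 0 < φ v := by
    have := hφ 0 v hvL
    rw [hvn] at this
    exact pos_of_mul_pos_right (one_pos.trans_le this) hC.le
  have hvt := h1 D (fun n => A n v) (fun n => (hD n).trans (min_le_left _ _)) (horb v) fun n =>
    (hφ n _ (hv n).2).trans (by gcongr; exact le_abs_self _)
  set α := φ a / φ v with hα
  have hz := h2 D (fun n => A n (a - α • v)) (fun n => (hD n).trans (min_le_right _ _)) (horb _)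
    (by
      have hs := ha.add (hvt.const_mul |α|)
      rw [mul_zero, add_zero] at hs
      refine squeeze_zero (fun n => by positivity) (fun n => ?_) hs
      have : ‖A n (a - α • v)‖ ≤ ‖A n a‖ + |α| * ‖A n v‖ := by
        rw [map_sub, map_smul]
        refine (norm_sub_le _ _).trans ?_
        rw [norm_smul, Real.norm_eq_abs]
      calc ρ ^ n * ‖A n (a - α • v)‖ ≤ ρ ^ n * (‖A n a‖ + |α| * ‖A n v‖) := by gcongr
        _ = _ := by ring)
    (by
      have : φ (a - α • v) = 0 := by
        rw [map_sub, map_smul, smul_eq_mul, hα, div_mul_cancel₀ _ hφv.ne', sub_self]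
      simpa [hA0] using this)
  have hav : a = α • v := by
    have : a - α • v = 0 := by simpa [hA0] using hz
    exact sub_eq_zero.1 this
  obtain h | h := le_total 0 α
  · exact Or.inl (hav ▸ hsmul 0 α h v hvL)
  · refine Or.inr ?_
    rw [hav, ← neg_smul]
    exact hsmul 0 _ (by linarith) v hvL

/-! ### The cone field near a fixed point -/

variable {d : ℕ} {M : Type*} [TopologicalSpace M]
  [ChartedSpace (EuclideanSpace ℝ (Fin d)) M] [IsManifold (𝓡 d) ∞ M]

/-- A cone field is closed as a subset of the tangent bundle. -/
lemma ConeField.isClosed_total (K : ConeField d M) :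
    IsClosed {q : TangentBundle (𝓡 d) M | q.2 ∈ K.cone q.1} := by
  have : IsManifold (𝓡 d) 1 M := IsManifold.of_le (n := ∞) (by simp)
  rw [← isOpen_compl_iff, isOpen_iff_mem_nhds]
  intro q hq
  obtain ⟨U, hU, hqU, S, k, hk, hmem⟩ := K.smooth q.1
  have hUo : IsOpen {q : TangentBundle (𝓡 d) M | q.proj ∈ U} :=
    hU.preimage (FiberBundle.continuous_proj (EuclideanSpace ℝ (Fin d))
      (TangentSpace (𝓡 d) (M := M)))
  have hq' : ¬ q.2 ∈ K.cone q.1 := hq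
  rw [hmem q.1 hqU q.2] at hq'
  push Not at hq'
  obtain ⟨i, hi, hki⟩ := hq'
  have hc : ContinuousAt (k i) q := ((hk i hi).continuousOn).continuousAt (hUo.mem_nhds hqU)
  filter_upwards [hUo.mem_nhds hqU, hc.eventually_lt continuousAt_const hki] with r hr hr'
  intro hrK
  exact absurd ((hmem r.1 hr r.2).1 hrK i hi) (not_le.2 hr')

/-- The cone `K(p)`, as a subset of the model space. -/
def ConeField.coneAt (K : ConeField d M) (p : M) : Set (EuclideanSpace ℝ (Fin d)) := K.cone p

lemma ConeField.isPointedCone (K : ConeField d M) (p : M) : IsPointedCone (K.coneAt p) :=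
  ⟨K.isClosed_cone p, K.zero_mem p, K.add_mem p, K.smul_mem p, K.pointed p⟩

/-- The cone `K(x)` in the coordinates given by the chart at `p`; it is meaningful only for `x` in
the domain of the chart. -/
def ConeField.localCone (K : ConeField d M) (p x : M) : Set (EuclideanSpace ℝ (Fin d)) :=
  {a | ofCoord p x a ∈ K.cone x}

section localCone

variable {K : ConeField d M} {p x : M}

lemma ConeField.isClosed_localCone : IsClosed (K.localCone p x) :=
  (K.isClosed_cone x).preimage (ofCoord p x).continuous

lemma ConeField.smul_mem_localCone (c : ℝ) (hc : 0 ≤ c) (a : EuclideanSpace ℝ (Fin d))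
    (ha : a ∈ K.localCone p x) : c • a ∈ K.localCone p x := by
  have : ofCoord p x (c • a) ∈ K.cone x := by
    rw [map_smul]
    exact K.smul_mem x c hc _ ha
  exact this

lemma ConeField.toCoord_mem_localCone
    (hx : x ∈ (chartAt (EuclideanSpace ℝ (Fin d)) p).source) {v : TangentSpace (𝓡 d) x} :
    toCoord p x v ∈ K.localCone p x ↔ v ∈ K.cone x := by
  change ofCoord p x (toCoord p x v) ∈ K.cone x ↔ _
  rw [ofCoord_toCoord hx]

lemma ConeField.exists_mem_localCone [Nontrivial (EuclideanSpace ℝ (Fin d))]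
    (hx : x ∈ (chartAt (EuclideanSpace ℝ (Fin d)) p).source) :
    ∃ a ∈ K.localCone p x, a ≠ 0 := by
  obtain ⟨v, hv, hv0⟩ : ∃ v ∈ K.cone x, v ≠ 0 := by
    by_contra! h
    have h1 : Submodule.span ℝ (K.cone x) = ⊥ := Submodule.span_eq_bot.2 h
    rw [K.solid x] at h1
    have : Nontrivial (TangentSpace (𝓡 d) x) := ‹Nontrivial (EuclideanSpace ℝ (Fin d))›
    exact top_ne_bot h1
  refine ⟨toCoord p x v, (K.toCoord_mem_localCone hx).2 hv, fun h => hv0 ?_⟩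
  rw [← ofCoord_toCoord hx v, h, map_zero]

variable {α : Type*} {l : Filter α}

lemma tendsto_ofCoord {x : α → M} {a : α → EuclideanSpace ℝ (Fin d)}
    {b : EuclideanSpace ℝ (Fin d)} (hx : Tendsto x l (𝓝 p)) (ha : Tendsto a l (𝓝 b)) :
    Tendsto (fun i => (⟨x i, ofCoord p (x i) (a i)⟩ : TangentBundle (𝓡 d) M)) l
      (𝓝 ⟨p, (b : TangentSpace (𝓡 d) p)⟩) := by
  refine tendsto_tangentBundle_iff.2 ⟨hx, ha.congr' ?_⟩
  filter_upwards [hx.eventually ((chartAt (EuclideanSpace ℝ (Fin d)) p).open_source.mem_nhds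
    (mem_chart_source _ p))] with i hi
  exact (tangentCoord_ofCoord hi _).symm

lemma ConeField.mem_coneAt_of_tendsto [l.NeBot] {x : α → M} {a : α → EuclideanSpace ℝ (Fin d)}
    {b : EuclideanSpace ℝ (Fin d)} (hx : Tendsto x l (𝓝 p)) (ha : Tendsto a l (𝓝 b))
    (h : ∀ᶠ i in l, a i ∈ K.localCone p (x i)) : b ∈ K.coneAt p :=
  K.isClosed_total.mem_of_tendsto (tendsto_ofCoord hx ha) h

/-- Near `p`, the cones lie in a sector of any functional that is positive on the cone at `p`. -/
lemma ConeField.exists_norm_le_localCone {φ : EuclideanSpace ℝ (Fin d) →L[ℝ] ℝ}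
    (hφ : ∀ v ∈ K.coneAt p, v ≠ 0 → 0 < φ v) :
    ∃ C : ℝ, 0 < C ∧ ∀ᶠ x in 𝓝 p, ∀ a ∈ K.localCone p x, ‖a‖ ≤ C * φ a := by
  obtain ⟨c, hc, hcK⟩ : ∃ c : ℝ, 0 < c ∧ ∀ v ∈ K.coneAt p, ‖v‖ = 1 → c < φ v := by
    have hS : IsCompact (Metric.sphere (0 : EuclideanSpace ℝ (Fin d)) 1 ∩ K.coneAt p) :=
      (isCompact_sphere _ _).inter_right (K.isPointedCone p).isClosed
    obtain he | hne := (Metric.sphere (0 : EuclideanSpace ℝ (Fin d)) 1 ∩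
        K.coneAt p).eq_empty_or_nonempty
    · refine ⟨1, one_pos, fun v hv hv1 => ?_⟩
      have : v ∈ Metric.sphere (0 : EuclideanSpace ℝ (Fin d)) 1 ∩ K.coneAt p :=
        ⟨by simpa using hv1, hv⟩
      rw [he] at this
      exact this.elim
    · obtain ⟨v₀, hv₀, hmin⟩ := hS.exists_isMinOn hne φ.continuous.continuousOn
      have h0 : v₀ ≠ 0 := fun h => by simpa [h] using hv₀.1
      have h1 := hφ v₀ hv₀.2 h0
      refine ⟨φ v₀ / 2, by positivity, fun v hv hv1 => ?_⟩
      have : φ v₀ ≤ φ v := hmin (show v ∈ _ from ⟨by simpa using hv1, hv⟩)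
      linarith
  refine ⟨c⁻¹, by positivity, ?_⟩
  have hS : IsCompact (Metric.sphere (0 : EuclideanSpace ℝ (Fin d)) 1 ∩ {a | φ a ≤ c}) :=
    (isCompact_sphere _ _).inter_right (isClosed_le φ.continuous continuous_const)
  have hev := hS.eventually_forall_of_forall_eventually (x₀ := p)
    (P := fun x a => a ∉ K.localCone p x) (by
      rintro b ⟨hb1, hb⟩
      have hb1 : ‖b‖ = 1 := by simpa using hb1
      have hbK : b ∉ K.coneAt p := fun h => (hcK b h hb1).not_ge hb
      have ht := tendsto_ofCoord (l := 𝓝 (p, b)) (p := p) (x := Prod.fst) (a := Prod.snd)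
        (continuous_fst.tendsto _) (continuous_snd.tendsto _)
      exact ht.eventually (K.isClosed_total.isOpen_compl.mem_nhds hbK))
  filter_upwards [hev] with x hx a ha
  by_cases ha0 : a = 0
  · simp [ha0]
  have hn : 0 < ‖a‖ := norm_pos_iff.2 ha0
  by_contra! hlt
  refine hx (‖a‖⁻¹ • a) ⟨?_, ?_⟩ (K.smul_mem_localCone _ (by positivity) a ha)
  · rw [mem_sphere_zero_iff_norm, norm_smul, norm_inv, norm_norm,
      inv_mul_cancel₀ hn.ne']
  · change φ (‖a‖⁻¹ • a) ≤ c
    rw [map_smul, smul_eq_mul]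
    rw [inv_mul_lt_iff₀ hc] at hlt
    rw [inv_mul_le_iff₀ hn]
    linarith

end localCone

variable {f : ∀ x : M, TangentSpace (𝓡 d) x} {ψ : ℝ → M → M} {K : ConeField d M}

lemma flowDeriv_mem_localCone (hK : DifferentiallyPositive ψ K) {p x : M} {t : ℝ} (ht : 0 ≤ t)
    (hx' : ψ t x ∈ (chartAt (EuclideanSpace ℝ (Fin d)) p).source)
    {a : EuclideanSpace ℝ (Fin d)} (ha : a ∈ K.localCone p x) :
    flowDeriv d ψ p t x a ∈ K.localCone p (ψ t x) :=
  (K.toCoord_mem_localCone hx').2 (hK x _ ha t ht)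

variable [T2Space M]

lemma tangentMap_flow_fixed
    (hf : ContMDiff (𝓡 d) (𝓡 d).tangent 2 (fun x => (⟨x, f x⟩ : TangentBundle (𝓡 d) M)))
    (hψ : IsCompleteFlow f ψ) {p : M} (hp : f p = 0) (t : ℝ) (v : EuclideanSpace ℝ (Fin d)) :
    tangentMap (𝓡 d) (𝓡 d) (ψ t) (⟨p, (v : TangentSpace (𝓡 d) p)⟩ : TangentBundle (𝓡 d) M) =
      ⟨p, (flowDeriv d ψ p t p v : EuclideanSpace ℝ (Fin d))⟩ := by
  have h1 := tangentCoord_tangentMap (ψ := ψ) (p := p) (t := t)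
    (q := ⟨p, (v : TangentSpace (𝓡 d) p)⟩) (mem_chart_source _ p)
    (by rw [flow_fixed hf hψ hp]; exact mem_chart_source _ p)
  rw [show tangentCoord p (⟨p, (v : TangentSpace (𝓡 d) p)⟩ : TangentBundle (𝓡 d) M) = v
    from tangentCoord_self _] at h1
  have h2 : (tangentMap (𝓡 d) (𝓡 d) (ψ t)
      (⟨p, (v : TangentSpace (𝓡 d) p)⟩ : TangentBundle (𝓡 d) M)).proj = p :=
    flow_fixed hf hψ hp t
  generalize tangentMap (𝓡 d) (𝓡 d) (ψ t)
      (⟨p, (v : TangentSpace (𝓡 d) p)⟩ : TangentBundle (𝓡 d) M) = q at h1 h2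
  obtain ⟨y, u⟩ := q
  obtain rfl : y = p := h2
  exact congrArg (Bundle.TotalSpace.mk y) ((tangentCoord_self u).symm.trans h1)

/-- At a fixed point, the derivative of the flow after the time of strict positivity maps the
nonzero vectors of the cone to its interior. -/
lemma flowDeriv_mem_interior
    (hf : ContMDiff (𝓡 d) (𝓡 d).tangent 2 (fun x => (⟨x, f x⟩ : TangentBundle (𝓡 d) M)))
    (hψ : IsCompleteFlow f ψ) {p : M} (hp : f p = 0) {T : ℝ}
    (hT : ∀ v ∈ K.cone p, mfderiv (𝓡 d) (𝓡 d) (ψ T) p v ∈ interior (K.cone (ψ T p)) ∪ {0})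
    {v : EuclideanSpace ℝ (Fin d)} (hv : v ∈ K.coneAt p) (hv0 : v ≠ 0) :
    flowDeriv d ψ p T p v ∈ interior (K.coneAt p) := by
  have h1 : (tangentMap (𝓡 d) (𝓡 d) (ψ T)
      (⟨p, (v : TangentSpace (𝓡 d) p)⟩ : TangentBundle (𝓡 d) M)).2 ∈ interior (K.cone
      (tangentMap (𝓡 d) (𝓡 d) (ψ T)
      (⟨p, (v : TangentSpace (𝓡 d) p)⟩ : TangentBundle (𝓡 d) M)).1) ∪ {0} := hT v hv
  rw [tangentMap_flow_fixed hf hψ hp] at h1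
  refine h1.resolve_right fun h => hv0 ?_
  have h2 := flow_fixed hf hψ hp T
  have hs := flowDeriv_surjective hf hψ (p := p) (x := p) (t := T) (mem_chart_source _ p)
    (by rw [h2]; exact mem_chart_source _ p)
  have hi : Function.Injective (flowDeriv d ψ p T p) :=
    (LinearMap.injective_iff_surjective (f := (flowDeriv d ψ p T p).toLinearMap)).2 hs
  exact hi (Eq.trans h (map_zero (flowDeriv d ψ p T p)).symm)

end DiffPos

/-! ### Orbits converging to a fixed point -/

namespace DiffPos

lemma tendsto_clm_apply {E F α : Type*} [NormedAddCommGroup E] [NormedSpace ℝ E]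
    [NormedAddCommGroup F] [NormedSpace ℝ F] {l : Filter α} {A : α → E →L[ℝ] F} {B : E →L[ℝ] F}
    {x : α → E} {y : E} (hA : Tendsto A l (𝓝 B)) (hx : Tendsto x l (𝓝 y)) :
    Tendsto (fun i => A i (x i)) l (𝓝 (B y)) :=
  ((isBoundedBilinearMap_apply (𝕜 := ℝ) (E := E) (F := F)).continuous.tendsto (B, y)).comp
    (hA.prodMk_nhds hx)

variable {d : ℕ} {M : Type*} [TopologicalSpace M]
  [ChartedSpace (EuclideanSpace ℝ (Fin d)) M] [IsManifold (𝓡 d) ∞ M]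
  {f : ∀ x : M, TangentSpace (𝓡 d) x} {ψ : ℝ → M → M} {K : ConeField d M}

/-- Along the times `-n τ`, a backward orbit that converges to `p` is eventually in any given
neighbourhood of `p`. -/
lemma exists_forall_backward {x : M} {p : M} (hx : Tendsto (fun t => ψ t x) atBot (𝓝 p)) {τ : ℝ}
    (hτ : 0 < τ) {s : M → Prop} (hs : ∀ᶠ y in 𝓝 p, s y) :
    ∃ n₀ : ℕ, ∀ n ≥ n₀, s (ψ (-(n * τ)) x) := by
  have h1 : Tendsto (fun n : ℕ => -((n : ℝ) * τ)) atTop atBot :=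
    tendsto_neg_atTop_atBot.comp (tendsto_natCast_atTop_atTop.atTop_mul_const hτ)
  exact eventually_atTop.1 ((hx.comp h1).eventually hs)

variable [T2Space M]

lemma smul_field_mem_cone
    (hf : ContMDiff (𝓡 d) (𝓡 d).tangent 2 (fun x => (⟨x, f x⟩ : TangentBundle (𝓡 d) M)))
    (hψ : IsCompleteFlow f ψ) (hK : DifferentiallyPositive ψ K) {x : M} {c t : ℝ} (ht : 0 ≤ t)
    (h : c • f x ∈ K.cone x) : c • f (ψ t x) ∈ K.cone (ψ t x) := by
  have h1 : mfderiv (𝓡 d) (𝓡 d) (ψ t) x (f x) = f (ψ t x) :=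
    Bundle.TotalSpace.mk_inj.1 (tangentMap_flow_field hf hψ t x)
  have h2 := hK x _ h t ht
  rwa [map_smul, h1] at h2

lemma field_flow_ne_zero
    (hf : ContMDiff (𝓡 d) (𝓡 d).tangent 2 (fun x => (⟨x, f x⟩ : TangentBundle (𝓡 d) M)))
    (hψ : IsCompleteFlow f ψ) {x : M} (hx : f x ≠ 0) (t : ℝ) : f (ψ t x) ≠ 0 := by
  intro h
  have h1 := flow_fixed hf hψ h (-t)
  rw [← flow_add hf hψ, neg_add_cancel, (hψ x).1] at h1
  rw [← h1] at h
  exact hx h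

lemma tangentCoord_field_flow
    (hf : ContMDiff (𝓡 d) (𝓡 d).tangent 2 (fun x => (⟨x, f x⟩ : TangentBundle (𝓡 d) M)))
    (hψ : IsCompleteFlow f ψ) {p x : M} {t : ℝ}
    (hx : x ∈ (chartAt (EuclideanSpace ℝ (Fin d)) p).source)
    (hx' : ψ t x ∈ (chartAt (EuclideanSpace ℝ (Fin d)) p).source) :
    tangentCoord p ⟨ψ t x, f (ψ t x)⟩ = flowDeriv d ψ p t x (tangentCoord p ⟨x, f x⟩) := by
  rw [← tangentMap_flow_field hf hψ]
  exact tangentCoord_tangentMap hx hx'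

variable {p : M} {T μ : ℝ} {w : EuclideanSpace ℝ (Fin d)} {φ : EuclideanSpace ℝ (Fin d) →L[ℝ] ℝ}

/-- If the velocity of a backward orbit decays faster than the dominant rate, then it is in the
cones, up to sign. -/
theorem exists_smul_field_mem_cone
    (hf : ContMDiff (𝓡 d) (𝓡 d).tangent 2 (fun x => (⟨x, f x⟩ : TangentBundle (𝓡 d) M)))
    (hψ : IsCompleteFlow f ψ) (hK : DifferentiallyPositive ψ K)
    [Nontrivial (EuclideanSpace ℝ (Fin d))] (hp : f p = 0) (hT : 0 < T)
    (h : IsPerronTriple (flowDeriv d ψ p T p) (K.coneAt p) μ w φ) {x : M}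
    (hx : Tendsto (fun t => ψ t x) atBot (𝓝 p)) {N : ℕ} (hN : 0 < N) {ρ : ℝ} (hρ : 0 < ρ)
    (hν : 2 * ρ ≤ μ ^ N)
    (hG : ∀ v, ‖(flowDeriv d ψ p T p ^ N) v - (μ ^ N * φ v) • w‖ ≤ ρ / 8 * ‖v‖)
    (hu : Tendsto (fun n : ℕ => ρ ^ n * ‖tangentCoord p
      ⟨ψ (-(n * (N * T))) x, f (ψ (-(n * (N * T))) x)⟩‖) atTop (𝓝 0)) :
    ∃ ε : ℝ, (ε = 1 ∨ ε = -1) ∧ ε • f x ∈ K.cone x := by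
  set τ : ℝ := N * T with hτ
  have hτ0 : 0 < τ := by positivity
  obtain ⟨C, hC, hsec⟩ := K.exists_norm_le_localCone h.apply_pos
  obtain ⟨δ, hδ, hmain⟩ := mem_or_neg_mem_of_tendsto_backward hρ hC hν (h.apply_pow N) hG
  rw [← flowDeriv_natCast_mul hf hψ hp, ← hτ] at hmain
  have hD : ∀ᶠ y in 𝓝 p, ‖flowDeriv d ψ p τ y - flowDeriv d ψ p τ p‖ ≤ δ := by
    filter_upwards [(tendsto_flowDeriv hf hψ hp τ).eventually (Metric.ball_mem_nhds _ hδ)] with y hy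
    rw [← dist_eq_norm]
    exact (Metric.mem_ball.1 hy).le
  obtain ⟨n₀, hn₀⟩ := exists_forall_backward hx hτ0 ((hsec.and hD).and
    ((chartAt (EuclideanSpace ℝ (Fin d)) p).open_source.mem_nhds (mem_chart_source _ p)))
  set y := ψ (-(n₀ * τ)) x with hy
  have hshift : ∀ n : ℕ, ψ (-(n * τ)) y = ψ (-((n + n₀ : ℕ) * τ)) x := fun n => by
    rw [hy, ← flow_add hf hψ]
    congr 1
    push_cast
    ring
  have hgood := fun n : ℕ => hn₀ (n + n₀) (by lia)
  simp only [← hshift] at hgood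
  have hsrc := fun n => (hgood n).2
  have hstep : ∀ n : ℕ, ψ τ (ψ (-((n + 1 : ℕ) * τ)) y) = ψ (-(n * τ)) y := fun n => by
    rw [← flow_add hf hψ]
    congr 1
    push_cast
    ring
  have hy0 : ψ (-((0 : ℕ) * τ)) y = y := by simp [(hψ y).1]
  have hysrc : y ∈ (chartAt (EuclideanSpace ℝ (Fin d)) p).source := by
    have := hsrc 0
    rwa [hy0] at this
  have key := hmain (fun n => flowDeriv d ψ p (-(n * τ)) y)
    (fun n => flowDeriv d ψ p τ (ψ (-((n + 1 : ℕ) * τ)) y))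
    (fun n => K.localCone p (ψ (-(n * τ)) y))
    (by simpa using flowDeriv_zero hψ hysrc)
    (fun n => by
      have e : -((n : ℝ) * τ) = τ + -((n + 1 : ℕ) * τ) := by push_cast; ring
      have := flowDeriv_add hf hψ (s := τ) (t := -((n + 1 : ℕ) * τ)) hysrc (hsrc _)
        (by rw [← e]; exact hsrc n)
      rwa [← e] at this)
    (fun n => flowDeriv_surjective hf hψ hysrc (hsrc n))
    (fun n => (hgood (n + 1)).1.2)
    (fun n => K.isClosed_localCone)
    (fun n => K.smul_mem_localCone)
    (fun n => K.exists_mem_localCone (hsrc n))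
    (fun n v hv => by
      have := flowDeriv_mem_localCone hK (t := τ) hτ0.le
        (by rw [hstep]; exact hsrc n) hv
      rwa [hstep] at this)
    (fun n => (hgood n).1.1)
    (tangentCoord p ⟨y, f y⟩)
    (by
      have h1 := ((tendsto_add_atTop_iff_nat n₀).2 hu).const_mul ((ρ ^ n₀)⁻¹)
      rw [mul_zero] at h1
      refine h1.congr fun n => ?_
      rw [← tangentCoord_field_flow hf hψ hysrc (hsrc n), hshift, pow_add]
      field_simp)
  have hyK : ∃ ε : ℝ, (ε = 1 ∨ ε = -1) ∧ ε • f y ∈ K.cone y := by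
    simp only [hy0] at key
    rw [tangentCoord_eq_toCoord hysrc] at key
    obtain h1 | h1 := key
    · exact ⟨1, Or.inl rfl, by rw [one_smul]; exact (K.toCoord_mem_localCone hysrc).1 h1⟩
    · refine ⟨-1, Or.inr rfl, (K.toCoord_mem_localCone hysrc).1 ?_⟩
      rw [map_smul, neg_smul, one_smul]
      exact h1
  obtain ⟨ε, hε, hεy⟩ := hyK
  refine ⟨ε, hε, ?_⟩
  have h1 := smul_field_mem_cone hf hψ hK (t := n₀ * τ) (by positivity) hεy
  rwa [hy, ← flow_add hf hψ, add_neg_cancel, (hψ x).1] at h1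

/-- A backward orbit whose velocity stays in a sector around the dominant direction decays
backwards in time faster than any `ρ⁻ⁿ` with `2ρ` at most the dominant rate. -/
lemma tendsto_field_backward
    (hf : ContMDiff (𝓡 d) (𝓡 d).tangent 2 (fun x => (⟨x, f x⟩ : TangentBundle (𝓡 d) M)))
    (hψ : IsCompleteFlow f ψ) (hp : f p = 0) {x : M}
    (hx : Tendsto (fun t => ψ t x) atBot (𝓝 p)) {τ ν ρ C : ℝ} (hτ0 : 0 < τ) (hρ : 0 < ρ)
    (hν : 2 * ρ ≤ ν) (hG : ∀ v, φ (flowDeriv d ψ p τ p v) = ν * φ v) (hC : 0 < C)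
    (hu : ∀ᶠ t in atBot, ‖tangentCoord p ⟨ψ t x, f (ψ t x)⟩‖ ≤
      C * |φ (tangentCoord p ⟨ψ t x, f (ψ t x)⟩)|) :
    Tendsto (fun n : ℕ => ρ ^ n * ‖tangentCoord p
      ⟨ψ (-(n * τ)) x, f (ψ (-(n * τ)) x)⟩‖) atTop (𝓝 0) := by
  obtain ⟨δ, hδ, hmain⟩ := tendsto_backward_orbit_of_norm_le hρ hC hν hG
  have hD : ∀ᶠ y in 𝓝 p, ‖flowDeriv d ψ p τ y - flowDeriv d ψ p τ p‖ ≤ δ := by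
    filter_upwards [(tendsto_flowDeriv hf hψ hp τ).eventually (Metric.ball_mem_nhds _ hδ)] with y hy
    rw [← dist_eq_norm]
    exact (Metric.mem_ball.1 hy).le
  obtain ⟨n₁, hn₁⟩ := exists_forall_backward hx hτ0 (hD.and
    ((chartAt (EuclideanSpace ℝ (Fin d)) p).open_source.mem_nhds (mem_chart_source _ p)))
  have ht : Tendsto (fun n : ℕ => -((n : ℝ) * τ)) atTop atBot :=
    tendsto_neg_atTop_atBot.comp (tendsto_natCast_atTop_atTop.atTop_mul_const hτ0)
  obtain ⟨n₂, hn₂⟩ := eventually_atTop.1 (ht.eventually hu)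
  set n₀ := max n₁ n₂
  have hgood := fun n : ℕ => hn₁ (n + n₀) (by lia)
  have hgood' := fun n : ℕ => hn₂ (n + n₀) (by lia)
  have hstep : ∀ n : ℕ, ψ τ (ψ (-((n + 1 + n₀ : ℕ) * τ)) x) = ψ (-((n + n₀ : ℕ) * τ)) x :=
    fun n => by
      rw [← flow_add hf hψ]
      congr 1
      push_cast
      ring
  have key := hmain (fun n => flowDeriv d ψ p τ (ψ (-((n + 1 + n₀ : ℕ) * τ)) x))
    (fun n => tangentCoord p ⟨ψ (-((n + n₀ : ℕ) * τ)) x, f (ψ (-((n + n₀ : ℕ) * τ)) x)⟩)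
    (fun n => (hgood (n + 1)).1)
    (fun n => by
      have := tangentCoord_field_flow hf hψ (t := τ) (hgood (n + 1)).2
        (by rw [hstep]; exact (hgood n).2)
      rwa [hstep] at this)
    hgood'
  have h1 := key.const_mul (ρ ^ n₀)
  rw [mul_zero] at h1
  refine (tendsto_add_atTop_iff_nat n₀).1 (h1.congr fun n => ?_)
  rw [pow_add]
  ring

/-- An orbit that converges to `p` with its velocity in the cones becomes tangent to the dominant
direction `w`: a limit of its directions is in all the cones `Pⁿ K(p)`. -/
theorem tendsto_direction
    (hf : ContMDiff (𝓡 d) (𝓡 d).tangent 2 (fun x => (⟨x, f x⟩ : TangentBundle (𝓡 d) M)))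
    (hψ : IsCompleteFlow f ψ) (hK : DifferentiallyPositive ψ K) (hp : f p = 0)
    (h : IsPerronTriple (flowDeriv d ψ p T p) (K.coneAt p) μ w φ) {x : M}
    (hx : Tendsto (fun t => ψ t x) atTop (𝓝 p)) (hfx : f x ≠ 0) {ε : ℝ} (hε : ε ≠ 0)
    (hcone : ε • f x ∈ K.cone x) :
    Tendsto (fun t => ‖ε • tangentCoord p ⟨ψ t x, f (ψ t x)⟩‖⁻¹ •
      (ε • tangentCoord p ⟨ψ t x, f (ψ t x)⟩)) atTop (𝓝 (‖w‖⁻¹ • w)) := by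
  set b : ℝ → EuclideanSpace ℝ (Fin d) := fun t => ε • tangentCoord p ⟨ψ t x, f (ψ t x)⟩ with hb
  have hsrc : ∀ᶠ t in atTop, ψ t x ∈ (chartAt (EuclideanSpace ℝ (Fin d)) p).source :=
    hx.eventually ((chartAt (EuclideanSpace ℝ (Fin d)) p).open_source.mem_nhds
      (mem_chart_source _ p))
  have hb0 : ∀ t, ψ t x ∈ (chartAt (EuclideanSpace ℝ (Fin d)) p).source → b t ≠ 0 := by
    intro t ht h0
    have h1 := (smul_eq_zero.1 h0).resolve_left hε
    rw [tangentCoord_eq_toCoord ht] at h1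
    refine field_flow_ne_zero hf hψ hfx t ?_
    rw [← ofCoord_toCoord ht (f (ψ t x)), h1, map_zero]
  change Tendsto (fun t => ‖b t‖⁻¹ • b t) atTop (𝓝 (‖w‖⁻¹ • w))
  rw [tendsto_iff_ultrafilter]
  intro U hU
  have hsph : ∀ᶠ t in (U : Filter ℝ),
      ‖b t‖⁻¹ • b t ∈ Metric.sphere (0 : EuclideanSpace ℝ (Fin d)) 1 := by
    filter_upwards [hU hsrc] with t ht
    rw [mem_sphere_zero_iff_norm, norm_smul, norm_inv, norm_norm,
      inv_mul_cancel₀ (norm_ne_zero_iff.2 (hb0 t ht))]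
  obtain ⟨a, ha, haU⟩ := (isCompact_sphere (0 : EuclideanSpace ℝ (Fin d)) 1).ultrafilter_le_nhds
    (U.map fun t => ‖b t‖⁻¹ • b t) (le_principal_iff.2 hsph)
  have haU : Tendsto (fun t => ‖b t‖⁻¹ • b t) U (𝓝 a) := haU
  have hpsrc := mem_chart_source (EuclideanSpace ℝ (Fin d)) p
  have hfix := flow_fixed hf hψ hp
  have hev : ∀ t₁ : ℝ, Tendsto (fun t => flowDeriv d ψ p t₁ (ψ t x) (‖b t‖⁻¹ • b t)) U
      (𝓝 (flowDeriv d ψ p t₁ p a)) := fun t₁ =>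
    tendsto_clm_apply ((tendsto_flowDeriv hf hψ hp t₁).comp (hx.mono_left hU)) haU
  have hmem : ∀ n : ℕ, ∃ k ∈ K.coneAt p, (flowDeriv d ψ p T p ^ n) k = a := by
    intro n
    refine ⟨flowDeriv d ψ p (-(n * T)) p a, ?_, ?_⟩
    · have hxs : Tendsto (fun t => ψ (-(n * T)) (ψ t x)) U (𝓝 p) := by
        have := ((contMDiff_flow hf hψ (-(n * T))).continuous.tendsto p).comp (hx.mono_left hU)
        rwa [hfix] at this
      refine ConeField.mem_coneAt_of_tendsto (K := K) (p := p) (l := (U : Filter ℝ))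
        (x := fun t => ψ (-(n * T)) (ψ t x))
        (a := fun t => flowDeriv d ψ p (-(n * T)) (ψ t x) (‖b t‖⁻¹ • b t))
        (b := flowDeriv d ψ p (-(n * T)) p a) hxs (hev (-(n * T))) ?_
      have hs' := hxs.eventually ((chartAt (EuclideanSpace ℝ (Fin d)) p).open_source.mem_nhds
        hpsrc)
      filter_upwards [hU hsrc, hs', hU (eventually_ge_atTop ((n : ℝ) * T))] with t ht ht' htn
      have e : ψ (-(n * T)) (ψ t x) = ψ (t - n * T) x := by
        rw [← flow_add hf hψ]
        congr 1
        ring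
      have h1 := smul_field_mem_cone hf hψ hK (t := t - n * T) (by linarith) hcone
      rw [← e] at h1
      have h2 := tangentCoord_field_flow hf hψ ht ht'
      rw [tangentCoord_eq_toCoord ht'] at h2
      have h3 := K.smul_mem_localCone ‖b t‖⁻¹ (by positivity) _
        ((K.toCoord_mem_localCone ht').2 h1)
      have h4 : flowDeriv d ψ p (-(n * T)) (ψ t x) (‖b t‖⁻¹ • b t) =
          ‖b t‖⁻¹ • toCoord p (ψ (-(n * T)) (ψ t x)) (ε • f (ψ (-(n * T)) (ψ t x))) := by
        rw [map_smul, map_smul, hb, map_smul, h2]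
      change flowDeriv d ψ p (-(n * T)) (ψ t x) (‖b t‖⁻¹ • b t) ∈ _
      rw [h4]
      exact h3
    · have h1 := flowDeriv_add hf hψ (p := p) (x := p) (s := n * T) (t := -(n * T)) hpsrc
        (by rw [hfix]; exact hpsrc) (by rw [hfix]; exact hpsrc)
      rw [add_neg_cancel, flowDeriv_zero hψ hpsrc, hfix, flowDeriv_natCast_mul hf hψ hp] at h1
      exact (DFunLike.congr_fun h1 a).symm
  have haw := h.eq_smul_of_forall_pow (K.isPointedCone p) hmem
  have haK : a ∈ K.coneAt p := by
    obtain ⟨k, hk, hka⟩ := hmem 0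
    rw [pow_zero] at hka
    exact hka ▸ hk
  have han : ‖a‖ = 1 := by simpa using ha
  have hφa : 0 < φ a := h.apply_pos a haK (by rintro rfl; simp at han)
  have hw0 : 0 < ‖w‖ := norm_pos_iff.2 h.ne_zero
  have : φ a = ‖w‖⁻¹ := by
    have h1 : ‖a‖ = φ a * ‖w‖ := by
      conv_lhs => rw [haw, norm_smul, Real.norm_of_nonneg hφa.le]
    rw [han] at h1
    field_simp
    linarith
  rw [haw, this] at haU
  exact haU

/-- If the dominant rate is greater than one, then no orbit converges to `p` with its velocity in
the cones: the Perron functional of the velocity does not decrease along the orbit. -/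
theorem field_eq_zero_of_mem_cone
    (hf : ContMDiff (𝓡 d) (𝓡 d).tangent 2 (fun x => (⟨x, f x⟩ : TangentBundle (𝓡 d) M)))
    (hψ : IsCompleteFlow f ψ) (hK : DifferentiallyPositive ψ K) (hp : f p = 0) (hT : 0 < T)
    (h : IsPerronTriple (flowDeriv d ψ p T p) (K.coneAt p) μ w φ) (hμ : 1 < μ) {x : M}
    (hx : Tendsto (fun t => ψ t x) atTop (𝓝 p)) {ε : ℝ} (hε : ε ≠ 0)
    (hcone : ε • f x ∈ K.cone x) : f x = 0 := by
  by_contra hfx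
  set b : ℝ → EuclideanSpace ℝ (Fin d) := fun t => ε • tangentCoord p ⟨ψ t x, f (ψ t x)⟩ with hb
  obtain ⟨C, hC, hsec⟩ := K.exists_norm_le_localCone h.apply_pos
  have hD : ∀ᶠ y in 𝓝 p, ‖flowDeriv d ψ p T y - flowDeriv d ψ p T p‖ <
      (μ - 1) / (C * (‖φ‖ + 1)) := by
    have hδ : 0 < (μ - 1) / (C * (‖φ‖ + 1)) := div_pos (by linarith) (by positivity)
    filter_upwards [(tendsto_flowDeriv hf hψ hp T).eventually (Metric.ball_mem_nhds _ hδ)] with y hy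
    rw [← dist_eq_norm]
    exact Metric.mem_ball.1 hy
  obtain ⟨t₀, ht₀⟩ := eventually_atTop.1 ((hx.eventually ((hsec.and hD).and
    ((chartAt (EuclideanSpace ℝ (Fin d)) p).open_source.mem_nhds (mem_chart_source _ p)))).and
    (eventually_ge_atTop (0 : ℝ)))
  have hbK : ∀ t ≥ t₀, b t ∈ K.localCone p (ψ t x) := by
    intro t ht
    have h1 := smul_field_mem_cone hf hψ hK (ht₀ t ht).2 hcone
    have h2 := (K.toCoord_mem_localCone (ht₀ t ht).1.2).2 h1
    rw [map_smul, ← tangentCoord_eq_toCoord (ht₀ t ht).1.2] at h2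
    exact h2
  have hmono : ∀ t ≥ t₀, φ (b t) ≤ φ (b (t + T)) := by
    intro t ht
    obtain ⟨⟨⟨h1, h2⟩, hs⟩, -⟩ := ht₀ t ht
    have hs' := (ht₀ (t + T) (by linarith)).1.2
    have e : ψ T (ψ t x) = ψ (t + T) x := by rw [← flow_add hf hψ, add_comm]
    have h3 : b (t + T) = flowDeriv d ψ p T (ψ t x) (b t) := by
      have := tangentCoord_field_flow hf hψ (t := T) hs (by rwa [e])
      rw [e] at this
      rw [hb]
      simp only
      rw [this, map_smul]
    have h4 : φ (b (t + T)) = μ * φ (b t) +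
        φ ((flowDeriv d ψ p T (ψ t x) - flowDeriv d ψ p T p) (b t)) := by
      rw [h3, sub_apply, map_sub, h.apply_map]
      ring
    have h5 := (φ.le_opNorm ((flowDeriv d ψ p T (ψ t x) - flowDeriv d ψ p T p) (b t)))
    have h6 := ContinuousLinearMap.le_of_opNorm_le _ h2.le (b t)
    have h7 := h1 _ (hbK t ht)
    have hφ0 : 0 ≤ φ (b t) := nonneg_of_mul_nonneg_right ((norm_nonneg _).trans h7) hC
    have h8 : ‖φ ((flowDeriv d ψ p T (ψ t x) - flowDeriv d ψ p T p) (b t))‖ ≤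
        (μ - 1) * φ (b t) := by
      have hm : 0 ≤ (μ - 1) / (C * (‖φ‖ + 1)) := div_nonneg (by linarith) (by positivity)
      calc _ ≤ ‖φ‖ * ((μ - 1) / (C * (‖φ‖ + 1)) * (C * φ (b t))) :=
            h5.trans (by gcongr; exact h6.trans (by gcongr))
        _ ≤ (‖φ‖ + 1) * ((μ - 1) / (C * (‖φ‖ + 1)) * (C * φ (b t))) := by
            gcongr
            linarith
        _ = _ := by field_simp
    rw [Real.norm_eq_abs] at h8
    have := (abs_le.1 h8).1
    nlinarith
  have hpos : 0 < φ (b t₀) := by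
    have h1 := (ht₀ t₀ le_rfl).1.1.1 _ (hbK t₀ le_rfl)
    have hs := (ht₀ t₀ le_rfl).1.2
    have h0 : b t₀ ≠ 0 := by
      intro h0
      have h1 := (smul_eq_zero.1 h0).resolve_left hε
      rw [tangentCoord_eq_toCoord hs] at h1
      refine field_flow_ne_zero hf hψ hfx t₀ ?_
      rw [← ofCoord_toCoord hs (f (ψ t₀ x)), h1, map_zero]
    exact pos_of_mul_pos_right ((norm_pos_iff.2 h0).trans_le h1) hC.le
  have hle : ∀ n : ℕ, φ (b t₀) ≤ φ (b (t₀ + n * T)) := by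
    intro n
    induction n with
    | zero => simp
    | succ n ih =>
      refine ih.trans ((hmono _ (by nlinarith [n.cast_nonneg (α := ℝ)])).trans_eq ?_)
      congr 2
      push_cast
      ring
  have hlim : Tendsto b atTop (𝓝 0) := by
    have h1 : Tendsto (fun t => (⟨ψ t x, f (ψ t x)⟩ : TangentBundle (𝓡 d) M)) atTop
        (𝓝 ⟨p, f p⟩) := (hf.continuous.tendsto p).comp hx
    rw [hp] at h1
    have h2 : Tendsto (fun t => tangentCoord p ⟨ψ t x, f (ψ t x)⟩) atTop
        (𝓝 (0 : EuclideanSpace ℝ (Fin d))) := (tendsto_tangentBundle_iff.1 h1).2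
    have h3 := h2.const_smul ε
    rwa [smul_zero] at h3
  have htn : Tendsto (fun n : ℕ => t₀ + n * T) atTop atTop :=
    tendsto_atTop_add_const_left _ _ (tendsto_natCast_atTop_atTop.atTop_mul_const hT)
  have h1 := ((φ.continuous.tendsto 0).comp hlim).comp htn
  rw [map_zero] at h1
  exact absurd (ge_of_tendsto' h1 hle) (not_le.2 hpos)

end DiffPos

/-! ### The Perron–Frobenius vector at a fixed point -/

namespace DiffPos

lemma IsPointedCone.smul_mem_interior {E : Type*} [NormedAddCommGroup E] [NormedSpace ℝ E]
    {K : Set E} (hK : IsPointedCone K) {c : ℝ} (hc : 0 < c) {v : E} (hv : v ∈ interior K) :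
    c • v ∈ interior K := by
  have h1 : (fun x : E => c⁻¹ • x) ⁻¹' interior K ⊆ K := fun x hx => by
    have := hK.smul_mem c hc.le _ (interior_subset hx)
    rwa [smul_smul, mul_inv_cancel₀ hc.ne', one_smul] at this
  refine interior_maximal h1 (isOpen_interior.preimage (by fun_prop)) ?_
  rw [mem_preimage, smul_smul, inv_mul_cancel₀ hc.ne', one_smul]
  exact hv

variable {d : ℕ} {M : Type*} [TopologicalSpace M]
  [ChartedSpace (EuclideanSpace ℝ (Fin d)) M]

section

variable [Bundle.RiemannianBundle (fun x : M => TangentSpace (𝓡 d) x)] {p : M}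

/-- The Riemannian norm of a vector of the model space, viewed as a tangent vector at `p`. -/
noncomputable def fiberNorm (p : M) (v : TangentSpace (𝓡 d) p) : ℝ := ‖v‖

lemma fiberNorm_smul (c : ℝ) (v : EuclideanSpace ℝ (Fin d)) :
    fiberNorm p (c • v) = |c| * fiberNorm p v :=
  norm_smul (α := ℝ) (β := TangentSpace (𝓡 d) p) c v

lemma fiberNorm_pos {v : EuclideanSpace ℝ (Fin d)} (hv : v ≠ 0) : 0 < fiberNorm p v :=
  norm_pos_iff (E := TangentSpace (𝓡 d) p).2 hv

end

variable [IsManifold (𝓡 d) ∞ M]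
  {f : ∀ x : M, TangentSpace (𝓡 d) x} {ψ : ℝ → M → M} {K : ConeField d M}

lemma tendsto_norm_tangentBundle
    [Bundle.RiemannianBundle (fun x : M => TangentSpace (𝓡 d) x)]
    [IsContinuousRiemannianBundle (EuclideanSpace ℝ (Fin d))
      (fun x : M => TangentSpace (𝓡 d) x)] {α : Type*} {l : Filter α}
    {q : α → TangentBundle (𝓡 d) M} {r : TangentBundle (𝓡 d) M} (hq : Tendsto q l (𝓝 r)) :
    Tendsto (fun i => ‖(q i).2‖) l (𝓝 ‖r.2‖) := by
  have h1 : Continuous fun q : TangentBundle (𝓡 d) M => inner ℝ q.2 q.2 :=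
    Continuous.inner_bundle (F := EuclideanSpace ℝ (Fin d))
      (E := fun x : M => TangentSpace (𝓡 d) x)
      (b := fun q : TangentBundle (𝓡 d) M => q.1) (v := fun q => q.2) (w := fun q => q.2)
      continuous_id continuous_id
  have h2 : (fun q : TangentBundle (𝓡 d) M => ‖q.2‖) =
      fun q : TangentBundle (𝓡 d) M => Real.sqrt (inner ℝ q.2 q.2) := by
    funext q
    rw [real_inner_self_eq_norm_sq, Real.sqrt_sq (norm_nonneg _)]
  have h3 : Continuous fun q : TangentBundle (𝓡 d) M => ‖q.2‖ := by
    rw [h2]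
    exact h1.sqrt
  exact (h3.tendsto r).comp hq

variable [T2Space M] {p : M} {T μ : ℝ} {w : EuclideanSpace ℝ (Fin d)}
  {φ : EuclideanSpace ℝ (Fin d) →L[ℝ] ℝ}

lemma exists_isPerronTriple
    (hf : ContMDiff (𝓡 d) (𝓡 d).tangent 2 (fun x => (⟨x, f x⟩ : TangentBundle (𝓡 d) M)))
    (hψ : IsCompleteFlow f ψ) [Nontrivial (EuclideanSpace ℝ (Fin d))] (hp : f p = 0)
    (hT : ∀ v ∈ K.cone p, mfderiv (𝓡 d) (𝓡 d) (ψ T) p v ∈ interior (K.cone (ψ T p)) ∪ {0}) :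
    ∃ μ w φ, IsPerronTriple (flowDeriv d ψ p T p) (K.coneAt p) μ w φ := by
  obtain ⟨a, ha, ha0⟩ := K.exists_mem_localCone (p := p) (mem_chart_source _ p)
  have ha' : a ∈ K.coneAt p := by
    have : ofCoord p p a ∈ K.coneAt p := ha
    rwa [ofCoord_self] at this
  exact (K.isPointedCone p).exists_isPerronTriple
    (fun v hv hv0 => flowDeriv_mem_interior hf hψ hp hT hv hv0) ha' ha0

/-- At a fixed point, the cone pushed forward for time `s` is the preimage of the cone under the
derivative of `ψ (-s)`. -/
lemma mem_pushedCone_iff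
    (hf : ContMDiff (𝓡 d) (𝓡 d).tangent 2 (fun x => (⟨x, f x⟩ : TangentBundle (𝓡 d) M)))
    (hψ : IsCompleteFlow f ψ) (hp : f p = 0) {s : ℝ} {v : EuclideanSpace ℝ (Fin d)} :
    (v : TangentSpace (𝓡 d) p) ∈ pushedCone ψ K p s ↔ flowDeriv d ψ p (-s) p v ∈ K.coneAt p := by
  have hsrc := mem_chart_source (EuclideanSpace ℝ (Fin d)) p
  have hadd : ∀ s : ℝ, flowDeriv d ψ p s p * flowDeriv d ψ p (-s) p = 1 := fun s => by
    have h1 := flowDeriv_add hf hψ (p := p) (x := p) (s := s) (t := -s) hsrc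
      (by rwa [flow_fixed hf hψ hp]) (by rwa [flow_fixed hf hψ hp])
    rw [add_neg_cancel, flowDeriv_zero hψ hsrc, flow_fixed hf hψ hp] at h1
    exact h1.symm
  have hset : (v : TangentSpace (𝓡 d) p) ∈ pushedCone ψ K p s ↔
      ∃ u ∈ K.cone p, tangentMap (𝓡 d) (𝓡 d) (ψ s) (⟨p, u⟩ : TangentBundle (𝓡 d) M) =
        ⟨p, (v : TangentSpace (𝓡 d) p)⟩ := by
    unfold pushedCone
    rw [flow_fixed hf hψ hp (-s)]
    rfl
  rw [hset]
  constructor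
  · rintro ⟨u, hu, huv⟩
    have h1 := (tangentMap_flow_fixed hf hψ hp s u).symm.trans huv
    have h2 : flowDeriv d ψ p s p u = v :=
      (Bundle.TotalSpace.mk_inj (E := fun x : M => TangentSpace (𝓡 d) x)).1 h1
    have h3 := DFunLike.congr_fun (hadd (-s)) u
    rw [neg_neg] at h3
    rw [← h2]
    have h4 : flowDeriv d ψ p (-s) p (flowDeriv d ψ p s p u) = u := h3
    rw [h4]
    exact hu
  · intro h
    refine ⟨flowDeriv d ψ p (-s) p v, h, ?_⟩
    refine (tangentMap_flow_fixed hf hψ hp s _).trans ?_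
    exact congrArg (Bundle.TotalSpace.mk p) (DFunLike.congr_fun (hadd s) v)

/-- At a fixed point `p`, the pushed cones converge to the ray of the dominant eigenvector. -/
lemma pkTendsto_pushedCone
    (hf : ContMDiff (𝓡 d) (𝓡 d).tangent 2 (fun x => (⟨x, f x⟩ : TangentBundle (𝓡 d) M)))
    (hψ : IsCompleteFlow f ψ) (hK : DifferentiallyPositive ψ K) (hp : f p = 0) (hT : 0 < T)
    (h : IsPerronTriple (flowDeriv d ψ p T p) (K.coneAt p) μ w φ) :
    PKTendsto (V := EuclideanSpace ℝ (Fin d)) (fun s => pushedCone ψ K p s) atTop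
      {u | ∃ c : ℝ, 0 ≤ c ∧ u = c • w} := by
  have hsrc := mem_chart_source (EuclideanSpace ℝ (Fin d)) p
  have hfix := flow_fixed hf hψ hp
  have hadd : ∀ s t : ℝ, ∀ v, flowDeriv d ψ p (s + t) p v =
      flowDeriv d ψ p s p (flowDeriv d ψ p t p v) := fun s t v => by
    have h1 := flowDeriv_add hf hψ (p := p) (x := p) (s := s) (t := t) hsrc
      (by rwa [hfix]) (by rwa [hfix])
    rw [hfix] at h1
    exact DFunLike.congr_fun h1 v
  have hpos : ∀ s : ℝ, 0 ≤ s → ∀ v ∈ K.coneAt p, flowDeriv d ψ p s p v ∈ K.coneAt p := by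
    intro s hs v hv
    have h1 := hK p v hv s hs
    have h2 : (tangentMap (𝓡 d) (𝓡 d) (ψ s)
        (⟨p, (v : TangentSpace (𝓡 d) p)⟩ : TangentBundle (𝓡 d) M)) ∈
        {q : TangentBundle (𝓡 d) M | q.2 ∈ K.cone q.1} := h1
    rw [tangentMap_flow_fixed hf hψ hp] at h2
    exact h2
  have hneg : ∀ (s t : ℝ), s ≤ t → ∀ v, flowDeriv d ψ p (-t) p v ∈ K.coneAt p →
      flowDeriv d ψ p (-s) p v ∈ K.coneAt p := by
    intro s t hst v hv
    have := hpos (t - s) (by linarith) _ hv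
    rwa [← hadd, show t - s + -t = -s by ring] at this
  constructor
  · intro v hv
    have hall : ∀ s : ℝ, flowDeriv d ψ p (-s) p v ∈ K.coneAt p := by
      intro s
      by_contra hns
      have hU : {v | flowDeriv d ψ p (-s) p v ∈ K.coneAt p}ᶜ ∈ 𝓝 v :=
        ((K.isPointedCone p).isClosed.preimage
          (flowDeriv d ψ p (-s) p).continuous).isOpen_compl.mem_nhds hns
      obtain ⟨t, ⟨u, hu, hu'⟩, hst⟩ := ((hv _ hU).and_eventually (eventually_ge_atTop s)).exists
      exact hu' (hneg s t hst u ((mem_pushedCone_iff hf hψ hp).1 hu))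
    have hvw := h.eq_smul_of_forall_pow (K.isPointedCone p) (v := v) fun n =>
      ⟨_, hall (n * T), by
        rw [← flowDeriv_natCast_mul hf hψ hp, ← hadd, add_neg_cancel, flowDeriv_zero hψ hsrc]
        rfl⟩
    refine ⟨φ v, ?_, hvw⟩
    have hvK : v ∈ K.coneAt p := by
      have := hall 0
      rw [neg_zero, flowDeriv_zero hψ hsrc] at this
      exact this
    by_cases hv0 : v = 0
    · rw [hv0, map_zero]
    · exact (h.apply_pos v hvK hv0).le
  · rintro _ ⟨c, hc, rfl⟩ U hU
    filter_upwards with s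
    refine ⟨c • w, ?_, mem_of_mem_nhds hU⟩
    refine (mem_pushedCone_iff hf hψ hp).2 ?_
    obtain ⟨n, hn⟩ := exists_nat_ge (s / T)
    refine hneg s (n * T) ((div_le_iff₀ hT).1 hn) _ ?_
    have h1 : ∀ n : ℕ, flowDeriv d ψ p (-(n * T)) p w = μ⁻¹ ^ n • w := by
      intro n
      have h2 : ∀ n : ℕ, (flowDeriv d ψ p T p ^ n) w = μ ^ n • w := by
        intro n
        induction n with
        | zero => simp
        | succ n ih => rw [pow_succ', mul_apply_eq_comp, ih, map_smul, h.map_eq,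
             smul_smul, pow_succ]
      have h3 := hadd (-(n * T)) (n * T) w
      rw [neg_add_cancel, flowDeriv_zero hψ hsrc, flowDeriv_natCast_mul hf hψ hp,
        h2, map_smul] at h3
      have h4 : w = μ ^ n • flowDeriv d ψ p (-(n * T)) p w := h3
      conv_rhs => rw [h4]
      rw [smul_smul, ← mul_pow, inv_mul_cancel₀ h.pos.ne', one_pow, one_smul]
    rw [map_smul, h1]
    have hw := interior_subset h.mem_interior
    exact K.smul_mem p c hc _ (K.smul_mem p _ (pow_nonneg (inv_nonneg.2 h.pos.le) n) _ hw)

variable [Bundle.RiemannianBundle (fun x : M => TangentSpace (𝓡 d) x)]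

/-- The Perron–Frobenius vector at a fixed point is the normalized dominant eigenvector. -/
theorem perronFrobenius_eq
    (hf : ContMDiff (𝓡 d) (𝓡 d).tangent 2 (fun x => (⟨x, f x⟩ : TangentBundle (𝓡 d) M)))
    (hψ : IsCompleteFlow f ψ) (hK : DifferentiallyPositive ψ K) (hp : f p = 0) (hT : 0 < T)
    (h : IsPerronTriple (flowDeriv d ψ p T p) (K.coneAt p) μ w φ) :
    (perronFrobenius ψ K p : EuclideanSpace ℝ (Fin d)) = (fiberNorm p w)⁻¹ • w := by
  have hW0 := fiberNorm_pos (p := p) h.ne_zero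
  have hpk := pkTendsto_pushedCone hf hψ hK hp hT h
  set V : EuclideanSpace ℝ (Fin d) := (fiberNorm p w)⁻¹ • w with hV
  have hV1 : fiberNorm p V = 1 := by
    rw [hV, fiberNorm_smul, abs_of_pos (inv_pos.2 hW0), inv_mul_cancel₀ hW0.ne']
  have hray : {u : EuclideanSpace ℝ (Fin d) | ∃ c : ℝ, 0 ≤ c ∧ u = c • V} =
      {u | ∃ c : ℝ, 0 ≤ c ∧ u = c • w} := by
    ext u
    constructor
    · rintro ⟨c, hc, rfl⟩
      exact ⟨c * (fiberNorm p w)⁻¹, by positivity, smul_smul _ _ _⟩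
    · rintro ⟨c, hc, rfl⟩
      refine ⟨c * fiberNorm p w, by positivity, ?_⟩
      rw [hV, smul_smul, mul_assoc, mul_inv_cancel₀ hW0.ne', mul_one]
  rw [← hray] at hpk
  have hex : IsPerronFrobeniusVector ψ K p V :=
    ⟨(K.isPointedCone p).smul_mem_interior (inv_pos.2 hW0) h.mem_interior, hV1, hpk⟩
  have hne : ∃ v, IsPerronFrobeniusVector ψ K p v := ⟨_, hex⟩
  have hval : perronFrobenius ψ K p = hne.choose := by
    unfold perronFrobenius
    rw [dif_pos hne]
  obtain ⟨-, hv1, hv⟩ := hne.choose_spec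
  rw [hval]
  obtain ⟨c, hc, hvc⟩ := hpk.1 hne.choose fun U hU =>
    (hv.2 hne.choose ⟨1, zero_le_one, (one_smul _ _).symm⟩ U hU).frequently
  have hc1 : fiberNorm p (c • V) = 1 := (congrArg (fiberNorm p) hvc).symm.trans hv1
  rw [fiberNorm_smul, hV1, mul_one, abs_of_nonneg hc] at hc1
  exact hvc.trans (by rw [hc1, one_smul])

/-- An orbit that converges to `p` with its velocity in the cones, up to sign, is tangent to the
Perron–Frobenius vector. -/
theorem orbitTangentAt_of_mem_cone [IsContinuousRiemannianBundle (EuclideanSpace ℝ (Fin d))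
      (fun x : M => TangentSpace (𝓡 d) x)]
    (hf : ContMDiff (𝓡 d) (𝓡 d).tangent 2 (fun x => (⟨x, f x⟩ : TangentBundle (𝓡 d) M)))
    (hψ : IsCompleteFlow f ψ) (hK : DifferentiallyPositive ψ K) (hp : f p = 0) (hT : 0 < T)
    (h : IsPerronTriple (flowDeriv d ψ p T p) (K.coneAt p) μ w φ) {x : M}
    (hx : Tendsto (fun t => ψ t x) atTop (𝓝 p)) (hfx : f x ≠ 0) {ε : ℝ} (hε : ε = 1 ∨ ε = -1)
    (hcone : ε • f x ∈ K.cone x) : OrbitTangentAt f ψ x atTop p (perronFrobenius ψ K p) := by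
  have hε0 : ε ≠ 0 := by rcases hε with rfl | rfl <;> norm_num
  have hεε : ε * ε = 1 := by rcases hε with rfl | rfl <;> norm_num
  refine ⟨ε, hε, ?_⟩
  have hW0 := fiberNorm_pos (p := p) h.ne_zero
  have hw0 : 0 < ‖w‖ := norm_pos_iff.2 h.ne_zero
  have hdir := tendsto_direction hf hψ hK hp h hx hfx hε0 hcone
  set u : ℝ → EuclideanSpace ℝ (Fin d) := fun t => tangentCoord p ⟨ψ t x, f (ψ t x)⟩ with hu
  have hsrc : ∀ᶠ t in atTop, ψ t x ∈ (chartAt (EuclideanSpace ℝ (Fin d)) p).source :=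
    hx.eventually ((chartAt (EuclideanSpace ℝ (Fin d)) p).open_source.mem_nhds
      (mem_chart_source _ p))
  -- the Riemannian length of the velocity, relative to its length in the chart
  have hnorm : Tendsto (fun t => ‖ε • u t‖⁻¹ * ‖f (ψ t x)‖) atTop (𝓝 (‖w‖⁻¹ * fiberNorm p w)) := by
    have h1 := tendsto_norm_tangentBundle (tendsto_ofCoord hx hdir)
    have h2 : fiberNorm p (‖w‖⁻¹ • w) = ‖w‖⁻¹ * fiberNorm p w := by
      rw [fiberNorm_smul, abs_of_pos (inv_pos.2 hw0)]
    have h3 : Tendsto (fun t => ‖ofCoord p (ψ t x) (‖ε • u t‖⁻¹ • (ε • u t))‖) atTop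
        (𝓝 (‖w‖⁻¹ * fiberNorm p w)) := by
      rw [← h2]
      exact h1
    refine h3.congr' ?_
    filter_upwards [hsrc] with t ht
    have h4 : ofCoord p (ψ t x) (u t) = f (ψ t x) := by
      rw [hu]
      simp only
      rw [tangentCoord_eq_toCoord ht, ofCoord_toCoord ht]
    rw [map_smul, map_smul, h4, norm_smul, norm_inv, norm_norm, norm_smul ε (f (ψ t x)),
      Real.norm_eq_abs, show |ε| = 1 by rcases hε with rfl | rfl <;> simp, one_mul]
  refine tendsto_tangentBundle_iff.2 ⟨hx, ?_⟩
  have hlim := ((hnorm.inv₀ (by positivity)).smul hdir).const_smul ε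
  have e1 : ε • (‖w‖⁻¹ * fiberNorm p w)⁻¹ • ‖w‖⁻¹ • w =
      ε • (perronFrobenius ψ K p : EuclideanSpace ℝ (Fin d)) := by
    rw [perronFrobenius_eq hf hψ hK hp hT h, smul_smul ((‖w‖⁻¹ * fiberNorm p w)⁻¹)]
    congr 2
    field_simp
  rw [e1] at hlim
  refine Tendsto.congr' ?_ hlim
  filter_upwards [hsrc] with t ht
  have hu0 : ε • u t ≠ 0 := by
    intro h0
    have h1 := (smul_eq_zero.1 h0).resolve_left hε0
    simp only [hu] at h1
    rw [tangentCoord_eq_toCoord ht] at h1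
    refine field_flow_ne_zero hf hψ hfx t ?_
    rw [← ofCoord_toCoord ht (f (ψ t x)), h1, map_zero]
  have hn0 : ‖ε • u t‖ ≠ 0 := norm_ne_zero_iff.2 hu0
  have h5 : tangentCoord p ⟨ψ t x, ‖f (ψ t x)‖⁻¹ • f (ψ t x)⟩ = ‖f (ψ t x)‖⁻¹ • u t := by
    simp only [hu]
    rw [tangentCoord_eq_toCoord ht, tangentCoord_eq_toCoord ht, map_smul]
  rw [h5, mul_inv, inv_inv, smul_smul, smul_smul, smul_smul]
  congr 1
  have : ‖ε • u t‖ * ‖f (ψ t x)‖⁻¹ * ‖ε • u t‖⁻¹ = ‖f (ψ t x)‖⁻¹ := by field_simp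
  calc ε * (‖ε • u t‖ * ‖f (ψ t x)‖⁻¹) * ‖ε • u t‖⁻¹ * ε
      = (ε * ε) * (‖ε • u t‖ * ‖f (ψ t x)‖⁻¹ * ‖ε • u t‖⁻¹) := by ring
    _ = _ := by rw [this, hεε, one_mul]

/-- Along a backward orbit that is tangent to the Perron–Frobenius vector at `p`, the velocity stays
in a sector of the Perron functional. -/
lemma exists_norm_le_of_orbitTangentAt
    (hf : ContMDiff (𝓡 d) (𝓡 d).tangent 2 (fun x => (⟨x, f x⟩ : TangentBundle (𝓡 d) M)))
    (hψ : IsCompleteFlow f ψ) (hK : DifferentiallyPositive ψ K) (hp : f p = 0) (hT : 0 < T)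
    (h : IsPerronTriple (flowDeriv d ψ p T p) (K.coneAt p) μ w φ) {x : M} (hfx : f x ≠ 0)
    {l : Filter ℝ} (hx : OrbitTangentAt f ψ x l p (perronFrobenius ψ K p)) :
    ∃ C : ℝ, 0 < C ∧ ∀ᶠ t in l, ‖tangentCoord p ⟨ψ t x, f (ψ t x)⟩‖ ≤
      C * |φ (tangentCoord p ⟨ψ t x, f (ψ t x)⟩)| := by
  obtain ⟨ε, hε, hlim⟩ := hx
  have hε0 : ε ≠ 0 := by rcases hε with rfl | rfl <;> norm_num
  have hW0 := fiberNorm_pos (p := p) h.ne_zero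
  obtain ⟨hx, hlim⟩ := tendsto_tangentBundle_iff.1 hlim
  set b : EuclideanSpace ℝ (Fin d) := ε • (perronFrobenius ψ K p : EuclideanSpace ℝ (Fin d))
    with hb
  have hlim : Tendsto (fun t => tangentCoord p ⟨ψ t x, ‖f (ψ t x)‖⁻¹ • f (ψ t x)⟩) l (𝓝 b) := hlim
  have hφb : 0 < |φ b| := by
    have hbw : b = (ε * (fiberNorm p w)⁻¹) • w := by
      rw [mul_smul]
      exact congrArg (ε • ·) (perronFrobenius_eq hf hψ hK hp hT h)
    rw [hbw, map_smul, h.apply_self, abs_pos, smul_eq_mul, mul_one]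
    exact mul_ne_zero hε0 (inv_ne_zero hW0.ne')
  have hC : 0 < ‖b‖ / |φ b| + 1 := by positivity
  refine ⟨‖b‖ / |φ b| + 1, hC, ?_⟩
  have hlt : ‖b‖ < (‖b‖ / |φ b| + 1) * |φ b| := by
    rw [add_mul, div_mul_cancel₀ _ hφb.ne', one_mul]
    linarith
  have hev := hlim.norm.eventually_lt
    ((((φ.continuous.tendsto b).comp hlim).abs).const_mul (‖b‖ / |φ b| + 1)) hlt
  have hsrc : ∀ᶠ t in l, ψ t x ∈ (chartAt (EuclideanSpace ℝ (Fin d)) p).source :=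
    hx.eventually ((chartAt (EuclideanSpace ℝ (Fin d)) p).open_source.mem_nhds
      (mem_chart_source _ p))
  filter_upwards [hev, hsrc] with t ht hs
  have hn : 0 < ‖f (ψ t x)‖ := norm_pos_iff.2 (field_flow_ne_zero hf hψ hfx t)
  have h5 : tangentCoord p ⟨ψ t x, ‖f (ψ t x)‖⁻¹ • f (ψ t x)⟩ =
      ‖f (ψ t x)‖⁻¹ • tangentCoord p ⟨ψ t x, f (ψ t x)⟩ := by
    rw [tangentCoord_eq_toCoord hs, tangentCoord_eq_toCoord hs, map_smul]
  set c := ‖b‖ / |φ b| + 1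
  rw [Function.comp, h5, map_smul, norm_smul, smul_eq_mul, abs_mul, Real.norm_eq_abs,
    mul_left_comm] at ht
  exact (le_of_mul_le_mul_left ht.le (abs_pos.2 (inv_ne_zero hn.ne')))

end DiffPos

/-! ### Heteroclinic and homoclinic orbits -/

namespace DiffPos

variable {d : ℕ} {M : Type*} [TopologicalSpace M]
  [ChartedSpace (EuclideanSpace ℝ (Fin d)) M] [IsManifold (𝓡 d) ∞ M] [T2Space M]
  {f : ∀ x : M, TangentSpace (𝓡 d) x} {ψ : ℝ → M → M} {K : ConeField d M} {T : ℝ}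

/-- Backwards in time the velocity of a homoclinic orbit tends to zero, which together with the
spectral gap places it in the cones up to sign; forwards in time it could then not tend to zero,
as the dominant eigenvalue is greater than one. -/
theorem not_homoclinic
    (hf : ContMDiff (𝓡 d) (𝓡 d).tangent 2 (fun x => (⟨x, f x⟩ : TangentBundle (𝓡 d) M)))
    (hψ : IsCompleteFlow f ψ) (hK : DifferentiallyPositive ψ K) (hT : 0 < T)
    (hKT : ∀ p, ∀ v ∈ K.cone p,
      mfderiv (𝓡 d) (𝓡 d) (ψ T) p v ∈ interior (K.cone (ψ T p)) ∪ {0})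
    {p : M} (hp : IsHyperbolicFixedPoint f p) (hp1 : unstableDim f p = 1) {x : M}
    (hbot : Tendsto (fun t => ψ t x) atBot (𝓝 p)) (htop : Tendsto (fun t => ψ t x) atTop (𝓝 p)) :
    x = p := by
  by_cases hfx : f x = 0
  · have : (fun t => ψ t x) = fun _ => x := funext fun t => flow_fixed hf hψ hfx t
    rw [this] at htop
    exact tendsto_nhds_unique tendsto_const_nhds htop
  exfalso
  have : Nontrivial (EuclideanSpace ℝ (Fin d)) := ⟨⟨f x, 0, hfx⟩⟩
  obtain ⟨μ, w, φ, h⟩ := exists_isPerronTriple hf hψ hp.1 (hKT p)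
  have h' := h
  rw [flowDeriv_eq_exp hf hψ hp.1] at h'
  obtain ⟨hμ, hz⟩ := h'.one_lt_and_tendsto_zero hT hp.2 hp1
  rw [← flowDeriv_eq_exp hf hψ hp.1] at hz
  have hG : Tendsto (fun n : ℕ => flowDeriv d ψ p T p ^ n - μ ^ n • φ.smulRight w) atTop
      (𝓝 0) := by
    refine tendsto_clm_of_forall_apply fun v => ?_
    refine (hz (v - φ v • w) (by simp [h.apply_self])).congr fun n => ?_
    have hw : ∀ n : ℕ, (flowDeriv d ψ p T p ^ n) w = μ ^ n • w := by
      intro n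
      induction n with
      | zero => simp
      | succ n ih => rw [pow_succ', mul_apply_eq_comp, ih, map_smul, h.map_eq, smul_smul, pow_succ]
    rw [map_sub, map_smul, hw, sub_apply, smul_apply, ContinuousLinearMap.smulRight_apply,
      smul_comm]
  have hev := hG.norm.eventually_lt tendsto_const_nhds
    (show ‖(0 : EuclideanSpace ℝ (Fin d) →L[ℝ] EuclideanSpace ℝ (Fin d))‖ < (1 : ℝ) / 8 by
      rw [norm_zero]; norm_num)
  obtain ⟨N, ⟨hN1, hN2⟩, hN⟩ := ((hev.and
    ((tendsto_pow_atTop_atTop_of_one_lt hμ).eventually_ge_atTop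
    2)).and (eventually_gt_atTop 0)).exists
  obtain ⟨ε, hε, hεK⟩ := exists_smul_field_mem_cone hf hψ hK hp.1 hT h hbot hN one_pos
    (by linarith) (fun v => by
      have h1 := ContinuousLinearMap.le_of_opNorm_le _ hN1.le v
      rw [sub_apply, smul_apply, ContinuousLinearMap.smulRight_apply, smul_smul] at h1
      exact h1)
    (by
      have ht : Tendsto (fun n : ℕ => -((n : ℝ) * (N * T))) atTop atBot :=
        tendsto_neg_atTop_atBot.comp
          (tendsto_natCast_atTop_atTop.atTop_mul_const (by positivity))
      have h1 : Tendsto (fun t => (⟨ψ t x, f (ψ t x)⟩ : TangentBundle (𝓡 d) M)) atBot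
          (𝓝 ⟨p, f p⟩) := (hf.continuous.tendsto p).comp hbot
      rw [hp.1] at h1
      have h2 : Tendsto (fun t => tangentCoord p ⟨ψ t x, f (ψ t x)⟩) atBot
          (𝓝 (0 : EuclideanSpace ℝ (Fin d))) := (tendsto_tangentBundle_iff.1 h1).2
      have h3 := (h2.comp ht).norm
      rw [norm_zero] at h3
      simpa using! h3)
  exact hfx (field_eq_zero_of_mem_cone hf hψ hK hp.1 hT h hμ htop
    (by rcases hε with rfl | rfl <;> norm_num) hεK)

/-- Tangency at the backward limit makes the velocity decay at the dominant rate, which places it in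
the cones up to sign; forwards in time, cone vectors align with the Perron–Frobenius vector.
Neither fixed point has to be hyperbolic. -/
theorem orbitTangentAt_atTop_of_atBot
    [Bundle.RiemannianBundle (fun x : M => TangentSpace (𝓡 d) x)]
    [IsContinuousRiemannianBundle (EuclideanSpace ℝ (Fin d)) (fun x : M => TangentSpace (𝓡 d) x)]
    (hf : ContMDiff (𝓡 d) (𝓡 d).tangent 2 (fun x => (⟨x, f x⟩ : TangentBundle (𝓡 d) M)))
    (hψ : IsCompleteFlow f ψ) (hK : DifferentiallyPositive ψ K) (hT : 0 < T)
    (hKT : ∀ p, ∀ v ∈ K.cone p,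
      mfderiv (𝓡 d) (𝓡 d) (ψ T) p v ∈ interior (K.cone (ψ T p)) ∪ {0})
    {y z : M} (hy : f y = 0) (hz : f z = 0) {x : M}
    (hbot : Tendsto (fun t => ψ t x) atBot (𝓝 y)) (htop : Tendsto (fun t => ψ t x) atTop (𝓝 z))
    (htan : OrbitTangentAt f ψ x atBot y (perronFrobenius ψ K y)) :
    OrbitTangentAt f ψ x atTop z (perronFrobenius ψ K z) := by
  by_cases hfx : f x = 0
  · have hconst : ∀ t, ψ t x = x := flow_fixed hf hψ hfx
    simp only [hconst] at hbot htop
    obtain rfl := tendsto_nhds_unique tendsto_const_nhds hbot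
    obtain rfl := tendsto_nhds_unique tendsto_const_nhds htop
    obtain ⟨ε, hε, hlim⟩ := htan
    refine ⟨ε, hε, ?_⟩
    have hc : (fun t => (⟨ψ t x, ‖f (ψ t x)‖⁻¹ • f (ψ t x)⟩ : TangentBundle (𝓡 d) M)) =
        fun _ => ⟨x, ‖f x‖⁻¹ • f x⟩ := funext fun t => by rw [hconst]
    rw [hc, Tendsto, Filter.map_const] at hlim ⊢
    exact hlim
  have : Nontrivial (EuclideanSpace ℝ (Fin d)) := ⟨⟨f x, 0, hfx⟩⟩
  obtain ⟨μ, w, φ, h⟩ := exists_isPerronTriple hf hψ hy (hKT y)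
  obtain ⟨μ', w', φ', h'⟩ := exists_isPerronTriple hf hψ hz (hKT z)
  have hμ := h.pos
  have hG : Tendsto (fun n : ℕ => μ⁻¹ ^ n • flowDeriv d ψ y T y ^ n) atTop
      (𝓝 (φ.smulRight w)) := tendsto_clm_of_forall_apply h.tendsto
  have hev := (hG.sub_const (φ.smulRight w)).norm.eventually_lt tendsto_const_nhds
    (show ‖φ.smulRight w - φ.smulRight w‖ < (1 : ℝ) / 16 by
      rw [sub_self, norm_zero]; norm_num)
  obtain ⟨N, hN1, hN⟩ := (hev.and (eventually_gt_atTop 0)).exists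
  have hμN : 0 < μ ^ N := by positivity
  obtain ⟨C, hC, hsec⟩ := exists_norm_le_of_orbitTangentAt hf hψ hK hy hT h hfx htan
  obtain ⟨ε, hε, hεK⟩ := exists_smul_field_mem_cone hf hψ hK hy hT h hbot hN (ρ := μ ^ N / 2)
    (by positivity) (by linarith)
    (fun v => by
      have h1 := ContinuousLinearMap.le_of_opNorm_le _ hN1.le v
      rw [sub_apply, smul_apply, ContinuousLinearMap.smulRight_apply] at h1
      have h2 : (flowDeriv d ψ y T y ^ N) v - (μ ^ N * φ v) • w =
          μ ^ N • (μ⁻¹ ^ N • (flowDeriv d ψ y T y ^ N) v - φ v • w) := by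
        rw [smul_sub, smul_smul, smul_smul, inv_pow, mul_inv_cancel₀ hμN.ne', one_smul]
      rw [h2, norm_smul, Real.norm_of_nonneg hμN.le]
      calc _ ≤ μ ^ N * (1 / 16 * ‖v‖) := by gcongr
        _ = _ := by ring)
    (tendsto_field_backward hf hψ hy hbot (by positivity) (by positivity) (ν := μ ^ N)
      (by linarith)
      (fun v => by rw [flowDeriv_natCast_mul hf hψ hy, h.apply_pow]) hC hsec)
  exact orbitTangentAt_of_mem_cone hf hψ hK hz hT h' htop hfx hε hεK

end DiffPos

theorem mainTheorem7 {d : ℕ} {M : Type*} [MetricSpace M] [SecondCountableTopology M]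
    [ConnectedSpace M] [CompleteSpace M]
    [ChartedSpace (EuclideanSpace ℝ (Fin d)) M] [IsManifold (𝓡 d) ∞ M]
    [Bundle.RiemannianBundle (fun x : M => TangentSpace (𝓡 d) x)]
    [IsContMDiffRiemannianBundle (𝓡 d) ∞ (EuclideanSpace ℝ (Fin d))
      (fun x : M => TangentSpace (𝓡 d) x)]
    [IsRiemannianManifold (𝓡 d) M]
    (f : ∀ x : M, TangentSpace (𝓡 d) x)
    (hf : ContMDiff (𝓡 d) (𝓡 d).tangent 2 (fun x => (⟨x, f x⟩ : TangentBundle (𝓡 d) M)))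
    (ψ : ℝ → M → M) (hψ : DiffPos.IsCompleteFlow f ψ)
    (K : DiffPos.ConeField d M)
    (hK : DiffPos.StrictlyDifferentiallyPositive ψ K)
    (hcomplete : ∀ x : M, DiffPos.HilbertComplete (K.cone x) {v | v ∈ K.cone x ∧ ‖v‖ = 1})
    (hbounded : ∀ x : M, Bornology.IsBounded ((fun t => ψ t x) '' Ici 0)) :
    (∀ y z x : M,
      DiffPos.IsHyperbolicFixedPoint f y → DiffPos.IsHyperbolicFixedPoint f z →
      Tendsto (fun t => ψ t x) atBot (𝓝 y) → Tendsto (fun t => ψ t x) atTop (𝓝 z) →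
      DiffPos.OrbitTangentAt f ψ x atBot y (DiffPos.perronFrobenius ψ K y) →
      DiffPos.OrbitTangentAt f ψ x atTop z (DiffPos.perronFrobenius ψ K z)) ∧
    (∀ p : M, DiffPos.IsHyperbolicFixedPoint f p → DiffPos.unstableDim f p = 1 →
      ¬ ∃ x : M, x ≠ p ∧ Tendsto (fun t => ψ t x) atBot (𝓝 p) ∧
        Tendsto (fun t => ψ t x) atTop (𝓝 p)) := by
  obtain ⟨hpos, T, hT, R, hR, -, hstrict⟩ := hK
  have hKT : ∀ p, ∀ v ∈ K.cone p,
      mfderiv (𝓡 d) (𝓡 d) (ψ T) p v ∈ interior (K.cone (ψ T p)) ∪ {0} :=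
    fun p v hv => hR _ (hstrict p v hv T le_rfl)
  have : IsContinuousRiemannianBundle (EuclideanSpace ℝ (Fin d))
      (fun x : M => TangentSpace (𝓡 d) x) := by
    obtain ⟨g, hg, hi⟩ := IsContMDiffRiemannianBundle.exists_contMDiff (IB := 𝓡 d) (n := ∞)
      (F := EuclideanSpace ℝ (Fin d)) (E := fun x : M => TangentSpace (𝓡 d) x)
    exact ⟨g, hg.continuous, hi⟩
  exact ⟨fun y z x hy hz hbot htop htan => DiffPos.orbitTangentAt_atTop_of_atBot hf hψ hpos hT hKT
      hy.1 hz.1 hbot htop htan,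
    fun p hp hp1 ⟨x, hxp, hbot, htop⟩ => hxp
      (DiffPos.not_homoclinic hf hψ hpos hT hKT hp hp1 hbot htop)⟩
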